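/- Setting. A managed multi-context system (MCS) $M$ consists of finitely many contexts $C_i$ ($1\le i\le n$), each with a logic (knowledge bases $\mathsf{KB}_i$, belief sets $\mathsf{BS}_i$, a map $\mathsf{ACC}_i:\mathsf{KB}_i\to 2^{\mathsf{BS}_i}$), a knowledge base $\mathsf{kb}_i$, bridge rules with an import domain, operation names $\mathsf{OP}_i$, and a management function $\mathsf{mng}_i:\wp(\mathsf{OP}_i\times\bigcup\mathsf{KB}_i)\times\mathsf{KB}_i\to\mathsf{KB}_i$. A belief state $(S_i)_i$ is an equilibrium if, for every $i$, $S_i\in\mathsf{ACC}_i(\mathsf{mng}_i(H_i,\mathsf{kb}_i))$, where $H_i$ is the set of heads of the ground bridge rules of $C_i$ applicable in $S$; $M$ is logically consistent if it has an equilibrium. An active integrity constraint (AIC) $r$ has a body of positive and negated beliefs of contexts, such that the variables of the negated beliefs occur in the positive ones, and a head, a finite list of update actions $(j:\alpha)$ with $\alpha\in\mathsf{OP}_j\times\bigcup\mathsf{KB}_j$. Let $\eta$ be a finite set of AICs with finitely many closed instances, and call $R$ the set of these. $M\models R$ means that some equilibrium falsifies the bodies of all rules of $R$ (weak satisfaction),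 or that $M$ is logically consistent and every equilibrium falsifies them (strong satisfaction); the result holds for either notion. For a set $U$ of ground update actions, $U(M)$ is $M$ with each $\mathsf{kb}_i$ replaced by $\mathsf{mng}_i(U_i,\mathsf{kb}_i)$, where $U_i$ is the set of actions of $U$ that affect $C_i$. A finite $U$ is consistent w.r.t. $M$ if, for each $i$, applying the actions of $U_i$ to $\mathsf{kb}_i$ one at a time, in any order, also gives $\mathsf{mng}_i(U_i,\mathsf{kb}_i)$. A grounded repair for $\langle M,\eta\rangle$ is a finite $U$, consistent w.r.t. $M$, with $U(M)\models R$, such that for every $V\subsetneq U$ there is $r\in R$ with $V(M)\not\models r$ and $\mathsf{head}(r)\cap(U\setminus V)\ne\emptyset$. The root of the repair tree is $\emptyset$; a consistent node $N$ and an $r\in R$ with $N(M)\not\models r$ give a child $N'=N\cup W$ for each $W\subseteq\mathsf{head}(r)$ such that $N'(M)\models r$ and $(N\cup W')(M)\not\models r$ for all $W'\subsetneq W$. Here a node $N$ is consistent if $N(M)$ is logically consistent and, when $N$ has a parent $P$, $N$ is consistent w.r.t. $P(M)$. Let $\mathcal C$ be a class of MCSs that are represented by words, as are their beliefs and update actions.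 The grounded repair problem for $\mathcal C$ asks, given $M\in\mathcal C$ and $\eta$, whether a grounded repair for $\langle M,\eta\rangle$ exists; the input consists of the representation of $M$ and the list of the closed instances of $\eta$. Theorem. 1. The depth of the repair tree for $\langle M,\eta\rangle$ is at most the sum of the lengths of the heads of the closed instances of $\eta$. 2. Let $A$ be an oracle such that, in polynomial time relative to $A$, one can decide whether an MCS $U(M)$, given by $M\in\mathcal C$ and a finite set $U$ of update actions, satisfies a given finite set of ground AICs. Suppose that consistency of $U$ w.r.t. $M$ is in $\mathrm{coNP}^A$. Then the grounded repair problem for $\mathcal C$ is in $\Sigma_2^{P,A}=\mathrm{NP}^{\mathrm{NP}^A}$. 3. Suppose that $\mathcal C$ contains the MCS $M(DB)$ of every database $DB$ (a finite set of ground atoms), with a representation that is computable from $DB$ in polynomial time. Here $M(DB)$ has a single context with knowledge base $DB$ and no bridge rules, the actions $+a$ and $-a$ add and remove the atom $a$, and the only acceptable belief set is the set of literals true in the database. Then the grounded repair problem for $\mathcal C$ is $\Sigma_2^P$-hard under polynomial-time many-one reductions that use no oracle. This holds even when the inputs are restricted to MCSs $M(DB)$ with ground database AICs, whose heads are nonempty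 and consist of actions $-p$ for positive body atoms $p$ and $+p$ for negated body atoms $p$. So, for a class that satisfies the hypotheses of 2 and 3, the problem is $\Sigma^P_2$-complete given the oracle. -/

import Mathlib

namespace MCSRepair

/-! ## Words and their encodings -/

/-- Words over the binary alphabet. -/
abbrev Word : Type := List Bool

/-- Self-delimiting code of a word: each bit `b` becomes `1b`, and the end is marked by `0`. -/
def encWord : Word → Word
  | [] => [false]
  | b :: w => true :: b :: encWord w

/-- Code of a finite sequence of words. -/
def encList : List Word → Word
  | [] => []
  | w :: l => encWord w ++ encList l

theorem encWord_append_inj : ∀ {u v s t : Word},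
    encWord u ++ s = encWord v ++ t → u = v ∧ s = t
  | [], [], s, t, h => by simpa [encWord] using h
  | [], b :: v, s, t, h => by simp [encWord] at h
  | b :: u, [], s, t, h => by simp [encWord] at h
  | b :: u, c :: v, s, t, h => by
      simp only [encWord, List.cons_append, List.cons.injEq, true_and] at h
      obtain ⟨hbc, h⟩ := h
      obtain ⟨huv, hst⟩ := encWord_append_inj h
      exact ⟨by rw [hbc, huv], hst⟩

theorem encList_injective : Function.Injective encList := by
  intro l
  induction l with
  | nil =>
      intro m h
      cases m with
      | nil => rfl
      | cons v m => cases v <;> simp [encList, encWord] at h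
  | cons u l ih =>
      intro m h
      cases m with
      | nil => cases u <;> simp [encList, encWord] at h
      | cons v m =>
          obtain ⟨h1, h2⟩ := encWord_append_inj (s := encList l) (t := encList m) h
          rw [h1, ih h2]

/-! ## Machines with an oracle, and their running time

Programs over finitely many stacks of bits. Every elementary operation (push, pop, test,
oracle query) costs one step; the model is polynomially equivalent to multi-tape oracle Turing
machines. -/

/-- Programs. Stacks are numbered by natural numbers. -/
inductive Prog : Type
  /-- do nothing -/
  | skip : Prog
  /-- push the bit `b` on stack `r` -/
  | push (r : ℕ) (b : Bool) : Prog
  /-- remove the top of stack `r` (no effect if it is empty) -/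
  | pop (r : ℕ) : Prog
  /-- push on stack `r` the oracle's answer for the word on stack `q` -/
  | query (q r : ℕ) : Prog
  /-- sequential composition -/
  | seq (p₁ p₂ : Prog) : Prog
  /-- branch according to stack `r` being empty, having top `false`, or having top `true` -/
  | case (r : ℕ) (pEmpty pFalse pTrue : Prog) : Prog
  /-- repeat `p` while stack `r` is nonempty -/
  | loop (r : ℕ) (p : Prog) : Prog

/-- The contents of all stacks; the head of the list is the top of the stack. -/
abbrev Stacks : Type := ℕ → Word

open Classical in
/-- The answer bit of the oracle `A` to the query `w`. -/
noncomputable def answer (A : Set Word) (w : Word) : Bool := decide (w ∈ A)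

/-- `Exec A p s s' t`: with oracle `A`, program `p` started on `s` halts on `s'` after exactly
`t` steps. -/
inductive Exec (A : Set Word) : Prog → Stacks → Stacks → ℕ → Prop
  | skip (s : Stacks) : Exec A Prog.skip s s 1
  | push (r : ℕ) (b : Bool) (s : Stacks) :
      Exec A (Prog.push r b) s (Function.update s r (b :: s r)) 1
  | pop (r : ℕ) (s : Stacks) : Exec A (Prog.pop r) s (Function.update s r (s r).tail) 1
  | query (q r : ℕ) (s : Stacks) :
      Exec A (Prog.query q r) s (Function.update s r (answer A (s q) :: s r)) 1
  | seq {p₁ p₂ : Prog} {s₁ s₂ s₃ : Stacks} {t₁ t₂ : ℕ} :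
      Exec A p₁ s₁ s₂ t₁ → Exec A p₂ s₂ s₃ t₂ → Exec A (Prog.seq p₁ p₂) s₁ s₃ (t₁ + t₂)
  | caseEmpty {r : ℕ} {p₀ p₁ p₂ : Prog} {s s' : Stacks} {t : ℕ} :
      s r = [] → Exec A p₀ s s' t → Exec A (Prog.case r p₀ p₁ p₂) s s' (t + 1)
  | caseFalse {r : ℕ} {p₀ p₁ p₂ : Prog} {s s' : Stacks} {t : ℕ} :
      (s r).head? = some false → Exec A p₁ s s' t → Exec A (Prog.case r p₀ p₁ p₂) s s' (t + 1)
  | caseTrue {r : ℕ} {p₀ p₁ p₂ : Prog} {s s' : Stacks} {t : ℕ} :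
      (s r).head? = some true → Exec A p₂ s s' t → Exec A (Prog.case r p₀ p₁ p₂) s s' (t + 1)
  | loopDone {r : ℕ} {p : Prog} {s : Stacks} : s r = [] → Exec A (Prog.loop r p) s s 1
  | loopStep {r : ℕ} {p : Prog} {s₁ s₂ s₃ : Stacks} {t₁ t₂ : ℕ} :
      s₁ r ≠ [] → Exec A p s₁ s₂ t₁ → Exec A (Prog.loop r p) s₂ s₃ t₂ →
        Exec A (Prog.loop r p) s₁ s₃ (t₁ + t₂ + 1)

/-- Initial stacks: the `k`-th input word is on stack `k`; all other stacks are empty. -/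
def initStacks (inputs : List Word) : Stacks := fun r => inputs.getD r []

/-- The program halts on the given inputs within `T` steps. -/
def HaltsWithin (A : Set Word) (p : Prog) (inputs : List Word) (T : ℕ) : Prop :=
  ∃ s t, Exec A p (initStacks inputs) s t ∧ t ≤ T

/-- The program halts on the given inputs with the single bit `1` on stack `0`. -/
def Accepts (A : Set Word) (p : Prog) (inputs : List Word) : Prop :=
  ∃ s t, Exec A p (initStacks inputs) s t ∧ s 0 = [true]

/-! ## Complexity classes relative to an oracle

A decision problem is a predicate `P` on a type of instances, with an encoding `enc` of the
instances by words. -/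

/-- The class `P^A`. -/
def InP {α : Type*} (A : Set Word) (enc : α → Word) (P : α → Prop) : Prop :=
  ∃ (p : Prog) (T : Polynomial ℕ), ∀ a : α,
    HaltsWithin A p [enc a] (T.eval (enc a).length) ∧ (P a ↔ Accepts A p [enc a])

/-- The class `coNP^A`. -/
def InCoNP {α : Type*} (A : Set Word) (enc : α → Word) (P : α → Prop) : Prop :=
  ∃ (p : Prog) (T q : Polynomial ℕ), ∀ a : α,
    (∀ z : Word, HaltsWithin A p [enc a, z] (T.eval ((enc a).length + z.length))) ∧
    (P a ↔ ∀ z : Word, z.length ≤ q.eval (enc a).length → Accepts A p [enc a, z])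

/-- The class `Σ₂^{P,A} = NP^{NP^A}`. -/
def InSigma2 {α : Type*} (A : Set Word) (enc : α → Word) (P : α → Prop) : Prop :=
  ∃ (p : Prog) (T q : Polynomial ℕ), ∀ a : α,
    (∀ y z : Word,
      HaltsWithin A p [enc a, y, z] (T.eval ((enc a).length + y.length + z.length))) ∧
    (P a ↔ ∃ y : Word, y.length ≤ q.eval (enc a).length ∧
      ∀ z : Word, z.length ≤ q.eval (enc a).length → Accepts A p [enc a, y, z])

/-- `f` is computable in polynomial time, without an oracle. -/
def PolyTimeComputable {α β : Type*} (encA : α → Word) (encB : β → Word) (f : α → β) : Prop :=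
  ∃ (p : Prog) (T : Polynomial ℕ), ∀ a : α, ∃ s t,
    Exec ∅ p (initStacks [encA a]) s t ∧ t ≤ T.eval (encA a).length ∧ s 0 = encB (f a)

/-- `Σ₂^P`-hardness under polynomial-time many-one reductions. -/
def Sigma2Hard {β : Type*} (enc : β → Word) (Q : β → Prop) : Prop :=
  ∀ L : Set Word, InSigma2 ∅ (fun x : Word => x) (fun x => x ∈ L) →
    ∃ f : Word → β, PolyTimeComputable (fun x : Word => x) enc f ∧ ∀ x, x ∈ L ↔ Q (f x)

/-! ## Managed multi-context systems -/

/-- An expression that may contain variables (numbered by natural numbers) and that yields an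
element of `X` when these are instantiated by constants. -/
structure Template (Const X : Type) where
  vars : Finset ℕ
  value : (vars → Const) → X

/-- Instantiation by a valuation. -/
def Template.inst {Const X : Type} (P : Template Const X) (θ : ℕ → Const) : X :=
  P.value fun v => θ v

/-- A relational logic. `Form` and `Bel` are the types of the formulas that occur in knowledge
bases and of the beliefs that occur in belief sets; `consts` are the constants of the signature. -/
structure RelationalLogic (Const : Type) where
  Form : Type
  Bel : Type
  KB : Set (Set Form)
  BS : Set (Set Bel)
  ACC : KB → Set BS
  consts : Set Const

section

variable {Const : Type} {n : ℕ} (L : Fin n → RelationalLogic Const)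

/-- Ground beliefs `(i : p)`. -/
abbrev Lit : Type := Σ i, (L i).Bel

/-- Beliefs `(i : P)` possibly with variables. -/
abbrev LitT : Type := Σ i, Template Const (L i).Bel

/-- A managed bridge rule for context `i`. -/
structure BridgeRule (Op : Fin n → Type) (i : Fin n) where
  op : Op i
  form : Template Const (L i).Form
  pos : List (LitT L)
  neg : List (LitT L)

end

/-- Instantiation of a belief with variables. -/
def LitT.inst {Const : Type} {n : ℕ} {L : Fin n → RelationalLogic Const}
    (P : LitT L) (θ : ℕ → Const) : Lit L := ⟨P.1, P.2.inst θ⟩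

/-- `v` is a variable of one of the beliefs in the list. -/
def OccursIn {Const : Type} {n : ℕ} {L : Fin n → RelationalLogic Const}
    (v : ℕ) (l : List (LitT L)) : Prop := ∃ P ∈ l, v ∈ P.2.vars

/-- All components of an MCS with `n` contexts except the knowledge bases. -/
structure Frame where
  Const : Type
  const_nonempty : Nonempty Const
  n : ℕ
  L : Fin n → RelationalLogic Const
  /-- import domains -/
  D : Fin n → Set Const
  D_subset : ∀ i, D i ⊆ (L i).consts
  Op : Fin n → Type
  mng : ∀ i, Set (Op i × (L i).Form) → (L i).KB → (L i).KB
  br : ∀ i, Set (BridgeRule L Op i)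

/-- A managed multi-context system. -/
structure MCS extends Frame where
  kb : ∀ i, (L i).KB

/-- A belief state. -/
abbrev BeliefState (F : Frame) : Type := ∀ i, (F.L i).BS

/-- The ground belief `l` belongs to the belief state `S`. -/
def Holds {F : Frame} (S : BeliefState F) (l : Lit F.L) : Prop := l.2 ∈ (S l.1 : Set (F.L l.1).Bel)

/-- The heads of the ground instances of bridge rules of context `i` that are applicable in `S`. -/
def applicableHeads {F : Frame} (S : BeliefState F) (i : Fin F.n) :
    Set (F.Op i × (F.L i).Form) :=
  {a | ∃ r ∈ F.br i, ∃ θ : ℕ → F.Const,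
    (∀ v, v ∈ r.form.vars ∨ OccursIn v r.pos ∨ OccursIn v r.neg → θ v ∈ F.D i) ∧
    (∀ P ∈ r.pos, Holds S (LitT.inst P θ)) ∧ (∀ P ∈ r.neg, ¬ Holds S (LitT.inst P θ)) ∧
    a = (r.op, r.form.inst θ)}

/-- `S` is an equilibrium of `M`. -/
def IsEquilibrium (M : MCS) (S : BeliefState M.toFrame) : Prop :=
  ∀ i, S i ∈ (M.L i).ACC (M.mng i (applicableHeads S i) (M.kb i))

/-- `M` is logically consistent. -/
def LogicallyConsistent (M : MCS) : Prop := ∃ S, IsEquilibrium M S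

/-! ## Active integrity constraints and repairs -/

/-- Ground update actions `(j : α)`. -/
abbrev Action (F : Frame) : Type := Σ j, F.Op j × (F.L j).Form

/-- Active integrity constraints. -/
structure AIC (F : Frame) where
  pos : List (LitT F.L)
  neg : List (LitT F.L)
  head : List (Σ j, F.Op j × Template F.Const (F.L j).Form)
  safe : ∀ v, OccursIn v neg → OccursIn v pos

/-- Ground active integrity constraints. -/
structure GroundAIC (F : Frame) where
  pos : List (Lit F.L)
  neg : List (Lit F.L)
  head : List (Action F)

/-- Instance of an AIC under a valuation. -/
def AIC.inst {F : Frame} (r : AIC F) (θ : ℕ → F.Const) : GroundAIC F where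
  pos := r.pos.map fun P => LitT.inst P θ
  neg := r.neg.map fun P => LitT.inst P θ
  head := r.head.map fun a => ⟨a.1, a.2.1, a.2.2.inst θ⟩

/-- The closed instances of an AIC: its variables are replaced by constants of the signatures. -/
def AIC.groundInstances {F : Frame} (r : AIC F) : Set (GroundAIC F) :=
  {g | ∃ θ : ℕ → F.Const,
    (∀ v, OccursIn v r.pos ∨ (∃ a ∈ r.head, v ∈ a.2.2.vars) → ∃ i, θ v ∈ (F.L i).consts) ∧
    g = r.inst θ}

/-- The closed instances of a finite set of AICs. -/
def groundInstances {F : Frame} (η : List (AIC F)) : Set (GroundAIC F) :=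
  {g | ∃ r ∈ η, g ∈ r.groundInstances}

/-- The two notions of satisfaction. -/
inductive Mode : Type
  | weak : Mode
  | strong : Mode

/-- The belief state `S` satisfies the ground AIC `r`: its body is not true in `S`. -/
def SatBy {F : Frame} (S : BeliefState F) (r : GroundAIC F) : Prop :=
  ¬ ((∀ l ∈ r.pos, Holds S l) ∧ ∀ l ∈ r.neg, ¬ Holds S l)

/-- `M ⊨ R` for a set `R` of ground AICs. -/
def Satisfies (m : Mode) (M : MCS) (R : Set (GroundAIC M.toFrame)) : Prop :=
  match m with
  | Mode.weak => ∃ S, IsEquilibrium M S ∧ ∀ r ∈ R, SatBy S r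
  | Mode.strong => LogicallyConsistent M ∧ ∀ S, IsEquilibrium M S → ∀ r ∈ R, SatBy S r

/-- The actions in `U` that affect context `i`. -/
def actionsAt {F : Frame} (U : Set (Action F)) (i : Fin F.n) : Set (F.Op i × (F.L i).Form) :=
  {a | (⟨i, a⟩ : Action F) ∈ U}

/-- `U(M)`: in each context `i`, the actions of `U` that affect it are applied simultaneously. -/
abbrev MCS.update (M : MCS) (U : Set (Action M.toFrame)) : MCS where
  toFrame := M.toFrame
  kb := fun i => M.mng i (actionsAt U i) (M.kb i)

/-- The (finite) set `U` of update actions is consistent with respect to `M`: applying the actions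
that affect a context one by one, in any order, has the same result as applying them at once. -/
def IsConsistent (M : MCS) (U : Set (Action M.toFrame)) : Prop :=
  ∀ i, ∀ l : List (M.Op i × (M.L i).Form), l.Nodup → (∀ a, a ∈ l ↔ a ∈ actionsAt U i) →
    M.mng i (actionsAt U i) (M.kb i) = l.foldr (fun a K => M.mng i {a} K) (M.kb i)

/-- Weak repairs, for the set `R` of ground instances of the AICs. -/
def IsWeakRepair (m : Mode) (M : MCS) (R : Set (GroundAIC M.toFrame))
    (U : Set (Action M.toFrame)) : Prop :=
  U.Finite ∧ IsConsistent M U ∧ Satisfies m (M.update U) R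

/-- Grounded sets of update actions. -/
def IsGrounded (m : Mode) (M : MCS) (R : Set (GroundAIC M.toFrame))
    (U : Set (Action M.toFrame)) : Prop :=
  ∀ V : Set (Action M.toFrame), V ⊂ U →
    ∃ r ∈ R, ¬ Satisfies m (M.update V) {r} ∧ ∃ a ∈ r.head, a ∈ U \ V

/-- There is a grounded repair for `⟨M, η⟩`. -/
def HasGroundedRepair (m : Mode) (M : MCS) (η : List (AIC M.toFrame)) : Prop :=
  ∃ U, IsWeakRepair m M (groundInstances η) U ∧ IsGrounded m M (groundInstances η) U

/-! ## The repair tree -/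

/-- `n'` is a child of the consistent node `n` in the repair tree. -/
def IsChild (m : Mode) (M : MCS) (R : Set (GroundAIC M.toFrame))
    (n n' : Set (Action M.toFrame)) : Prop :=
  ∃ r ∈ R, ¬ Satisfies m (M.update n) {r} ∧
    ∃ W : Set (Action M.toFrame), (∀ a ∈ W, a ∈ r.head) ∧ n' = n ∪ W ∧
      Satisfies m (M.update n') {r} ∧ ∀ W', W' ⊂ W → ¬ Satisfies m (M.update (n ∪ W')) {r}

/-- `node 0, …, node k` are the nodes on a path with `k` edges that starts at the root of the
repair tree; each node that has a child on the path is consistent. -/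
structure IsTreePath (m : Mode) (M : MCS) (R : Set (GroundAIC M.toFrame)) (k : ℕ)
    (node : ℕ → Set (Action M.toFrame)) : Prop where
  root : node 0 = ∅
  logicallyConsistent : ∀ j < k, LogicallyConsistent (M.update (node j))
  consistent : ∀ j, j + 1 < k → IsConsistent (M.update (node j)) (node (j + 1))
  child : ∀ j < k, IsChild m M R (node j) (node (j + 1))

/-! ## Classes of finitely represented MCSs and the decision problems -/

/-- An MCS whose beliefs and update actions are represented by words. -/
structure CodedMCS extends MCS where
  litCode : Lit L → Word
  litCode_injective : Function.Injective litCode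
  actCode : Action toFrame → Word
  actCode_injective : Function.Injective actCode

/-- Code of a ground AIC. -/
def CodedMCS.groundCode (E : CodedMCS) (g : GroundAIC E.toFrame) : Word :=
  encList [encList (g.pos.map E.litCode), encList (g.neg.map E.litCode),
    encList (g.head.map E.actCode)]

/-- A class of MCSs, each of which is represented by a word. -/
structure MCSClass where
  Name : Type
  code : Name → Word
  code_injective : Function.Injective code
  mcs : Name → CodedMCS

/-- An instance `⟨M, η⟩` of the repair problem, with a list of all closed instances of `η`. -/
structure MCSClass.Input (C : MCSClass) where
  name : C.Name
  aics : List (AIC (C.mcs name).toFrame)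
  ground : List (GroundAIC (C.mcs name).toFrame)
  mem_ground : ∀ g, g ∈ ground ↔ g ∈ groundInstances aics

/-- Inputs are represented by `M` and the closed instances of `η`. -/
def MCSClass.Input.encode {C : MCSClass} (x : C.Input) : Word :=
  encList [C.code x.name, encList (x.ground.map (C.mcs x.name).groundCode)]

/-- The decision problem: is there a grounded repair for `⟨M, η⟩`? -/
def MCSClass.Input.HasRepair {C : MCSClass} (m : Mode) (x : C.Input) : Prop :=
  HasGroundedRepair m (C.mcs x.name).toMCS x.aics

/-- An MCS `M` of the class with a finite set `U` of update actions, representing `U(M)`. -/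
structure MCSClass.Variant (C : MCSClass) where
  name : C.Name
  acts : List (Action (C.mcs name).toFrame)

/-- Code of a variant. -/
def MCSClass.Variant.encode {C : MCSClass} (v : C.Variant) : Word :=
  encList [C.code v.name, encList (v.acts.map (C.mcs v.name).actCode)]

/-- The decision problem: is `U` consistent with respect to `M`? -/
def MCSClass.Variant.Consistent {C : MCSClass} (v : C.Variant) : Prop :=
  IsConsistent (C.mcs v.name).toMCS {a | a ∈ v.acts}

/-- A variant `U(M)` together with a finite set of ground AICs. -/
structure MCSClass.SatInput (C : MCSClass) extends C.Variant where
  ground : List (GroundAIC (C.mcs name).toFrame)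

/-- Code of a variant with a finite set of ground AICs. -/
def MCSClass.SatInput.encode {C : MCSClass} (v : C.SatInput) : Word :=
  encList [v.toVariant.encode, encList (v.ground.map (C.mcs v.name).groundCode)]

/-- The decision problem: does the MCS `U(M)` satisfy the given set of AICs? -/
def MCSClass.SatInput.Sat {C : MCSClass} (m : Mode) (v : C.SatInput) : Prop :=
  Satisfies m ((C.mcs v.name).toMCS.update {a | a ∈ v.acts}) {g | g ∈ v.ground}

/-! ## Databases as MCSs -/

/-- Ground atoms: a predicate symbol and its arguments, which are constants. -/
abbrev Atom : Type := Word × List Word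

/-- Code of an atom. -/
def atomCode (a : Atom) : Word := encList (a.1 :: a.2)

theorem atomCode_injective : Function.Injective atomCode := by
  rintro ⟨p, l⟩ ⟨q, k⟩ h
  have h' := encList_injective h
  simp only [List.cons.injEq] at h'
  exact Prod.ext h'.1 h'.2

/-- Code of a signed atom. -/
def signedCode (x : Bool × Atom) : Word := x.1 :: atomCode x.2

theorem signedCode_injective : Function.Injective signedCode := by
  rintro ⟨b, a⟩ ⟨c, d⟩ h
  simp only [signedCode, List.cons.injEq] at h
  exact Prod.ext h.1 (atomCode_injective h.2)

/-- The logic of databases: a knowledge base is a set of ground atoms, and its only acceptable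
belief set is the set of literals that are true in it (`(true, a)` is the literal `a`, and
`(false, a)` is its negation). -/
abbrev dbLogic : RelationalLogic Word where
  Form := Atom
  Bel := Bool × Atom
  KB := Set.univ
  BS := Set.univ
  ACC := fun K => {S | (S : Set (Bool × Atom)) = {l | l.1 = true ↔ l.2 ∈ K.1}}
  consts := Set.univ

/-- The single context of a database. The operations are `true` (addition of an atom) and `false`
(removal of an atom). -/
abbrev dbFrame : Frame where
  Const := Word
  const_nonempty := ⟨[]⟩
  n := 1
  L := fun _ => dbLogic
  D := fun _ => Set.univ
  D_subset := fun _ => Set.subset_univ _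
  Op := fun _ => Bool
  mng := fun _ O K =>
    ⟨(K.1 \ {a | (false, a) ∈ O}) ∪ {a | (true, a) ∈ O}, Set.mem_univ _⟩
  br := fun _ => ∅

/-- The MCS `M(DB)` of a database. -/
abbrev dbMCS (DB : List Atom) : CodedMCS where
  toFrame := dbFrame
  kb := fun _ => ⟨{a | a ∈ DB}, Set.mem_univ _⟩
  litCode := fun l => signedCode l.2
  litCode_injective := by
    rintro ⟨i, l⟩ ⟨j, k⟩ h
    obtain rfl : i = j := Subsingleton.elim (α := Fin 1) i j
    exact congrArg _ (signedCode_injective h)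
  actCode := fun a => signedCode a.2
  actCode_injective := by
    rintro ⟨i, l⟩ ⟨j, k⟩ h
    obtain rfl : i = j := Subsingleton.elim (α := Fin 1) i j
    exact congrArg _ (signedCode_injective h)

/-- Code of a database. -/
def dbCode (DB : List Atom) : Word := encList (DB.map atomCode)

theorem dbCode_injective : Function.Injective dbCode :=
  encList_injective.comp (List.map_injective_iff.mpr atomCode_injective)

/-- Ground AICs over databases: each action in the head removes an atom that occurs positively in
the body, or adds an atom that occurs negatively in it. -/
structure DBAIC where
  pos : List Atom
  neg : List Atom
  head : List (Bool × Atom)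
  head_nonempty : head ≠ []
  add_mem : ∀ a, (true, a) ∈ head → a ∈ neg
  del_mem : ∀ a, (false, a) ∈ head → a ∈ pos

/-- An expression without variables. -/
def Template.const {Const X : Type} (x : X) : Template Const X := ⟨∅, fun _ => x⟩

/-- The belief `(1 : a)` of `M(DB)`, for an atom `a`. -/
def dbLit (a : Atom) : LitT dbFrame.L :=
  ⟨(0 : Fin 1), Template.const (Const := Word) (X := Bool × Atom) (true, a)⟩

/-- The action `(1 : +a)` or `(1 : -a)` of `M(DB)`. -/
def dbAction (x : Bool × Atom) :
    Σ j, dbFrame.Op j × Template dbFrame.Const (dbFrame.L j).Form :=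
  ⟨(0 : Fin 1), x.1, Template.const (Const := Word) (X := Atom) x.2⟩

/-- A ground AIC over a database as an AIC over `M(DB)`. -/
def DBAIC.toAIC (r : DBAIC) : AIC dbFrame where
  pos := r.pos.map dbLit
  neg := r.neg.map dbLit
  head := r.head.map dbAction
  safe := by
    rintro v ⟨P, hP, hv⟩
    obtain ⟨a, -, rfl⟩ := List.mem_map.mp hP
    exact absurd hv (Finset.notMem_empty v)

/-- The class contains the MCSs `M(DB)` of all databases, and a word that represents `M(DB)` can be
computed from `DB` in polynomial time. -/
def MCSClass.ContainsDatabases (C : MCSClass) : Prop :=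
  ∃ f : List Atom → C.Name, PolyTimeComputable dbCode C.code f ∧ ∀ DB, C.mcs (f DB) = dbMCS DB

/-- The class of all databases. -/
def dbClass : MCSClass where
  Name := List Atom
  code := dbCode
  code_injective := dbCode_injective
  mcs := dbMCS

theorem dbClass_containsDatabases : dbClass.ContainsDatabases :=
  ⟨id, ⟨Prog.skip, 1, fun DB => ⟨initStacks [dbCode DB], 1, Exec.skip _, by simp, rfl⟩⟩,
    fun _ => rfl⟩

/-- The input consists of `M(DB)` for a database `DB` and of ground AICs over `DB`. -/
def MCSClass.Input.IsDatabaseInput {C : MCSClass} (x : C.Input) : Prop :=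
  ∃ (DB : List Atom) (h : C.mcs x.name = dbMCS DB), ∀ r ∈ x.aics, ∃ d : DBAIC,
    cast (congrArg (fun E : CodedMCS => AIC E.toFrame) h) r = d.toAIC

end MCSRepair

namespace MCSRepair

/-! ## Basic facts on program executions -/

/-! Depth. Along an edge of the repair tree some rule turns from violated to satisfied, so the child
is a strictly larger set than its parent. A node at depth `j` therefore has at least `j` actions,
all taken from heads of closed instances (`depth_le`).

Membership. A grounded repair `U` consists of actions from heads: otherwise the head actions in `U`
form a proper subset of `U`, and the rule that supports going beyond it would supply a head action
outside it. So `U` has a code of polynomial length, which is guessed. A single universal challenge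
then covers three tests. The empty word asks for satisfaction; a word that starts with `false`
carries a coNP challenge to consistency; a word that starts with `true` names a subset `V` of `U`,
and a violated rule whose head meets `U \ V` is sought (`MCSClass.Input.hasRepair_iff`,
`membership`).

Hardness. An arbitrary `Σ₂` language, given by a program `p`, is reduced directly. A positive
disjunctive rule becomes an AIC whose head atoms are negated in the body and added by the head. Over
the empty database, groundedness says that no proper subset of the added atoms is a model, so
grounded repairs correspond to minimal models. Two more AICs, with bodies `¬w, ¬u` and `u` and with
heads `+u` and `-u`, force `w` to hold but never support an action of a repair, because `u` is in no
head of a rule (`hasGroundedRepair_iff`).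

Minimal models containing `w` express one quantifier alternation by saturation
(`exists_minModel_iff`). Disjunctive rules guess the bits of `y` and of `z`, Horn rules run `p` on
the input, `y` and `z`, acceptance gives `w`, and `w` makes all choices for `z` true. Every `z` is
then represented inside one saturated model, whose minimality says that no `z` avoids deriving `w`.
The Horn rules are the instances, with numbers below a polynomial bound, of a finite set of schemas
that depends only on `p`. They are sound and complete for the computation
(`computationSchemas_sound`, `win_mem`).

Polynomial time. The machine model is concrete, so a calculus of register transformations is set up:
`Trans` and `Computes` are closed under composition, branching, loops with a nonincreasing size
potential, and mapping over coded sequences. Both the checker for membership and the reduction for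
hardness are assembled from these closure rules. -/

theorem Exec.det {A : Set Word} {p : Prog} {s s₁ : Stacks} {t₁ : ℕ} (h : Exec A p s s₁ t₁) :
    ∀ {s₂ : Stacks} {t₂ : ℕ}, Exec A p s s₂ t₂ → s₁ = s₂ ∧ t₁ = t₂ := by
  induction h with
  | skip s => intro _ _ h'; cases h'; exact ⟨rfl, rfl⟩
  | push r b s => intro _ _ h'; cases h'; exact ⟨rfl, rfl⟩
  | pop r s => intro _ _ h'; cases h'; exact ⟨rfl, rfl⟩
  | query q r s => intro _ _ h'; cases h'; exact ⟨rfl, rfl⟩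
  | seq _ _ ih₁ ih₂ =>
      intro _ _ h'
      cases h' with
      | seq k₁ k₂ =>
          obtain ⟨rfl, rfl⟩ := ih₁ k₁
          obtain ⟨rfl, rfl⟩ := ih₂ k₂
          exact ⟨rfl, rfl⟩
  | caseEmpty hr _ ih =>
      intro _ _ h'
      cases h' with
      | caseEmpty hr' k => obtain ⟨rfl, rfl⟩ := ih k; exact ⟨rfl, rfl⟩
      | caseFalse hr' k => simp [hr] at hr'
      | caseTrue hr' k => simp [hr] at hr'
  | caseFalse hr _ ih =>
      intro _ _ h'
      cases h' with
      | caseEmpty hr' k => simp [hr'] at hr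
      | caseFalse hr' k => obtain ⟨rfl, rfl⟩ := ih k; exact ⟨rfl, rfl⟩
      | caseTrue hr' k => simp [hr] at hr'
  | caseTrue hr _ ih =>
      intro _ _ h'
      cases h' with
      | caseEmpty hr' k => simp [hr'] at hr
      | caseFalse hr' k => simp [hr] at hr'
      | caseTrue hr' k => obtain ⟨rfl, rfl⟩ := ih k; exact ⟨rfl, rfl⟩
  | loopDone hr =>
      intro _ _ h'
      cases h' with
      | loopDone => exact ⟨rfl, rfl⟩
      | loopStep hr' => exact absurd hr hr'
  | loopStep hr _ _ ih₁ ih₂ =>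
      intro _ _ h'
      cases h' with
      | loopDone hr' => exact absurd hr' hr
      | loopStep _ k₁ k₂ =>
          obtain ⟨rfl, rfl⟩ := ih₁ k₁
          obtain ⟨rfl, rfl⟩ := ih₂ k₂
          exact ⟨rfl, rfl⟩

theorem Exec.cast {A : Set Word} {p : Prog} {s s₁ s₂ : Stacks} {t : ℕ} (h : Exec A p s s₁ t)
    (e : s₁ = s₂) : Exec A p s s₂ t := e ▸ h

theorem Exec.castTime {A : Set Word} {p : Prog} {s s₁ : Stacks} {t u : ℕ} (h : Exec A p s s₁ t)
    (e : t = u) : Exec A p s s₁ u := e ▸ h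

/-- All stacks used by the program have numbers below this bound. -/
def Prog.bound : Prog → ℕ
  | skip => 0
  | push r _ => r + 1
  | pop r => r + 1
  | query q r => max q r + 1
  | seq p₁ p₂ => max p₁.bound p₂.bound
  | case r p₀ p₁ p₂ => max (r + 1) (max p₀.bound (max p₁.bound p₂.bound))
  | loop r p => max (r + 1) p.bound

/-- Only finitely many stacks can hold garbage after a run, so a fixed program can clean up
(`Computes.of_exec`). -/
theorem Exec.unchanged {A : Set Word} {p : Prog} {s s' : Stacks} {t : ℕ} (h : Exec A p s s' t) :
    ∀ r, p.bound ≤ r → s' r = s r := by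
  induction h with
  | skip s => intros; rfl
  | push r b s | pop r s | query q r s =>
      intro k hk
      simp only [Prog.bound] at hk
      exact Function.update_of_ne (by omega) _ _
  | seq _ _ ih₁ ih₂ | loopStep _ _ _ ih₁ ih₂ =>
      intro k hk
      simp only [Prog.bound] at hk ih₂
      rw [ih₂ k (by omega), ih₁ k (by omega)]
  | caseEmpty _ _ ih | caseFalse _ _ ih | caseTrue _ _ ih =>
      intro k hk
      simp only [Prog.bound] at hk
      exact ih k (by omega)
  | loopDone => intros; rfl

/-- An elementary instruction pushes at most one bit and costs one step. Hence outputs of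
polynomial-time programs have polynomial length, which is what makes their composition polynomial.
-/
theorem Exec.length_le {A : Set Word} {p : Prog} {s s' : Stacks} {t : ℕ} (h : Exec A p s s' t) :
    ∀ r, (s' r).length ≤ (s r).length + t := by
  induction h with
  | skip s => intro; omega
  | push r b s | pop r s | query q r s =>
      intro k
      by_cases hk : k = r
      · subst hk; simp <;> omega
      · simp [Function.update_of_ne hk]
  | seq _ _ ih₁ ih₂ | loopStep _ _ _ ih₁ ih₂ =>
      intro k
      have := ih₁ k
      have := ih₂ k
      omega
  | caseEmpty _ _ ih | caseFalse _ _ ih | caseTrue _ _ ih =>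
      intro k
      have := ih k
      omega
  | loopDone => intro; omega

/-- The program with all stack numbers increased by `m`. -/
def Prog.shift (m : ℕ) : Prog → Prog
  | skip => skip
  | push r b => push (m + r) b
  | pop r => pop (m + r)
  | query q r => query (m + q) (m + r)
  | seq p₁ p₂ => seq (p₁.shift m) (p₂.shift m)
  | case r p₀ p₁ p₂ => case (m + r) (p₀.shift m) (p₁.shift m) (p₂.shift m)
  | loop r p => loop (m + r) (p.shift m)

/-- The first `m` stacks from `S`, followed by those of `s`. -/
def glue (m : ℕ) (S s : Stacks) : Stacks := fun r => if r < m then S r else s (r - m)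

@[simp] theorem glue_add (m : ℕ) (S s : Stacks) (r : ℕ) : glue m S s (m + r) = s r := by
  simp [glue]

theorem update_glue (m : ℕ) (S s : Stacks) (r : ℕ) (w : Word) :
    Function.update (glue m S s) (m + r) w = glue m S (Function.update s r w) := by
  funext k
  by_cases hk : k = m + r
  · subst hk; simp
  · rw [Function.update_of_ne hk]
    unfold glue
    split_ifs with h
    · rfl
    · rw [Function.update_of_ne (by omega)]

/-- Renumbering leaves the first `m` stacks out of reach, so a program can run next to registers
that must survive (`Trans.frame`). -/
theorem Exec.shift {A : Set Word} {p : Prog} {s s' : Stacks} {t : ℕ} (h : Exec A p s s' t)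
    (m : ℕ) (S : Stacks) : Exec A (p.shift m) (glue m S s) (glue m S s') t := by
  induction h with
  | skip s => exact Exec.skip _
  | push r b s => exact (Exec.push (m + r) b _).cast (by rw [update_glue, glue_add])
  | pop r s => exact (Exec.pop (m + r) _).cast (by rw [update_glue, glue_add])
  | query q r s =>
      exact (Exec.query (m + q) (m + r) _).cast (by rw [update_glue, glue_add, glue_add])
  | seq _ _ ih₁ ih₂ => exact Exec.seq ih₁ ih₂
  | caseEmpty hr _ ih => exact Exec.caseEmpty (by simpa using hr) ih
  | caseFalse hr _ ih => exact Exec.caseFalse (by simpa using hr) ih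
  | caseTrue hr _ ih => exact Exec.caseTrue (by simpa using hr) ih
  | loopDone hr => exact Exec.loopDone (by simpa using hr)
  | loopStep hr _ _ ih₁ ih₂ => exact Exec.loopStep (by simpa using hr) ih₁ ih₂

theorem initStacks_append (l k : List Word) :
    initStacks (l ++ k) = glue l.length (initStacks l) (initStacks k) := by
  funext r
  unfold glue initStacks
  split_ifs with h
  · exact List.getD_append _ _ _ _ h
  · exact List.getD_append_right _ _ _ _ (by omega)

/-- A trailing empty register is indistinguishable from an absent one; this is how registers get
deleted. -/
theorem initStacks_append_nil (l : List Word) : initStacks (l ++ [[]]) = initStacks l := by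
  funext r
  unfold initStacks
  rcases lt_or_ge r l.length with h | h
  · exact List.getD_append _ _ _ _ h
  · rw [List.getD_append_right _ _ _ _ h, List.getD_eq_default _ _ h]
    rcases r - l.length with _ | k <;> simp

/-! ## Elementary programs -/

/-- Empty the stack `r`. -/
def clearProg (r : ℕ) : Prog := .loop r (.pop r)

theorem exec_clear (A : Set Word) (r : ℕ) : ∀ (w : Word) (s : Stacks), s r = w →
    Exec A (clearProg r) s (Function.update s r []) (2 * w.length + 1)
  | [], s, h => (Exec.loopDone h).cast (by rw [← h, Function.update_eq_self])
  | b :: w, s, h => by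
      have h1 := Exec.loopStep (A := A) (r := r) (by simp [h]) (Exec.pop r s)
        (exec_clear A r w (Function.update s r (s r).tail) (by simp [h]))
      rw [Function.update_idem] at h1
      exact h1.castTime (by simp; ring)

/-- Move the stack `r` to the stacks in the list `ds`, symbol by symbol. -/
def pourProg (r : ℕ) (ds : List ℕ) : Prog :=
  .loop r (.seq (.case r .skip (ds.foldr (fun d p => .seq (.push d false) p) .skip)
    (ds.foldr (fun d p => .seq (.push d true) p) .skip)) (.pop r))

/-- Push the bit `b` on each stack in `ds`. -/
def pushAll (b : Bool) : List ℕ → Stacks → Stacks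
  | [], s => s
  | d :: ds, s => pushAll b ds (Function.update s d (b :: s d))

theorem pushAll_of_notMem (b : Bool) (r : ℕ) : ∀ (ds : List ℕ) (s : Stacks), r ∉ ds →
    pushAll b ds s r = s r
  | [], s, _ => rfl
  | d :: ds, s, h => by
      simp only [List.mem_cons, not_or] at h
      rw [pushAll, pushAll_of_notMem b r ds _ h.2, Function.update_of_ne h.1]

theorem pushAll_of_mem (b : Bool) (r : ℕ) : ∀ (ds : List ℕ) (s : Stacks), ds.Nodup → r ∈ ds →
    pushAll b ds s r = b :: s r
  | d :: ds, s, hn, h => by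
      rw [List.nodup_cons] at hn
      rcases eq_or_ne r d with rfl | hne
      · rw [pushAll, pushAll_of_notMem b r ds _ hn.1, Function.update_self]
      · rw [pushAll, pushAll_of_mem b r ds _ hn.2 (by simpa [hne] using h),
          Function.update_of_ne hne]

theorem exec_pushAll (A : Set Word) (b : Bool) : ∀ (ds : List ℕ) (s : Stacks),
    Exec A (ds.foldr (fun d p => .seq (.push d b) p) .skip) s (pushAll b ds s) (ds.length + 1)
  | [], s => Exec.skip s
  | d :: ds, s => by
      have := Exec.seq (Exec.push (A := A) d b s) (exec_pushAll A b ds _)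
      exact this.castTime (by simp; ring)

/-- Pouring reverses, so pouring twice copies. A bit costs `ds.length` pushes plus one step each for
the final `skip`, the `case`, the `pop` and the loop test; this is the factor `ds.length + 4`. -/
theorem exec_pour (A : Set Word) (r : ℕ) (ds : List ℕ) (hn : ds.Nodup) (hr : r ∉ ds) :
    ∀ (w : Word) (s : Stacks), s r = w →
    Exec A (pourProg r ds) s
      (fun k => if k = r then [] else if k ∈ ds then w.reverse ++ s k else s k)
      (w.length * (ds.length + 4) + 1)
  | [], s, h => by
      refine ((Exec.loopDone h).cast ?_).castTime (by simp)
      funext k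
      split_ifs with h1 h2
      · rw [h1, h]
      · rfl
      · rfl
  | b :: w, s, h => by
      have h0 : Exec A (.case r .skip (ds.foldr (fun d p => .seq (.push d false) p) .skip)
          (ds.foldr (fun d p => .seq (.push d true) p) .skip)) s (pushAll b ds s)
          (ds.length + 1 + 1) := by
        cases b
        · exact Exec.caseFalse (by simp [h]) (exec_pushAll A _ _ _)
        · exact Exec.caseTrue (by simp [h]) (exec_pushAll A _ _ _)
      have h1 := Exec.loopStep (A := A) (r := r) (by simp [h]) (Exec.seq h0 (Exec.pop r _))
        (exec_pour A r ds hn hr w _ (by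
          rw [Function.update_self, pushAll_of_notMem _ _ _ _ hr, h, List.tail_cons]))
      refine (h1.cast ?_).castTime ?_
      rotate_left
      · simp only [List.length_cons]; ring
      · funext k
        split_ifs with h1 h2
        · rfl
        · rw [Function.update_of_ne h1, pushAll_of_mem _ _ _ _ hn h2]; simp
        · rw [Function.update_of_ne h1, pushAll_of_notMem _ _ _ _ h2]

theorem eval_mono (P : Polynomial ℕ) {a b : ℕ} (h : a ≤ b) : P.eval a ≤ P.eval b := by
  rw [Polynomial.eval_eq_sum, Polynomial.eval_eq_sum]
  exact Finset.sum_le_sum fun i _ => Nat.mul_le_mul_left _ (Nat.pow_le_pow_left h i)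

/-! ## Polynomial-time transformations of registers -/

/-- The total length of a list of words. -/
def size (l : List Word) : ℕ := (l.map List.length).sum

/-- The values of a list of functions. -/
abbrev vals {α : Type*} (E : List (α → Word)) (a : α) : List Word := E.map fun f => f a

theorem length_le_size {w : Word} {l : List Word} (h : w ∈ l) : w.length ≤ size l :=
  List.single_le_sum (by simp) _ (List.mem_map_of_mem h)

@[simp] theorem size_nil : size [] = 0 := rfl

theorem size_append (l k : List Word) : size (l ++ k) = size l + size k := by
  simp [size]

@[simp] theorem size_cons (w : Word) (k : List Word) : size (w :: k) = w.length + size k := by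
  simp [size]

theorem length_initStacks_le (l : List Word) (r : ℕ) : (initStacks l r).length ≤ size l := by
  unfold initStacks
  rcases lt_or_ge r l.length with h | h
  · rw [List.getD_eq_getElem _ _ h]
    exact length_le_size (List.getElem_mem h)
  · rw [List.getD_eq_default _ _ h]; simp

theorem size_le_mul (l : List Word) (B : ℕ) (h : ∀ w ∈ l, w.length ≤ B) :
    size l ≤ l.length * B := by
  have := List.sum_le_card_nsmul (l.map List.length) B (by simpa using h)
  simpa [size] using this

/-- A program transforms the contents `E` of the registers into `F`, in polynomial time, for all
instances in the domain `D`. -/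
def Trans (A : Set Word) {α : Type*} (D : α → Prop) (E F : List (α → Word)) : Prop :=
  ∃ (p : Prog) (T : Polynomial ℕ), ∀ a, D a → ∃ t, t ≤ T.eval (size (vals E a)) ∧
    Exec A p (initStacks (vals E a)) (initStacks (vals F a)) t

/-- `f` can be computed in polynomial time from `E`, on the domain `D`. -/
def Computes (A : Set Word) {α : Type*} (D : α → Prop) (E : List (α → Word)) (f : α → Word) :
    Prop := Trans A D E [f]

theorem size_le_of_exec {A : Set Word} {p : Prog} {l k : List Word} {t : ℕ}
    (h : Exec A p (initStacks l) (initStacks k) t) : size k ≤ k.length * (size l + t) := by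
  refine size_le_mul _ _ fun w hw => ?_
  obtain ⟨i, hi, rfl⟩ := List.getElem_of_mem hw
  have h1 := h.length_le i
  have h2 := length_initStacks_le l i
  rw [show initStacks k i = k[i] from List.getD_eq_getElem _ _ hi] at h1
  omega

/-! ### Composing transformations; copying and deleting registers. -/

section Structural

variable {A : Set Word} {α β : Type*} {D : α → Prop} {E F G : List (α → Word)} {f : α → Word}

theorem Trans.size_le (h : Trans A D E F) : ∃ Q : Polynomial ℕ, ∀ a, D a →
    size (vals F a) ≤ Q.eval (size (vals E a)) := by
  obtain ⟨p, T, hp⟩ := h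
  refine ⟨Polynomial.C F.length * (Polynomial.X + T), fun a ha => ?_⟩
  obtain ⟨t, ht, he⟩ := hp a ha
  have := size_le_of_exec he
  rw [List.length_map] at this
  simp only [Polynomial.eval_mul, Polynomial.eval_C, Polynomial.eval_add, Polynomial.eval_X]
  exact this.trans (Nat.mul_le_mul_left _ (by omega))

/-- The second running time is a polynomial in the size of `F`, which `Trans.size_le` bounds by a
polynomial in the size of `E`. -/
theorem Trans.comp (h₁ : Trans A D E F) (h₂ : Trans A D F G) : Trans A D E G := by
  obtain ⟨Q, hQ⟩ := h₁.size_le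
  obtain ⟨p, T, hp⟩ := h₁
  obtain ⟨q, S, hq⟩ := h₂
  refine ⟨.seq p q, T + S.comp Q, fun a ha => ?_⟩
  obtain ⟨t, ht, he⟩ := hp a ha
  obtain ⟨u, hu, hf⟩ := hq a ha
  refine ⟨t + u, ?_, Exec.seq he hf⟩
  rw [Polynomial.eval_add, Polynomial.eval_comp]
  exact add_le_add ht (hu.trans (eval_mono _ (hQ a ha)))

theorem Trans.mono {D' : α → Prop} (h : Trans A D E F) (hD : ∀ a, D' a → D a) :
    Trans A D' E F := by
  obtain ⟨p, T, hp⟩ := h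
  exact ⟨p, T, fun a ha => hp a (hD a ha)⟩

/-- A program sees registers and not instances. A result about words or tuples of words therefore
applies to instances of any type through their registers. -/
theorem Trans.reindex (h : Trans A D E F) (φ : β → α) :
    Trans A (fun b => D (φ b)) (E.map (· ∘ φ)) (F.map (· ∘ φ)) := by
  obtain ⟨p, T, hp⟩ := h
  refine ⟨p, T, fun b hb => ?_⟩
  simpa [vals, Function.comp_def] using hp (φ b) hb

theorem Trans.congr {E' F' : List (α → Word)} (h : Trans A D E F)
    (hE : ∀ a, D a → vals E a = vals E' a) (hF : ∀ a, D a → vals F a = vals F' a) :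
    Trans A D E' F' := by
  obtain ⟨p, T, hp⟩ := h
  refine ⟨p, T, fun a ha => ?_⟩
  rw [← hE a ha, ← hF a ha]
  exact hp a ha

theorem Trans.refl : Trans A D E E := ⟨.skip, 1, fun a _ => ⟨1, by simp, Exec.skip _⟩⟩

theorem Trans.frame (h : Trans A D E F) (G : List (α → Word)) :
    Trans A D (G ++ E) (G ++ F) := by
  obtain ⟨p, T, hp⟩ := h
  refine ⟨p.shift G.length, T, fun a ha => ?_⟩
  obtain ⟨t, ht, he⟩ := hp a ha
  refine ⟨t, ht.trans (eval_mono _ ?_), ?_⟩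
  · simp [vals, size_append]
  · have := he.shift G.length (initStacks (vals G a))
    simpa [vals, initStacks_append] using this

theorem trans_copy (hf : f ∈ E) : Trans A D E (E ++ [f]) := by
  obtain ⟨i, hi, rfl⟩ := List.getElem_of_mem hf
  set n := E.length with hn
  -- Stack `n + 1` is scratch space: the word is poured there and then back to both `i` and `n`. The
  -- two passes cost 5 and 6 steps per bit, plus one step each at the end.
  refine ⟨.seq (pourProg i [n + 1]) (pourProg (n + 1) [i, n]),
    Polynomial.C 11 * Polynomial.X + 2, fun a _ => ?_⟩
  set s := initStacks (vals E a) with hs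
  set w := E[i] a with hw
  have hsi : s i = w := by
    rw [hs, hw]; unfold initStacks
    rw [List.getD_eq_getElem _ _ (by simpa using hi)]; simp
  have hge : ∀ r, n ≤ r → s r = [] := fun r hr => List.getD_eq_default _ _ (by simpa using hr)
  have h1 := exec_pour A i [n + 1] (by simp) (by simp; omega) w s hsi
  have h2 := exec_pour A (n + 1) [i, n] (by simp; omega) (by simp; omega) w.reverse
    (fun k => if k = i then [] else if k ∈ [n + 1] then w.reverse ++ s k else s k)
    (by rw [if_neg (by omega), if_pos (by simp), hge _ (by omega), List.append_nil])
  refine ⟨_, ?_, (Exec.seq h1 h2).cast ?_⟩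
  · have : w.length ≤ size (vals E a) := length_le_size (by simp [vals]; exact ⟨_, List.getElem_mem hi, rfl⟩)
    simp
    omega
  · funext k
    have e : initStacks (vals (E ++ [E[i]]) a) k = if k = n then w else s k := by
      rw [vals, List.map_append, initStacks_append]
      unfold glue
      rw [List.length_map]
      split_ifs with h1 h2 h2
      · omega
      · rfl
      · subst h2; simp [initStacks, n, w]
      · rw [hge k (by omega)]; exact List.getD_eq_default _ _ (by simp; omega)
    rw [e]
    by_cases h1 : k = n + 1
    · subst h1; simp [hge]
    · by_cases h2 : k = i
      · subst h2
        rw [if_neg (by omega), if_pos (by simp), if_pos rfl, if_neg (by omega), hsi]; simp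
      · by_cases h3 : k = n
        · subst h3
          rw [if_neg h1, if_pos (by simp), if_neg h2, if_neg (by simp), hge n le_rfl]; simp
        · rw [if_neg h1, if_neg (by simp; tauto), if_neg h2, if_neg (by simpa using h1), if_neg h3]

theorem trans_copies : ∀ (F : List (α → Word)) (E : List (α → Word)), (∀ f ∈ F, f ∈ E) →
    Trans A D E (E ++ F)
  | [], E, _ => by rw [List.append_nil]; exact Trans.refl
  | f :: F, E, h => by
      have h1 : Trans A D E (E ++ [f]) := trans_copy (h f (by simp))
      have h2 : Trans A D (E ++ [f]) (E ++ [f] ++ F) :=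
        trans_copies F _ fun g hg => by simp [h g (by simp [hg])]
      simpa using h1.comp h2

theorem trans_swap_nil (w : α → Word) (Q : List (α → Word)) :
    Trans A D ((fun _ => []) :: w :: Q) (w :: (fun _ => []) :: Q) := by
  set n := Q.length + 2 with hn
  refine ⟨.seq (pourProg 1 [n]) (pourProg n [0]), Polynomial.C 10 * Polynomial.X + 2,
    fun a _ => ?_⟩
  set s := initStacks (vals ((fun _ => []) :: w :: Q) a) with hs
  have hge : ∀ r, n ≤ r → s r = [] := fun r hr => List.getD_eq_default _ _ (by simp; omega)
  have h1 := exec_pour A 1 [n] (by simp) (by simp; omega) (w a) s rfl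
  have h2 := exec_pour A n [0] (by simp) (by simp [n]) (w a).reverse
    (fun k => if k = 1 then [] else if k ∈ [n] then (w a).reverse ++ s k else s k)
    (by rw [if_neg (by omega), if_pos (by simp), hge _ le_rfl, List.append_nil])
  refine ⟨_, ?_, (Exec.seq h1 h2).cast ?_⟩
  · simp; omega
  · funext k
    rcases k with _ | _ | k
    · simp [s, n, initStacks]
    · simp [n, initStacks]
    · by_cases h3 : k + 2 = n
      · have : k = Q.length := by omega
        subst this
        simp [n, initStacks]
      · simp [h3, s, initStacks]

/-- Registers are addressed by position, so the empty register is moved past its successors to the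
end, where it is invisible. -/
theorem trans_delete_nil : ∀ (Q : List (α → Word)) (P : List (α → Word)),
    Trans A D (P ++ (fun _ => []) :: Q) (P ++ Q)
  | [], P => by
      obtain ⟨p, T, h⟩ : Trans A D P P := Trans.refl
      refine ⟨p, T, fun a ha => ?_⟩
      have := h a ha
      simpa [vals, initStacks_append_nil, size_append] using this
  | w :: Q, P => by
      have h1 : Trans A D (P ++ (fun _ => []) :: w :: Q) (P ++ w :: (fun _ => []) :: Q) :=
        (trans_swap_nil w Q).frame P
      have h2 := trans_delete_nil Q (P ++ [w])
      rw [List.append_assoc, List.append_assoc] at h2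
      exact h1.comp h2

theorem trans_clear_head (w : α → Word) (Q : List (α → Word)) :
    Trans A D (w :: Q) ((fun _ => []) :: Q) := by
  refine ⟨clearProg 0, Polynomial.C 2 * Polynomial.X + 1, fun a _ => ?_⟩
  refine ⟨_, ?_, (exec_clear A 0 (w a) _ rfl).cast ?_⟩
  · simp
  · funext k
    rcases k with _ | k
    · simp [initStacks]
    · simp [initStacks]

theorem trans_drop : ∀ (E F : List (α → Word)), Trans A D (E ++ F) F
  | [], _ => Trans.refl
  | e :: E, F =>
      ((trans_clear_head e (E ++ F)).comp (trans_delete_nil (E ++ F) [])).comp (trans_drop E F)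

theorem Computes.extend (h : Computes A D E f) (hE : ∀ g ∈ E, g ∈ G) : Trans A D G (G ++ [f]) :=
  (trans_copies E G hE).comp (h.frame G)

/-- The inputs `E` must stay available until the last output is computed. The outputs are therefore
appended, and the inputs are dropped only afterwards. -/
theorem Trans.of_computes_append : ∀ (F G : List (α → Word)), (∀ g ∈ E, g ∈ G) →
    (∀ f ∈ F, Computes A D E f) → Trans A D G (G ++ F)
  | [], G, _, _ => by rw [List.append_nil]; exact Trans.refl
  | f :: F, G, hG, h => by
      have h1 := (h f (by simp)).extend hG
      have h2 := Trans.of_computes_append F (G ++ [f]) (fun g hg => by simp [hG g hg])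
        fun g hg => h g (by simp [hg])
      simpa using h1.comp h2

theorem Trans.of_computes (h : ∀ f ∈ F, Computes A D E f) : Trans A D E F :=
  (Trans.of_computes_append F E (fun _ h => h) h).comp (trans_drop E F)

theorem Computes.var (h : f ∈ E) : Computes A D E f :=
  (trans_copy h).comp (trans_drop E [f])

theorem Computes.subst (hf : Computes A D G f) (hG : ∀ g ∈ G, Computes A D E g) :
    Computes A D E f :=
  (Trans.of_computes hG).comp hf

theorem Computes.weaken (hf : Computes A D G f) (h : ∀ g ∈ G, g ∈ E) : Computes A D E f :=
  hf.subst fun g hg => Computes.var (h g hg)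

theorem Computes.mono {D' : α → Prop} (h : Computes A D E f) (hD : ∀ a, D' a → D a) :
    Computes A D' E f := Trans.mono h hD

theorem Computes.congr {g : α → Word} (h : Computes A D E f) (hg : ∀ a, D a → f a = g a) :
    Computes A D E g := Trans.congr h (fun _ _ => rfl) fun a ha => by simp [vals, hg a ha]

theorem Computes.size_le (h : Computes A D E f) : ∃ Q : Polynomial ℕ, ∀ a, D a →
    (f a).length ≤ Q.eval (size (vals E a)) := by
  obtain ⟨Q, hQ⟩ := Trans.size_le h
  exact ⟨Q, fun a ha => by simpa [vals] using hQ a ha⟩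

/-- Apply a function of one word. -/
theorem Computes.app₁ {H : Word → Word} (hH : Computes A (fun _ => True) [id] H)
    (h : Computes A D E f) : Computes A D E fun a => H (f a) := by
  have h1 := (Trans.reindex hH f).mono (D' := D) (by simp)
  exact Computes.subst (G := [f]) h1 (by simpa using h)

/-- Apply a function of two words. -/
theorem Computes.app₂ {g : α → Word} {H : Word → Word → Word}
    (hH : Computes A (fun _ => True) [Prod.fst, Prod.snd] fun p : Word × Word => H p.1 p.2)
    (hf : Computes A D E f) (hg : Computes A D E g) : Computes A D E fun a => H (f a) (g a) := by
  have h1 := (Trans.reindex hH fun a => (f a, g a)).mono (D' := D) (by simp)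
  exact Computes.subst (G := [f, g]) h1 (by simpa using ⟨hf, hg⟩)

/-- A function computed from `E` is computed from `E` and one more register. -/
theorem Computes.lift {γ : Type*} (h : Computes A D E f) (D' : α × γ → Prop)
    (hD : ∀ p, D' p → D p.1) (g : α × γ → Word) :
    Computes A D' (g :: E.map (· ∘ Prod.fst)) fun p => f p.1 :=
  Computes.weaken (G := E.map (· ∘ Prod.fst)) ((Trans.reindex h Prod.fst).mono hD)
    fun _ hg => List.mem_cons_of_mem _ hg

end Structural

/-! ## Elementary functions, branching and loops -/

section Rules

variable {A : Set Word} {α β : Type*} {D : α → Prop} {E : List (α → Word)} {f g : α → Word}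

theorem Computes.cons (b : Bool) (h : Computes A D E f) : Computes A D E fun a => b :: f a := by
  refine Computes.app₁ (H := fun w => b :: w) ⟨.push 0 b, 1, fun w _ => ⟨1, by simp, ?_⟩⟩ h
  refine (Exec.push 0 b _).cast ?_
  funext k
  rcases k with _ | k <;> simp [initStacks]

theorem Computes.tail (h : Computes A D E f) : Computes A D E fun a => (f a).tail := by
  refine Computes.app₁ (H := List.tail) ⟨.pop 0, 1, fun w _ => ⟨1, by simp, ?_⟩⟩ h
  refine (Exec.pop 0 _).cast ?_
  funext k
  rcases k with _ | k <;> simp [initStacks]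

theorem Computes.nil : Computes A D E fun _ => [] := by
  refine Computes.weaken (G := []) ⟨.skip, 1, fun w _ => ⟨1, by simp, ?_⟩⟩ (by simp)
  refine (Exec.skip _).cast ?_
  funext k
  rcases k with _ | k <;> simp [initStacks]

theorem Computes.const : ∀ w : Word, Computes A D E fun _ => w
  | [] => Computes.nil
  | b :: w => (Computes.const w).cons b

/-- Branching on the first bit of `c`. -/
theorem Computes.case {c : α → Word} (hc : Computes A D E c)
    (h₀ : Computes A (fun a => D a ∧ c a = []) E f)
    (h₁ : Computes A (fun a => D a ∧ (c a).head? = some false) E f)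
    (h₂ : Computes A (fun a => D a ∧ (c a).head? = some true) E f) : Computes A D E f := by
  have hE : Trans A D E (c :: E) := Trans.of_computes fun g hg => by
    rcases List.mem_cons.1 hg with rfl | hg
    · exact hc
    · exact Computes.var hg
  refine Trans.comp hE ?_
  have w : ∀ {D' : α → Prop}, Computes A D' E f → Computes A D' (c :: E) f := fun h =>
    h.weaken fun g hg => List.mem_cons_of_mem _ hg
  obtain ⟨p₀, T₀, H₀⟩ := w h₀
  obtain ⟨p₁, T₁, H₁⟩ := w h₁
  obtain ⟨p₂, T₂, H₂⟩ := w h₂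
  refine ⟨.case 0 p₀ p₁ p₂, T₀ + T₁ + T₂ + 1, fun a ha => ?_⟩
  simp only [Polynomial.eval_add, Polynomial.eval_one]
  have e0 : initStacks (vals (c :: E) a) 0 = c a := rfl
  rcases hca : c a with _ | ⟨b, w⟩
  · obtain ⟨t, ht, he⟩ := H₀ a ⟨ha, hca⟩
    exact ⟨t + 1, by omega, Exec.caseEmpty (by rw [e0, hca]) he⟩
  · cases b
    · obtain ⟨t, ht, he⟩ := H₁ a ⟨ha, by simp [hca]⟩
      exact ⟨t + 1, by omega, Exec.caseFalse (by rw [e0, hca]; rfl) he⟩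
    · obtain ⟨t, ht, he⟩ := H₂ a ⟨ha, by simp [hca]⟩
      exact ⟨t + 1, by omega, Exec.caseTrue (by rw [e0, hca]; rfl) he⟩

/-- Iteration while the first register is nonempty. The states are the elements of `α`; `μ`
bounds the number of iterations, and `Φ` the size of the registers. -/
theorem Trans.loop {c : α → Word} {V : List (α → Word)} (next fin : α → α) (μ Φ : α → ℕ)
    (Q : Polynomial ℕ)
    (hnext : ∀ a, D a → c a ≠ [] → D (next a) ∧ fin a = fin (next a) ∧ μ (next a) < μ a ∧
      Φ (next a) ≤ Φ a)
    (hfin : ∀ a, D a → c a = [] → fin a = a)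
    (hsize : ∀ a, D a → size (vals (c :: V) a) ≤ Φ a)
    (hQ : ∀ a, D a → μ a ≤ Q.eval (size (vals (c :: V) a)) ∧
      Φ a ≤ Q.eval (size (vals (c :: V) a)))
    (body : ∀ g ∈ c :: V, Computes A (fun a => D a ∧ c a ≠ []) (c :: V) fun a => g (next a)) :
    Trans A D (c :: V) ((c :: V).map fun g a => g (fin a)) := by
  have body' : Trans A (fun a => D a ∧ c a ≠ []) (c :: V) ((c :: V).map fun g a => g (next a)) := by
    refine Trans.of_computes fun g hg => ?_
    obtain ⟨g', hg', rfl⟩ := List.mem_map.1 hg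
    exact body g' hg'
  obtain ⟨p, T, hp⟩ := body'
  -- Because `Φ` does not increase, one bound `M` on the sizes serves for the whole run, and each
  -- round costs at most `T.eval M + 1`. Bounding the growth in a single round would not exclude
  -- exponential growth.
  have key : ∀ (M n : ℕ) (a : α), D a → Φ a ≤ M → μ a ≤ n →
      ∃ t, t ≤ n * (T.eval M + 1) + 1 ∧
        Exec A (.loop 0 p) (initStacks (vals (c :: V) a)) (initStacks (vals (c :: V) (fin a))) t := by
    intro M n
    induction n with
    | zero =>
        intro a ha hM hn
        have hc : c a = [] := by
          by_contra hc
          have := (hnext a ha hc).2.2.1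
          omega
        rw [hfin a ha hc]
        exact ⟨1, by simp, Exec.loopDone hc⟩
    | succ n ih =>
        intro a ha hM hn
        by_cases hc : c a = []
        · rw [hfin a ha hc]
          exact ⟨1, by simp, Exec.loopDone hc⟩
        · obtain ⟨h1, h2, h3, h4⟩ := hnext a ha hc
          obtain ⟨t, ht, he⟩ := hp a ⟨ha, hc⟩
          obtain ⟨u, hu, hf⟩ := ih (next a) h1 (h4.trans hM) (by omega)
          refine ⟨t + u + 1, ?_, Exec.loopStep hc (he.cast ?_) (h2 ▸ hf)⟩
          · have := eval_mono T ((hsize a ha).trans hM)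
            have h5 := ht.trans this
            rw [Nat.succ_mul]
            omega
          · simp [vals, Function.comp_def]
  refine ⟨.loop 0 p, Q * (T.comp Q + 1) + 1, fun a ha => ?_⟩
  obtain ⟨t, ht, he⟩ := key _ _ a ha (hQ a ha).2 (hQ a ha).1
  refine ⟨t, by simpa using ht, he.cast ?_⟩
  simp [vals, Function.comp_def]

/-- Empty the stacks with numbers `1, …, k`. -/
def clearUpTo : ℕ → Prog
  | 0 => .skip
  | k + 1 => .seq (clearUpTo k) (clearProg (k + 1))

theorem exec_clearUpTo (A : Set Word) (s : Stacks) (M : ℕ) (hM : ∀ r, (s r).length ≤ M) :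
    ∀ k : ℕ, ∃ t, t ≤ k * (2 * M + 1) + 1 ∧
      Exec A (clearUpTo k) s (fun r => if 1 ≤ r ∧ r ≤ k then [] else s r) t
  | 0 => ⟨1, by simp, (Exec.skip s).cast (by funext r; rw [if_neg (by omega)])⟩
  | k + 1 => by
      obtain ⟨t, ht, he⟩ := exec_clearUpTo A s M hM k
      have h2 := exec_clear A (k + 1) (s (k + 1))
        (fun r => if 1 ≤ r ∧ r ≤ k then [] else s r) (by simp)
      refine ⟨_, ?_, (Exec.seq he h2).cast ?_⟩
      · have := hM (k + 1)
        have e : (k + 1) * (2 * M + 1) = k * (2 * M + 1) + (2 * M + 1) := by ring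
        omega
      · funext r
        by_cases hr : r = k + 1
        · subst hr; simp
        · rw [Function.update_of_ne hr]
          split_ifs <;> first | rfl | omega

/-- A program that leaves its result on stack `0`, and possibly garbage on the other stacks. -/
theorem Computes.of_exec (p : Prog) (T : Polynomial ℕ)
    (h : ∀ a, D a → ∃ s t, Exec A p (initStacks (vals E a)) s t ∧
      t ≤ T.eval (size (vals E a)) ∧ s 0 = f a) : Computes A D E f := by
  -- Stacks from number `K` on hold no input and are not touched by `p`, so clearing the stacks `1,
  -- …, K` leaves nothing but the result.
  set K := max p.bound E.length with hK
  refine ⟨.seq p (clearUpTo K), T + (Polynomial.C K * (2 * (Polynomial.X + T) + 1) + 1),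
    fun a ha => ?_⟩
  obtain ⟨s, t, he, ht, h0⟩ := h a ha
  obtain ⟨u, hu, hf⟩ := exec_clearUpTo A s (size (vals E a) + T.eval (size (vals E a)))
    (fun r => (he.length_le r).trans (add_le_add (length_initStacks_le _ _) ht)) K
  refine ⟨_, ?_, (Exec.seq he hf).cast ?_⟩
  · have e2 : Polynomial.eval (size (vals E a)) (2 : Polynomial ℕ) = 2 := by
      rw [← Polynomial.C_ofNat, Polynomial.eval_C]
    simp only [Polynomial.eval_add, Polynomial.eval_mul, Polynomial.eval_C, e2, Polynomial.eval_X,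
      Polynomial.eval_one]
    exact add_le_add ht hu
  · funext r
    rcases r with _ | r
    · simp [initStacks, h0]
    · have : initStacks (vals [f] a) (r + 1) = [] := by simp [initStacks]
      rw [this]
      split_ifs with hr
      · rfl
      · rw [he.unchanged _ (by omega)]
        exact List.getD_eq_default _ _ (by simp; omega)

end Rules

/-! ## Functions on words that are computable in polynomial time -/

section WordFunctions

variable {A : Set Word} {α β : Type*} {D : α → Prop} {E : List (α → Word)} {f g : α → Word}

theorem Computes.of_loop {c : α → Word} {V : List (α → Word)} (next fin : α → α) (μ Φ : α → ℕ)
    (Q : Polynomial ℕ)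
    (hnext : ∀ a, D a → c a ≠ [] → D (next a) ∧ fin a = fin (next a) ∧ μ (next a) < μ a ∧
      Φ (next a) ≤ Φ a)
    (hfin : ∀ a, D a → c a = [] → fin a = a)
    (hsize : ∀ a, D a → size (vals (c :: V) a) ≤ Φ a)
    (hQ : ∀ a, D a → μ a ≤ Q.eval (size (vals (c :: V) a)) ∧
      Φ a ≤ Q.eval (size (vals (c :: V) a)))
    (body : ∀ g ∈ c :: V, Computes A (fun a => D a ∧ c a ≠ []) (c :: V) fun a => g (next a)) :
    ∀ g ∈ c :: V, Computes A D (c :: V) fun a => g (fin a) := fun g hg =>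
  (Trans.loop next fin μ Φ Q hnext hfin hsize hQ body).comp
    (Computes.var (List.mem_map.2 ⟨g, hg, rfl⟩))

theorem Computes.app₃ {H : Word × Word × Word → Word} {D' : Word × Word × Word → Prop}
    {f₁ f₂ f₃ : α → Word}
    (hH : Computes A D' [fun p => p.1, fun p => p.2.1, fun p => p.2.2] H)
    (h₁ : Computes A D E f₁) (h₂ : Computes A D E f₂) (h₃ : Computes A D E f₃)
    (hD : ∀ a, D a → D' (f₁ a, f₂ a, f₃ a)) :
    Computes A D E fun a => H (f₁ a, f₂ a, f₃ a) :=
  Computes.subst (G := [f₁, f₂, f₃])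
    ((Trans.reindex hH fun a => (f₁ a, f₂ a, f₃ a)).mono hD) (by simpa using ⟨h₁, h₂, h₃⟩)

theorem Computes.constAppend (hf : Computes A D E f) :
    ∀ w : Word, Computes A D E fun a => w ++ f a
  | [] => hf
  | b :: w => (Computes.constAppend hf w).cons b

/-- The final state of the loop that moves the first word to the second, translating each bit. -/
theorem computes_flatMapBits_aux (h : Bool → Word) :
    Computes A (fun _ => True) [Prod.fst, Prod.snd]
      fun p : Word × Word => p.1.reverse.flatMap h ++ p.2 := by
  -- In the potential, a bit that is still to be read weighs `C`, at least as much as its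
  -- translation, so reading it does not raise the potential. The summand 1 makes the potential
  -- dominate the length of the first register as well.
  set C := (h false).length + (h true).length + 1 with hC
  have hb : ∀ b, (h b).length ≤ C := by intro b; cases b <;> omega
  refine Computes.of_loop (V := [Prod.snd]) (fun p => (p.1.tail, h p.1.headI ++ p.2))
    (fun p => ([], p.1.reverse.flatMap h ++ p.2)) (fun p => p.1.length)
    (fun p => C * p.1.length + p.2.length) (Polynomial.C C * Polynomial.X) ?_ ?_ ?_ ?_ ?_ Prod.snd
    (by simp)
  · rintro ⟨u, v⟩ - hu
    rcases u with _ | ⟨b, u⟩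
    · exact absurd rfl hu
    · have := hb b
      refine ⟨trivial, by simp, by simp, ?_⟩
      simp only [List.tail_cons, List.headI_cons, List.length_append, List.length_cons]
      rw [Nat.mul_succ]; omega
  · rintro ⟨u, v⟩ - hu
    obtain rfl : u = [] := hu
    rfl
  · rintro ⟨u, v⟩ -
    have : u.length ≤ C * u.length := Nat.le_mul_of_pos_left _ (by omega)
    simp; omega
  · rintro ⟨u, v⟩ -
    have h1 : u.length ≤ C * u.length := Nat.le_mul_of_pos_left _ (by omega)
    have h2 : v.length ≤ C * v.length := Nat.le_mul_of_pos_left _ (by omega)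
    constructor <;> simp [Nat.mul_add] <;> omega
  · intro g hg
    have v1 : Computes A (fun _ : Word × Word => True) [Prod.fst, Prod.snd] Prod.fst :=
      Computes.var (by simp)
    have v2 : Computes A (fun _ : Word × Word => True) [Prod.fst, Prod.snd] Prod.snd :=
      Computes.var (by simp)
    simp only [List.mem_cons, List.not_mem_nil, or_false] at hg
    rcases hg with rfl | rfl
    · exact v1.tail.mono (by simp)
    · refine Computes.case (v1.mono (by simp)) ?_ ?_ ?_
      · exact (v1.mono (by simp)).congr fun a h => absurd h.2 h.1.2
      · refine ((v2.constAppend (h false)).mono (by simp)).congr fun a h => ?_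
        rcases hc : a.1 with _ | ⟨b, w⟩ <;> simp_all
      · refine ((v2.constAppend (h true)).mono (by simp)).congr fun a h => ?_
        rcases hc : a.1 with _ | ⟨b, w⟩ <;> simp_all

theorem Computes.reverse (hf : Computes A D E f) : Computes A D E fun a => (f a).reverse := by
  have := Computes.app₂ (H := fun u v => u.reverse.flatMap (fun b => [b]) ++ v)
    (computes_flatMapBits_aux _) hf Computes.nil
  simpa using this

theorem Computes.append (hf : Computes A D E f) (hg : Computes A D E g) :
    Computes A D E fun a => f a ++ g a := by
  have := Computes.app₂ (H := fun u v => u.reverse.flatMap (fun b => [b]) ++ v)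
    (computes_flatMapBits_aux _) hf.reverse hg
  simpa using this

theorem Computes.flatMapBits (h : Bool → Word) (hf : Computes A D E f) :
    Computes A D E fun a => (f a).flatMap h := by
  have := Computes.app₂ (H := fun u v => u.reverse.flatMap h ++ v)
    (computes_flatMapBits_aux _) hf.reverse Computes.nil
  simpa using this

theorem encWord_eq (w : Word) : encWord w = w.flatMap (fun b => [true, b]) ++ [false] := by
  induction w with
  | nil => rfl
  | cons b w ih => simp [encWord, ih]

theorem Computes.encWord (hf : Computes A D E f) : Computes A D E fun a => encWord (f a) := by
  simp only [encWord_eq]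
  exact (hf.flatMapBits _).append (Computes.const _)

/-- Natural numbers in unary. -/
def unary (n : ℕ) : Word := List.replicate n true

@[simp] theorem length_unary (n : ℕ) : (unary n).length = n := List.length_replicate

theorem unary_injective : Function.Injective unary := fun m n h => by
  simpa using congrArg List.length h

theorem unary_add (m n : ℕ) : unary (m + n) = unary m ++ unary n := List.replicate_add ..

theorem unary_tail (n : ℕ) : (unary n).tail = unary (n - 1) := List.tail_replicate

theorem Computes.unary_length (hf : Computes A D E f) :
    Computes A D E fun a => unary (f a).length := by
  refine (hf.flatMapBits fun _ => [true]).congr fun a _ => ?_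
  generalize f a = w
  induction w with
  | nil => rfl
  | cons b w ih => simpa [unary, List.replicate_succ] using ih

/-- Appending a word once for every bit of another one multiplies lengths, which is multiplication
in unary. -/
theorem computes_mul_aux : Computes A (fun _ => True)
    [fun p => p.1, fun p => p.2.1, fun p => p.2.2]
    fun p : Word × Word × Word => p.1.flatMap (fun _ => p.2.2) ++ p.2.1 := by
  refine Computes.of_loop (V := [fun p => p.2.1, fun p => p.2.2])
    (fun p => (p.1.tail, p.2.2 ++ p.2.1, p.2.2))
    (fun p => ([], p.1.flatMap (fun _ => p.2.2) ++ p.2.1, p.2.2)) (fun p => p.1.length)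
    (fun p => p.1.length * p.2.2.length + p.1.length + p.2.1.length + p.2.2.length)
    (Polynomial.X * Polynomial.X + Polynomial.X) ?_ ?_ ?_ ?_ ?_ (fun p => p.2.1) (by simp)
  · rintro ⟨u, v, w⟩ - hu
    rcases u with _ | ⟨b, u⟩
    · exact absurd rfl hu
    · refine ⟨trivial, ?_, by simp, ?_⟩
      · have : ∀ u : Word, w ++ u.flatMap (fun _ => w) = u.flatMap (fun _ => w) ++ w := by
          intro u
          induction u with
          | nil => simp
          | cons b u ih => rw [List.flatMap_cons, List.append_assoc, ← ih]
        simp only [List.flatMap_cons, List.tail_cons, this, List.append_assoc]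
      · simp only [List.tail_cons, List.length_append, List.length_cons]
        rw [Nat.succ_mul]; omega
  · rintro ⟨u, v, w⟩ - hu
    obtain rfl : u = [] := hu
    rfl
  · rintro ⟨u, v, w⟩ -
    simp; omega
  · rintro ⟨u, v, w⟩ -
    constructor <;> simp <;> nlinarith
  · have v1 : Computes A (fun _ : Word × Word × Word => True)
      [fun p => p.1, fun p => p.2.1, fun p => p.2.2] fun p => p.1 := Computes.var (by simp)
    have v2 : Computes A (fun _ : Word × Word × Word => True)
      [fun p => p.1, fun p => p.2.1, fun p => p.2.2] fun p => p.2.1 := Computes.var (by simp)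
    have v3 : Computes A (fun _ : Word × Word × Word => True)
      [fun p => p.1, fun p => p.2.1, fun p => p.2.2] fun p => p.2.2 := Computes.var (by simp)
    intro g hg
    simp only [List.mem_cons, List.not_mem_nil, or_false] at hg
    rcases hg with rfl | rfl | rfl
    · exact v1.tail.mono (by simp)
    · exact (v3.append v2).mono (by simp)
    · exact v3.mono (by simp)

theorem Computes.unary_mul (hf : Computes A D E f) (hg : Computes A D E g) :
    Computes A D E fun a => unary ((f a).length * (g a).length) := by
  have h2 := Computes.app₃ computes_mul_aux hf Computes.nil hg (by simp)
  refine h2.unary_length.congr fun a _ => ?_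
  simp

/-- Values of polynomials, in unary. -/
theorem Computes.unary_eval (P : Polynomial ℕ) (hf : Computes A D E f) :
    Computes A D E fun a => unary (P.eval (f a).length) := by
  induction P using Polynomial.induction_on with
  | C n => simpa using Computes.const (unary n)
  | add p q hp hq => simpa [unary_add] using hp.append hq
  | monomial n c h =>
      refine (h.unary_mul hf).congr fun a _ => ?_
      simp [pow_succ, mul_assoc]

theorem computes_take_aux : Computes A (fun _ => True)
    [fun p => p.1, fun p => p.2.1, fun p => p.2.2]
    fun p : Word × Word × Word => (p.2.1.take p.1.length).reverse ++ p.2.2 := by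
  refine Computes.of_loop (V := [fun p => p.2.1, fun p => p.2.2])
    (fun p => (p.1.tail, p.2.1.tail, if p.2.1 = [] then p.2.2 else p.2.1.headI :: p.2.2))
    (fun p => ([], p.2.1.drop p.1.length, (p.2.1.take p.1.length).reverse ++ p.2.2))
    (fun p => p.1.length) (fun p => p.1.length + p.2.1.length + p.2.2.length)
    Polynomial.X ?_ ?_ ?_ ?_ ?_ (fun p => p.2.2) (by simp)
  · rintro ⟨u, v, w⟩ - hu
    rcases u with _ | ⟨b, u⟩
    · exact absurd rfl hu
    · rcases v with _ | ⟨c, v⟩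
      · simp
      · refine ⟨trivial, by simp, by simp, by simp; omega⟩
  · rintro ⟨u, v, w⟩ - hu
    obtain rfl : u = [] := hu
    rfl
  · rintro ⟨u, v, w⟩ -
    simp; omega
  · rintro ⟨u, v, w⟩ -
    constructor <;> simp; omega
  · have v1 : Computes A (fun _ : Word × Word × Word => True)
      [fun p => p.1, fun p => p.2.1, fun p => p.2.2] fun p => p.1 := Computes.var (by simp)
    have v2 : Computes A (fun _ : Word × Word × Word => True)
      [fun p => p.1, fun p => p.2.1, fun p => p.2.2] fun p => p.2.1 := Computes.var (by simp)
    have v3 : Computes A (fun _ : Word × Word × Word => True)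
      [fun p => p.1, fun p => p.2.1, fun p => p.2.2] fun p => p.2.2 := Computes.var (by simp)
    intro g hg
    simp only [List.mem_cons, List.not_mem_nil, or_false] at hg
    rcases hg with rfl | rfl | rfl
    · exact v1.tail.mono (by simp)
    · exact v2.tail.mono (by simp)
    · refine Computes.case (v2.mono (by simp)) ?_ ?_ ?_
      · exact (v3.mono (by simp)).congr fun a h => by simp [h.2]
      · refine ((v3.cons false).mono (by simp)).congr fun a h => ?_
        rcases hc : a.2.1 with _ | ⟨b, w⟩ <;> simp_all
      · refine ((v3.cons true).mono (by simp)).congr fun a h => ?_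
        rcases hc : a.2.1 with _ | ⟨b, w⟩ <;> simp_all

theorem Computes.take (hf : Computes A D E f) (hg : Computes A D E g) :
    Computes A D E fun a => (f a).take (g a).length := by
  have h2 := Computes.app₃ computes_take_aux hg hf Computes.nil (by simp)
  refine (Computes.reverse h2).congr fun a _ => ?_
  simp

/-! ### Decisions -/

open Classical in
/-- The word that represents the truth value of `P`. -/
noncomputable def truth (P : Prop) : Word := if P then [true] else []

theorem truth_eq_nil {P : Prop} : truth P = [] ↔ ¬ P := by
  unfold truth; split_ifs <;> simp_all

theorem truth_eq_true {P : Prop} : truth P = [true] ↔ P := by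
  unfold truth; split_ifs <;> simp_all

theorem truth_true {P : Prop} (h : P) : truth P = [true] := truth_eq_true.2 h

theorem truth_false {P : Prop} (h : ¬ P) : truth P = [] := truth_eq_nil.2 h

theorem Computes.cond {P : α → Prop} (hP : Computes A D E fun a => truth (P a))
    (h₁ : Computes A (fun a => D a ∧ P a) E f) (h₂ : Computes A (fun a => D a ∧ ¬ P a) E f) :
    Computes A D E f := by
  refine Computes.case hP (h₂.mono fun a h => ⟨h.1, truth_eq_nil.1 h.2⟩) ?_
    (h₁.mono fun a h => ⟨h.1, ?_⟩)
  · refine Computes.congr (f := fun _ => []) Computes.nil fun a h => ?_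
    have := h.2
    unfold truth at this
    split_ifs at this <;> simp at this
  · by_contra hn
    simp [truth_false hn] at h

theorem Computes.nonempty (hf : Computes A D E f) : Computes A D E fun a => truth (f a ≠ []) := by
  refine Computes.case hf ?_ ?_ ?_
  · exact Computes.nil.congr fun a h => (truth_false (by simp [h.2])).symm
  all_goals
    refine (Computes.const [true]).congr fun a h => (truth_true ?_).symm
    intro hn
    simp [hn] at h

theorem Computes.not {P : α → Prop} (hP : Computes A D E fun a => truth (P a)) :
    Computes A D E fun a => truth (¬ P a) :=
  hP.cond (Computes.nil.congr fun _ h => (truth_false (not_not.2 h.2)).symm)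
    ((Computes.const [true]).congr fun _ h => (truth_true h.2).symm)

theorem Computes.and {P Q : α → Prop} (hP : Computes A D E fun a => truth (P a))
    (hQ : Computes A D E fun a => truth (Q a)) : Computes A D E fun a => truth (P a ∧ Q a) :=
  hP.cond ((hQ.mono fun _ h => h.1).congr fun a h => by simp [h.2])
    (Computes.nil.congr fun a h => (truth_false fun h' => h.2 h'.1).symm)

theorem Computes.or {P Q : α → Prop} (hP : Computes A D E fun a => truth (P a))
    (hQ : Computes A D E fun a => truth (Q a)) : Computes A D E fun a => truth (P a ∨ Q a) :=
  hP.cond ((Computes.const [true]).congr fun a h => (truth_true (Or.inl h.2)).symm)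
    ((hQ.mono fun _ h => h.1).congr fun a h => by simp [h.2])

/-- The two words are stripped in parallel, and the third register, initially empty in the
application, becomes `[false]` at a mismatch. The words are equal if and only if no mismatch
occurred and nothing of the second word is left. The domain keeps the third register short, so that
sizes stay bounded. -/
theorem computes_eq_aux : Computes A (fun p => p.2.2.length ≤ 1)
    [fun p => p.1, fun p => p.2.1, fun p => p.2.2]
    (fun p : Word × Word × Word => p.2.1.drop p.1.length) ∧ Computes A (fun p => p.2.2.length ≤ 1)
    [fun p => p.1, fun p => p.2.1, fun p => p.2.2]
    (fun p : Word × Word × Word => if p.1 <+: p.2.1 then p.2.2 else [false]) := by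
  have key := Computes.of_loop (A := A) (α := Word × Word × Word) (D := fun p => p.2.2.length ≤ 1)
    (c := fun p => p.1) (V := [fun p => p.2.1, fun p => p.2.2])
    (fun p => (p.1.tail, p.2.1.tail, if p.2.1.head? = some p.1.headI then p.2.2 else [false]))
    (fun p => ([], p.2.1.drop p.1.length, if p.1 <+: p.2.1 then p.2.2 else [false]))
    (fun p => p.1.length) (fun p => p.1.length + p.2.1.length + 1)
    (Polynomial.X + 1) ?_ ?_ ?_ ?_ ?_
  · exact ⟨key (fun p => p.2.1) (by simp), key (fun p => p.2.2) (by simp)⟩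
  · rintro ⟨u, v, w⟩ hD hu
    rcases u with _ | ⟨b, u⟩
    · exact absurd rfl hu
    · rcases v with _ | ⟨c, v⟩
      · simp
      · have : (some c = some b) ↔ (b = c) := by simp [eq_comm]
        refine ⟨?_, ?_, by simp, by simp; omega⟩
        · dsimp only; split_ifs <;> simp_all
        · by_cases h : b = c
          · subst h; simp
          · simp [List.cons_prefix_cons, this, h]
  · rintro ⟨u, v, w⟩ - hu
    obtain rfl : u = [] := hu
    simp
  · rintro ⟨u, v, w⟩ hD
    simp at hD ⊢; omega
  · rintro ⟨u, v, w⟩ -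
    constructor <;> simp; omega
  · have v1 : Computes A (fun _ : Word × Word × Word => True)
      [fun p => p.1, fun p => p.2.1, fun p => p.2.2] fun p => p.1 := Computes.var (by simp)
    have v2 : Computes A (fun _ : Word × Word × Word => True)
      [fun p => p.1, fun p => p.2.1, fun p => p.2.2] fun p => p.2.1 := Computes.var (by simp)
    have v3 : Computes A (fun _ : Word × Word × Word => True)
      [fun p => p.1, fun p => p.2.1, fun p => p.2.2] fun p => p.2.2 := Computes.var (by simp)
    intro g hg
    simp only [List.mem_cons, List.not_mem_nil, or_false] at hg
    rcases hg with rfl | rfl | rfl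
    · exact v1.tail.mono (by simp)
    · exact v2.tail.mono (by simp)
    · refine Computes.case (v1.mono (by simp)) ?_ ?_ ?_
      · exact (v3.mono (by simp)).congr fun a h => absurd h.2 h.1.2
      · refine Computes.case (v2.mono (by simp)) ?_ ?_ ?_
        · refine (Computes.const [false]).congr fun a h => by simp [h.2]
        · refine (v3.mono (by simp)).congr fun a h => ?_
          rcases hc : a.1 with _ | ⟨b, w⟩ <;> simp_all
        · refine (Computes.const [false]).congr fun a h => ?_
          rcases hc : a.1 with _ | ⟨b, w⟩ <;> simp_all
      · refine Computes.case (v2.mono (by simp)) ?_ ?_ ?_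
        · refine (Computes.const [false]).congr fun a h => by simp [h.2]
        · refine (Computes.const [false]).congr fun a h => ?_
          rcases hc : a.1 with _ | ⟨b, w⟩ <;> simp_all
        · refine (v3.mono (by simp)).congr fun a h => ?_
          rcases hc : a.1 with _ | ⟨b, w⟩ <;> simp_all

theorem Computes.eq (hf : Computes A D E f) (hg : Computes A D E g) :
    Computes A D E fun a => truth (f a = g a) := by
  have h1 := (Computes.app₃ computes_eq_aux.1 hf hg Computes.nil (by simp)).nonempty.not
  have h2 := (Computes.app₃ computes_eq_aux.2 hf hg Computes.nil (by simp)).nonempty.not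
  refine (h1.and h2).congr fun a _ => congrArg truth (propext ?_)
  simp only [ne_eq, not_not, List.drop_eq_nil_iff, ite_eq_left_iff, List.cons_ne_nil, imp_false]
  constructor
  · rintro ⟨h1, h2⟩
    exact h2.eq_of_length_le h1
  · intro h
    rw [h]
    exact ⟨le_rfl, List.prefix_rfl⟩

/-! ### Sequences of words -/

/-- The rest of a word after the first encoded word, or `v` if there is no end mark. -/
def tlAux (v : Word) : Word → Word
  | true :: _ :: w => tlAux v w
  | false :: w => w
  | _ => v

/-- The first word encoded in a sequence. -/
def hdW : Word → Word
  | true :: b :: w => b :: hdW w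
  | _ => []

/-- The sequence without its first word. -/
def tlW (w : Word) : Word := tlAux [] w

theorem hdW_encWord : ∀ u v : Word, hdW (encWord u ++ v) = u
  | [], v => by simp [encWord, hdW]
  | b :: u, v => by simp [encWord, hdW, hdW_encWord u v]

theorem tlW_encWord : ∀ u v : Word, tlW (encWord u ++ v) = v
  | [], v => by simp [encWord, tlW, tlAux]
  | b :: u, v => by simpa [encWord, tlW, tlAux] using tlW_encWord u v

theorem length_tlAux : ∀ w : Word, w ≠ [] → (tlW w).length < w.length
  | true :: b :: w, _ => by
      rcases w with _ | ⟨c, w⟩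
      · simp [tlW, tlAux]
      · have := length_tlAux (c :: w) (by simp)
        simp only [tlW, tlAux, List.length_cons] at this ⊢
        omega
  | false :: w, _ => by simp [tlW, tlAux]
  | [true], _ => by simp [tlW, tlAux]

theorem length_hdW : ∀ w : Word, (hdW w).length ≤ w.length
  | true :: b :: w => by
      have := length_hdW w
      simp only [hdW, List.length_cons]; omega
  | false :: w => by simp [hdW]
  | [true] => by simp [hdW]
  | [] => by simp [hdW]

/-- The first register is read two bits at a time. At the end mark its remainder moves to the second
register and the first one is emptied, which stops the loop; the third register collects the decoded
word in reverse. The default value of `tlAux` is the initial content of the second register. -/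
theorem computes_parse_aux : Computes A (fun _ => True)
    [fun p => p.1, fun p => p.2.1, fun p => p.2.2]
    (fun p : Word × Word × Word => tlAux p.2.1 p.1) ∧ Computes A (fun _ => True)
    [fun p => p.1, fun p => p.2.1, fun p => p.2.2]
    (fun p : Word × Word × Word => (hdW p.1).reverse ++ p.2.2) := by
  have key := Computes.of_loop (A := A) (α := Word × Word × Word) (D := fun _ => True)
    (c := fun p => p.1) (V := [fun p => p.2.1, fun p => p.2.2])
    (fun p => (if p.1.head? = some true then p.1.tail.tail else [],
      if p.1.head? = some false then p.1.tail else p.2.1,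
      if p.1.head? = some true ∧ p.1.tail ≠ [] then p.1.tail.headI :: p.2.2 else p.2.2))
    (fun p => ([], tlAux p.2.1 p.1, (hdW p.1).reverse ++ p.2.2))
    (fun p => p.1.length) (fun p => p.1.length + p.2.1.length + p.2.2.length)
    Polynomial.X ?_ ?_ ?_ ?_ ?_
  · exact ⟨key (fun p => p.2.1) (by simp), key (fun p => p.2.2) (by simp)⟩
  · rintro ⟨u, v, w⟩ - hu
    rcases u with _ | ⟨_ | _, u⟩
    · exact absurd rfl hu
    · simp [tlAux, MCSRepair.hdW]; omega
    · rcases u with _ | ⟨b, u⟩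
      · simp [tlAux, MCSRepair.hdW]
      · simp [tlAux, MCSRepair.hdW]; omega
  · rintro ⟨u, v, w⟩ - hu
    obtain rfl : u = [] := hu
    simp [tlAux, hdW]
  · rintro ⟨u, v, w⟩ -
    simp; omega
  · rintro ⟨u, v, w⟩ -
    constructor <;> simp; omega
  · have v1 : Computes A (fun _ : Word × Word × Word => True)
      [fun p => p.1, fun p => p.2.1, fun p => p.2.2] fun p => p.1 := Computes.var (by simp)
    have v2 : Computes A (fun _ : Word × Word × Word => True)
      [fun p => p.1, fun p => p.2.1, fun p => p.2.2] fun p => p.2.1 := Computes.var (by simp)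
    have v3 : Computes A (fun _ : Word × Word × Word => True)
      [fun p => p.1, fun p => p.2.1, fun p => p.2.2] fun p => p.2.2 := Computes.var (by simp)
    intro g hg
    simp only [List.mem_cons, List.not_mem_nil, or_false] at hg
    rcases hg with rfl | rfl | rfl
    · refine Computes.case (v1.mono (by simp)) ?_ ?_ ?_
      · exact Computes.nil.congr fun a h => by simp [h.2]
      · exact Computes.nil.congr fun a h => by simp [h.2]
      · exact (v1.tail.tail.mono (by simp)).congr fun a h => by simp [h.2]
    · refine Computes.case (v1.mono (by simp)) ?_ ?_ ?_
      · exact (v2.mono (by simp)).congr fun a h => by simp [h.2]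
      · exact (v1.tail.mono (by simp)).congr fun a h => by simp [h.2]
      · exact (v2.mono (by simp)).congr fun a h => by simp [h.2]
    · refine Computes.case (v1.mono (by simp)) ?_ ?_ ?_
      · exact (v3.mono (by simp)).congr fun a h => by simp [h.2]
      · exact (v3.mono (by simp)).congr fun a h => by simp [h.2]
      · refine Computes.case (v1.tail.mono (by simp)) ?_ ?_ ?_
        · exact (v3.mono (by simp)).congr fun a h => by simp [h.2]
        · refine ((v3.cons false).mono (by simp)).congr fun a h => ?_
          rcases hc : a.1.tail with _ | ⟨b, w⟩ <;> simp_all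
        · refine ((v3.cons true).mono (by simp)).congr fun a h => ?_
          rcases hc : a.1.tail with _ | ⟨b, w⟩ <;> simp_all

theorem Computes.hdW (hf : Computes A D E f) : Computes A D E fun a => hdW (f a) := by
  have h2 := Computes.app₃ computes_parse_aux.2 hf Computes.nil Computes.nil (by simp)
  refine (Computes.reverse h2).congr fun a _ => ?_
  simp

theorem Computes.tlW (hf : Computes A D E f) : Computes A D E fun a => tlW (f a) :=
  Computes.app₃ computes_parse_aux.1 hf Computes.nil Computes.nil (by simp)

/-- The words encoded in a sequence. -/
def parseList (w : Word) : List Word :=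
  if w = [] then [] else hdW w :: parseList (tlW w)
termination_by w.length
decreasing_by exact length_tlAux w ‹_›

theorem parseList_nil : parseList [] = [] := by rw [parseList]; simp

theorem parseList_of_ne {w : Word} (h : w ≠ []) :
    parseList w = hdW w :: parseList (tlW w) := by
  conv_lhs => rw [parseList]
  simp [h]

theorem parseList_encList : ∀ l : List Word, parseList (encList l) = l
  | [] => parseList_nil
  | w :: l => by
      have : encList (w :: l) ≠ [] := by cases w <;> simp [encList, encWord]
      rw [parseList_of_ne this, encList, hdW_encWord, tlW_encWord, parseList_encList l]

/-- Each parsed word consumes at least one bit, so there are at most `w.length` of them. This holds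
for words that are not codes too, as is needed for arbitrary certificates. -/
theorem length_flatMap_parseList (F : Word → Word) (B : ℕ) : ∀ (w : Word),
    (∀ b ∈ parseList w, (F b).length ≤ B) →
    ((parseList w).flatMap F).length ≤ w.length * B := by
  intro w
  induction hn : w.length using Nat.strong_induction_on generalizing w with
  | _ n ih =>
    intro h
    by_cases hw : w = []
    · subst hw; simp [parseList_nil]
    · have h1 := length_tlAux w hw
      rw [parseList_of_ne hw] at h ⊢
      have h2 := ih _ (hn ▸ h1) _ rfl fun b hb => h b (by simp [hb])
      have h3 := h (MCSRepair.hdW w) (by simp)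
      simp only [List.flatMap_cons, List.length_append]
      have h4 : ((tlW w).length + 1) * B ≤ n * B := Nat.mul_le_mul_right _ (by omega)
      rw [Nat.succ_mul] at h4
      omega

theorem length_le_of_mem_parseList : ∀ (w b : Word), b ∈ parseList w → b.length ≤ w.length := by
  intro w
  induction hn : w.length using Nat.strong_induction_on generalizing w with
  | _ n ih =>
    intro b hb
    by_cases hw : w = []
    · subst hw; simp [parseList_nil] at hb
    · have h1 := length_tlAux w hw
      rw [parseList_of_ne hw, List.mem_cons] at hb
      rcases hb with rfl | hb
      · exact (length_hdW w).trans hn.le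
      · exact (ih _ (hn ▸ h1) _ rfl b hb).trans (by omega)

/-- Concatenation of the values of a function on the words of a sequence. -/
theorem Computes.flatMap {w : α → Word} {F : α → Word → Word} (hw : Computes A D E w)
    (hF : Computes A (fun p : α × Word => D p.1 ∧ p.2 ∈ parseList (w p.1))
      (Prod.snd :: E.map (· ∘ Prod.fst)) fun p => F p.1 p.2) :
    Computes A D E fun a => (parseList (w a)).flatMap (F a) := by
  obtain ⟨G, hG⟩ := hF.size_le
  -- A state consists of the instance, the unread part of the sequence and the output so far. The
  -- domain records that unread words belong to `w a`, since `F` is computable only on those.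
  let D' : α × Word × Word → Prop := fun s => D s.1 ∧ ∀ b ∈ parseList s.2.1, b ∈ parseList (w s.1)
  let V : List (α × Word × Word → Word) := (fun s => s.2.2) :: E.map (· ∘ Prod.fst)
  have hV : ∀ s : α × Word × Word, size (vals ((fun s => s.2.1) :: V) s) =
      s.2.1.length + (s.2.2.length + size (vals E s.1)) := by
    intro s
    simp [V, vals, Function.comp_def]
  have vrest : ∀ D'' : α × Word × Word → Prop, Computes A D'' ((fun s => s.2.1) :: V)
    fun s => s.2.1 := fun _ => Computes.var (by simp)
  have vacc : ∀ D'' : α × Word × Word → Prop, Computes A D'' ((fun s => s.2.1) :: V)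
    fun s => s.2.2 := fun _ => Computes.var (by simp [V])
  have venv : ∀ D'' : α × Word × Word → Prop, ∀ e ∈ E, Computes A D'' ((fun s => s.2.1) :: V)
    fun s => e s.1 := fun _ e he =>
      Computes.var (List.mem_cons_of_mem _ (List.mem_cons_of_mem _ (List.mem_map_of_mem he)))
  have hG' : ∀ s, D' s → ∀ b ∈ parseList s.2.1,
      (F s.1 b).length ≤ G.eval (s.2.1.length + size (vals E s.1)) := by
    intro s hs b hb
    refine (hG (s.1, b) ⟨hs.1, hs.2 b hb⟩).trans (eval_mono _ ?_)
    have := length_le_of_mem_parseList _ _ hb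
    simp only [vals, List.map_cons, List.map_map, size_cons, Function.comp_def]
    omega
  -- The potential includes the length of the output still to be produced, so moving a value into
  -- the accumulator does not raise it.
  have key := Computes.of_loop (A := A) (D := D') (c := fun s => s.2.1) (V := V)
    (fun s => (s.1, MCSRepair.tlW s.2.1, s.2.2 ++ F s.1 (MCSRepair.hdW s.2.1)))
    (fun s => (s.1, [], s.2.2 ++ (parseList s.2.1).flatMap (F s.1)))
    (fun s => s.2.1.length)
    (fun s => s.2.1.length + (s.2.2.length + size (vals E s.1)) +
      ((parseList s.2.1).flatMap (F s.1)).length)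
    (Polynomial.X + Polynomial.X * G) ?_ ?_ ?_ ?_ ?_ (fun s => s.2.2) (by simp [V])
  · have h1 := (Trans.reindex key fun a => (a, w a, [])).mono (D' := D) fun a ha => ⟨ha, by simp⟩
    refine (Computes.subst (E := E) h1 ?_).congr fun a _ => by simp
    intro g hg
    simp only [V, List.map_cons, List.map_map, List.mem_cons, List.mem_map] at hg
    rcases hg with rfl | rfl | ⟨e, he, rfl⟩
    · exact hw
    · exact Computes.nil
    · exact Computes.var he
  · rintro ⟨a, r, v⟩ hD hr
    have hr : r ≠ [] := hr
    have e := parseList_of_ne hr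
    refine ⟨⟨hD.1, fun b hb => hD.2 b ?_⟩, ?_, length_tlAux r hr, ?_⟩
    · change b ∈ parseList r
      rw [e]; exact List.mem_cons_of_mem _ hb
    · dsimp only
      rw [e]; simp
    · have := length_tlAux r hr
      dsimp only
      rw [e]
      simp only [List.length_append, List.flatMap_cons]
      omega
  · rintro ⟨a, r, v⟩ hD hr
    obtain rfl : r = [] := hr
    simp [parseList_nil]
  · intro s hs
    rw [hV]; omega
  · intro s hs
    rw [hV]
    have h1 := length_flatMap_parseList (F s.1) _ s.2.1 (hG' s hs)
    have h2 : s.2.1.length * G.eval (s.2.1.length + size (vals E s.1)) ≤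
        (s.2.1.length + (s.2.2.length + size (vals E s.1))) *
          G.eval (s.2.1.length + (s.2.2.length + size (vals E s.1))) :=
      Nat.mul_le_mul (by omega) (eval_mono _ (by omega))
    simp only [Polynomial.eval_add, Polynomial.eval_mul, Polynomial.eval_X]
    constructor <;> omega
  · intro g hg
    simp only [V, List.mem_cons, List.mem_map] at hg
    rcases hg with rfl | rfl | ⟨e, he, rfl⟩
    · exact (vrest _).tlW
    · refine (vacc _).append ?_
      have h1 := (Trans.reindex hF fun s : α × Word × Word => (s.1, MCSRepair.hdW s.2.1)).mono
        (D' := fun s => D' s ∧ s.2.1 ≠ []) fun s hs => ⟨hs.1.1, hs.1.2 _ (by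
          rw [parseList_of_ne hs.2]; simp)⟩
      refine Computes.subst (E := (fun s => s.2.1) :: V) h1 ?_
      intro g hg
      simp only [List.map_cons, List.map_map, List.mem_cons, List.mem_map] at hg
      rcases hg with rfl | ⟨e, he, rfl⟩
      · exact (vrest _).hdW
      · exact venv _ e he
    · exact venv _ e he

theorem Computes.exists_mem {w : α → Word} {P : α → Word → Prop} (hw : Computes A D E w)
    (hP : Computes A (fun p : α × Word => D p.1 ∧ p.2 ∈ parseList (w p.1))
      (Prod.snd :: E.map (· ∘ Prod.fst)) fun p => truth (P p.1 p.2)) :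
    Computes A D E fun a => truth (∃ b ∈ parseList (w a), P a b) := by
  refine (hw.flatMap (F := fun a b => truth (P a b)) hP).nonempty.congr fun a _ => congrArg truth (propext ?_)
  simp [List.flatMap_eq_nil_iff, truth_eq_nil]

/-- The nonempty suffixes of a word. -/
def suffixes : Word → List Word
  | [] => []
  | b :: w => (b :: w) :: suffixes w

/-- Suffixes serve as loop indices: the nonempty suffixes of a unary number stand for the smaller
numbers, and a suffix of the input identifies a position together with the bit there. The potential
allots `2 * u.length + 2` to each remaining suffix, enough for its code. -/
theorem computes_suffixes_aux : Computes A (fun _ => True) [Prod.fst, Prod.snd]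
    fun p : Word × Word => p.2 ++ encList (suffixes p.1) := by
  have len : ∀ w : Word, (MCSRepair.encWord w).length = 2 * w.length + 1 := by
    intro w
    induction w with
    | nil => rfl
    | cons b w ih => simp [MCSRepair.encWord, ih]; omega
  refine Computes.of_loop (V := [Prod.snd]) (fun p => (p.1.tail, p.2 ++ MCSRepair.encWord p.1))
    (fun p => ([], p.2 ++ encList (suffixes p.1))) (fun p => p.1.length)
    (fun p => p.1.length * (2 * p.1.length + 2) + p.2.length)
    (2 * Polynomial.X * Polynomial.X + 2 * Polynomial.X) ?_ ?_ ?_ ?_ ?_ Prod.snd (by simp)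
  · rintro ⟨u, v⟩ - hu
    rcases u with _ | ⟨b, u⟩
    · exact absurd rfl hu
    · refine ⟨trivial, by simp [suffixes, encList], by simp, ?_⟩
      simp [len]
      nlinarith
  · rintro ⟨u, v⟩ - hu
    obtain rfl : u = [] := hu
    simp [suffixes, encList]
  · rintro ⟨u, v⟩ -
    simp; nlinarith
  · rintro ⟨u, v⟩ -
    constructor <;> simp <;> nlinarith
  · have v1 : Computes A (fun _ : Word × Word => True) [Prod.fst, Prod.snd] Prod.fst :=
      Computes.var (by simp)
    have v2 : Computes A (fun _ : Word × Word => True) [Prod.fst, Prod.snd] Prod.snd :=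
      Computes.var (by simp)
    intro g hg
    simp only [List.mem_cons, List.not_mem_nil, or_false] at hg
    rcases hg with rfl | rfl
    · exact v1.tail.mono (by simp)
    · exact (v2.append v1.encWord).mono (by simp)

theorem Computes.suffixes (hf : Computes A D E f) :
    Computes A D E fun a => encList (suffixes (f a)) := by
  have := Computes.app₂ (H := fun u v => v ++ encList (MCSRepair.suffixes u))
    computes_suffixes_aux hf Computes.nil
  simpa using this

end WordFunctions

/-! ## Depth of the repair tree -/

theorem depth_le {m : Mode} {M : MCS} {η : List (AIC M.toFrame)} {ground : List (GroundAIC M.toFrame)}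
    (hg : ∀ g, g ∈ ground ↔ g ∈ groundInstances η) {k : ℕ} {node : ℕ → Set (Action M.toFrame)}
    (h : IsTreePath m M (groundInstances η) k node) :
    k ≤ (ground.map fun g => g.head.length).sum := by
  classical
  set l : List (Action M.toFrame) := ground.flatMap fun g => g.head with hl
  have key : ∀ j, j ≤ k → node j ⊆ {a | a ∈ l} ∧ j ≤ (node j).ncard := by
    intro j
    induction j with
    | zero => intro _; rw [h.root]; simp
    | succ j ih =>
        intro hj
        obtain ⟨hs, hc⟩ := ih (by omega)
        obtain ⟨r, hr, hn, W, hW, he, hs', -⟩ := h.child j (by omega)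
        have hsub : node (j + 1) ⊆ {a | a ∈ l} := by
          rw [he]
          rintro a (ha | ha)
          · exact hs ha
          · exact List.mem_flatMap.2 ⟨r, (hg r).2 hr, hW a ha⟩
        refine ⟨hsub, ?_⟩
        -- The rule `r` is violated at the parent and satisfied at the child, so the two sets
        -- differ.
        have hss : node j ⊂ node (j + 1) := by
          refine (Set.subset_union_left.trans he.ge).ssubset_of_ne fun e => hn ?_
          rw [e]; exact hs'
        have := Set.ncard_lt_ncard hss ((List.finite_toSet l).subset hsub)
        omega
  obtain ⟨hs, hc⟩ := key k le_rfl
  have h1 := Set.ncard_le_ncard hs (List.finite_toSet l)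
  have h2 : {a | a ∈ l}.ncard ≤ l.length := by
    have : {a | a ∈ l} = (l.toFinset : Set _) := by ext; simp
    rw [this, Set.ncard_coe_finset]
    exact l.toFinset_card_le
  have h3 : l.length = (ground.map fun g => g.head.length).sum := by simp [hl, List.length_flatMap]
  omega

/-! ## Membership -/

section Membership

variable {A : Set Word} {α β : Type*} {D : α → Prop} {E : List (α → Word)} {f g : α → Word}

/-- By determinism the final content of stack `0` is a function of the instance. It can be computed
despite the garbage on other stacks, and is then compared with `[true]`. -/
theorem Computes.accepts (p : Prog) (T : Polynomial ℕ)
    (h : ∀ a, D a → HaltsWithin A p (vals E a) (T.eval (size (vals E a)))) :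
    Computes A D E fun a => truth (Accepts A p (vals E a)) := by
  classical
  let out : α → Word := fun a => if h : ∃ s t, Exec A p (initStacks (vals E a)) s t
    then h.choose 0 else []
  have hout : ∀ a s t, Exec A p (initStacks (vals E a)) s t → s 0 = out a := by
    intro a s t he
    have hex : ∃ s t, Exec A p (initStacks (vals E a)) s t := ⟨s, t, he⟩
    obtain ⟨t', he'⟩ := hex.choose_spec
    simp only [out, dif_pos hex]
    rw [(he.det he').1]
  have h1 : Computes A D E out := Computes.of_exec p T fun a ha => by
    obtain ⟨s, t, he, ht⟩ := h a ha
    exact ⟨s, t, he, ht, hout a s t he⟩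
  refine (h1.eq (Computes.const [true])).congr fun a ha => congrArg truth (propext ?_)
  constructor
  · intro e
    obtain ⟨s, t, he, -⟩ := h a ha
    exact ⟨s, t, he, (hout a s t he).trans e⟩
  · rintro ⟨s, t, he, e⟩
    rw [← hout a s t he, e]

theorem InP.computes {enc : α → Word} {P : α → Prop} (h : InP A enc P) :
    Computes A (fun _ => True) [enc] fun a => truth (P a) := by
  obtain ⟨p, T, hp⟩ := h
  refine (Computes.accepts (E := [enc]) p T fun a _ => ?_).congr fun a _ =>
    congrArg truth (propext (hp a).2.symm)
  simpa using (hp a).1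

theorem InSigma2.of_computes {enc : α → Word} {P : α → Prop} (q : Polynomial ℕ)
    (chk : α × Word × Word → Prop)
    (h : Computes A (fun _ => True) [fun x => enc x.1, fun x => x.2.1, fun x => x.2.2]
      fun x => truth (chk x))
    (hP : ∀ a, P a ↔ ∃ y : Word, y.length ≤ q.eval (enc a).length ∧
      ∀ z : Word, z.length ≤ q.eval (enc a).length → chk (a, y, z)) :
    InSigma2 A enc P := by
  obtain ⟨p, T, hp⟩ := h
  refine ⟨p, T, q, fun a => ⟨fun y z => ?_, ?_⟩⟩
  · obtain ⟨t, ht, he⟩ := hp (a, y, z) trivial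
    exact ⟨_, t, he, ht.trans (le_of_eq (by simp [vals, add_assoc]))⟩
  · rw [hP]
    have : ∀ y z, Accepts A p [enc a, y, z] ↔ chk (a, y, z) := by
      intro y z
      obtain ⟨t, ht, he⟩ := hp (a, y, z) trivial
      constructor
      · rintro ⟨s, t', he', h0⟩
        rw [← (he.det he').1] at h0
        exact truth_eq_true.1 h0
      · intro h
        exact ⟨_, t, he, truth_true h⟩
    simp only [this]

/-- Replace the instances by other ones with the same registers. -/
theorem Computes.transfer {D' : β → Prop} {E' : List (β → Word)} {f' : β → Word}
    (h : Computes A D E f) (hE : ∀ b, D' b → ∃ a, D a ∧ vals E a = vals E' b ∧ f a = f' b) :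
    Computes A D' E' f' := by
  obtain ⟨p, T, hp⟩ := h
  refine ⟨p, T, fun b hb => ?_⟩
  obtain ⟨a, ha, e1, e2⟩ := hE b hb
  obtain ⟨t, ht, he⟩ := hp a ha
  rw [e1] at ht he
  refine ⟨t, ht, ?_⟩
  simpa [vals, e2] using he

theorem encList_eq_flatMap (l : List Word) : encList l = l.flatMap encWord := by
  induction l with
  | nil => rfl
  | cons w l ih => simp [encList, ih]

theorem encList_append (l k : List Word) : encList (l ++ k) = encList l ++ encList k := by
  simp [encList_eq_flatMap]

theorem encList_flatMap {γ : Type*} (l : List γ) (F : γ → List Word) :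
    encList (l.flatMap F) = l.flatMap fun x => encList (F x) := by
  induction l with
  | nil => rfl
  | cons a l ih => simp [encList_append, ih]

theorem Computes.encList_cons {l : α → List Word} (hf : Computes A D E f)
    (hl : Computes A D E fun a => encList (l a)) :
    Computes A D E fun a => encList (f a :: l a) := hf.encWord.append hl

theorem Computes.encList_nil : Computes A D E fun _ => encList [] := Computes.nil

theorem Computes.mem_parseList (hf : Computes A D E f) (hg : Computes A D E g) :
    Computes A D E fun a => truth (f a ∈ parseList (g a)) := by
  refine (Computes.exists_mem (P := fun a b => f a = b) hg ?_).congr fun a _ =>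
    congrArg truth (propext (by simp))
  exact (hf.lift _ (fun _ h => h.1) _).eq (Computes.var (by simp))

open Classical in
theorem Computes.filter_parseList (hf : Computes A D E f) (hg : Computes A D E g) :
    Computes A D E fun a => encList ((parseList (f a)).filter (· ∈ parseList (g a))) := by
  refine (Computes.flatMap (F := fun a b => if b ∈ parseList (g a) then MCSRepair.encWord b else []) hf
    ?_).congr fun a _ => ?_
  · have hb : ∀ D' : α × Word → Prop, Computes A D' (Prod.snd :: E.map (· ∘ Prod.fst)) Prod.snd :=
      fun _ => Computes.var (by simp)
    refine Computes.cond (P := fun p : α × Word => p.2 ∈ parseList (g p.1))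
      ((hb _).mem_parseList (hg.lift _ (fun _ h => h.1) _)) ?_ ?_
    · exact (hb _).encWord.congr fun a h => by simp [h.2]
    · exact Computes.nil.congr fun a h => by simp [h.2]
  · induction parseList (f a) with
    | nil => rfl
    | cons b l ih =>
        by_cases h : b ∈ parseList (g a)
        · simpa [h, encList] using ih
        · simpa [h, encList] using ih

theorem Computes.subset_parseList (hf : Computes A D E f) (hg : Computes A D E g) :
    Computes A D E fun a => truth (∀ b ∈ parseList (f a), b ∈ parseList (g a)) :=
  (Computes.exists_mem (P := fun a b => ¬ b ∈ parseList (g a)) hf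
    ((Computes.var (by simp)).mem_parseList (hg.lift _ (fun _ h => h.1) _)).not).not.congr
    fun a _ => congrArg truth (propext (by simp))

/-- For `b` the code of a ground AIC, `hdW (tlW (tlW b))` is the code of its head. If `f` and `g`
code `U` and `V`, and `S` is satisfaction after `V`, this decides whether some rule supports going
beyond `V`. -/
theorem Computes.supported {w : α → Word} {S : α → Word → Prop} (hf : Computes A D E f)
    (hg : Computes A D E g) (hw : Computes A D E w)
    (hS : Computes A (fun p : α × Word => D p.1 ∧ p.2 ∈ parseList (w p.1))
      (Prod.snd :: E.map (· ∘ Prod.fst)) fun p => truth (S p.1 p.2)) :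
    Computes A D E fun a => truth (∃ b ∈ parseList (w a), ¬ S a b ∧
      ∃ h ∈ parseList (MCSRepair.hdW (MCSRepair.tlW (MCSRepair.tlW b))),
        h ∈ parseList (f a) ∧ ¬ h ∈ parseList (g a)) := by
  refine Computes.exists_mem (P := fun a b => ¬ S a b ∧
    ∃ h ∈ parseList (MCSRepair.hdW (MCSRepair.tlW (MCSRepair.tlW b))),
      h ∈ parseList (f a) ∧ ¬ h ∈ parseList (g a)) hw (hS.not.and ?_)
  refine Computes.exists_mem (P := fun (p : α × Word) h => h ∈ parseList (f p.1) ∧ ¬ h ∈ parseList (g p.1))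
    (Computes.var (by simp)).tlW.tlW.hdW ?_
  have hf' := (hf.lift (fun p : α × Word => D p.1) (fun _ h => h) Prod.snd).lift
    (fun p : (α × Word) × Word => D p.1.1) (fun _ h => h) Prod.snd
  have hg' := (hg.lift (fun p : α × Word => D p.1) (fun _ h => h) Prod.snd).lift
    (fun p : (α × Word) × Word => D p.1.1) (fun _ h => h) Prod.snd
  exact ((Computes.var (by simp)).mem_parseList (hf'.mono fun _ h => h.1.1)).and
    ((Computes.var (by simp)).mem_parseList (hg'.mono fun _ h => h.1.1)).not

theorem length_encWord (w : Word) : (encWord w).length = 2 * w.length + 1 := by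
  induction w with
  | nil => rfl
  | cons b w ih => simp [encWord, ih]; omega

theorem length_encList (l : List Word) :
    (encList l).length = (l.map fun w => 2 * w.length + 1).sum := by
  induction l with
  | nil => rfl
  | cons w l ih => simp [encList, ih, length_encWord]

theorem length_le_encList {w : Word} {l : List Word} (h : w ∈ l) :
    2 * w.length + 1 ≤ (encList l).length := by
  rw [length_encList]
  exact List.single_le_sum (by simp) _ (List.mem_map_of_mem (f := fun w => 2 * w.length + 1) h)

theorem length_encList_sublist {l k : List Word} (h : l.Sublist k) :
    (encList l).length ≤ (encList k).length := by
  rw [length_encList, length_encList]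
  exact (h.map _).sum_le_sum (by simp)

theorem CodedMCS.groundCode_injective (M : CodedMCS) : Function.Injective M.groundCode := by
  rintro ⟨a, b, c⟩ ⟨a', b', c'⟩ h
  have h1 := encList_injective h
  simp only [List.cons.injEq, and_true] at h1
  obtain ⟨h1, h2, h3⟩ := h1
  have h1 := List.map_injective_iff.2 M.litCode_injective (encList_injective h1)
  have h2 := List.map_injective_iff.2 M.litCode_injective (encList_injective h2)
  have h3 := List.map_injective_iff.2 M.actCode_injective (encList_injective h3)
  subst h1 h2 h3
  rfl

end Membership

/-! ### Certificates and challenges for grounded repairs. -/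

section Repairs

variable {C : MCSClass}

/-- All actions in heads of closed instances. -/
def MCSClass.Input.heads (x : C.Input) : List (Action (C.mcs x.name).toFrame) :=
  x.ground.flatMap fun g => g.head

open Classical in
/-- The actions in the list whose codes occur in the sequence `w`. -/
noncomputable def select {M : CodedMCS} (l : List (Action M.toFrame)) (w : Word) :
    List (Action M.toFrame) := l.filter fun a => M.actCode a ∈ parseList w

theorem mem_select {M : CodedMCS} {l : List (Action M.toFrame)} {w : Word}
    {a : Action M.toFrame} : a ∈ select l w ↔ a ∈ l ∧ M.actCode a ∈ parseList w := by
  simp [select]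

open Classical in
theorem map_select {M : CodedMCS} (l : List (Action M.toFrame)) (w : Word) :
    (select l w).map M.actCode = (l.map M.actCode).filter (· ∈ parseList w) := by
  rw [List.filter_map]; rfl

/-- Selecting from a fixed list turns every word into a legitimate subset, so certificates need no
test of well-formedness; here it is seen that no subset is missed and that short words suffice. -/
theorem exists_select {M : CodedMCS} (l : List (Action M.toFrame)) (U : Set (Action M.toFrame))
    (hU : ∀ a ∈ U, a ∈ l) : ∃ w, w.length ≤ (encList (l.map M.actCode)).length ∧
      {a | a ∈ select l w} = U := by
  classical
  refine ⟨encList ((l.filter (· ∈ U)).map M.actCode),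
    length_encList_sublist (List.filter_sublist.map _), ?_⟩
  ext a
  simp only [Set.mem_ofPred_eq, mem_select, parseList_encList,
    List.mem_map_of_injective M.actCode_injective]
  simp only [List.mem_filter, decide_eq_true_eq]
  exact ⟨fun h => h.2.2, fun h => ⟨hU a h, hU a h, h⟩⟩

/-- The condition on the certificate `y` for a repair and the challenge `z`; `cons` says that
`z` does not refute the consistency of a variant. -/
def MCSClass.Input.Check (m : Mode) (cons : C.Variant → Word → Prop) (x : C.Input) (y z : Word) :
    Prop :=
  if z = [] then MCSClass.SatInput.Sat m ⟨⟨x.name, select x.heads y⟩, x.ground⟩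
  else if z.head? = some false then cons ⟨x.name, select x.heads y⟩ z.tail
  else (∀ a ∈ select x.heads y, a ∈ select (select x.heads y) z.tail) ∨
    ∃ g ∈ x.ground,
      ¬ MCSClass.SatInput.Sat m ⟨⟨x.name, select (select x.heads y) z.tail⟩, [g]⟩ ∧
      ∃ a ∈ g.head, a ∈ select x.heads y ∧ a ∉ select (select x.heads y) z.tail

/-- A conjunction of three tests is a single universal quantifier over challenges whose first bit,
or emptiness, tells which test is meant. That tag bit accounts for the `+ 1` in both length bounds.
-/
theorem MCSClass.Input.hasRepair_iff (m : Mode) (cons : C.Variant → Word → Prop) (x : C.Input)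
    (B : ℕ) (hcons : ∀ y, MCSClass.Variant.Consistent ⟨x.name, select x.heads y⟩ ↔
      ∀ z : Word, z.length + 1 ≤ B → cons ⟨x.name, select x.heads y⟩ z)
    (hB : (encList (x.heads.map (C.mcs x.name).actCode)).length + 1 ≤ B) :
    x.HasRepair m ↔ ∃ y : Word, y.length ≤ B ∧ ∀ z : Word, z.length ≤ B →
      x.Check m cons y z := by
  have hR : groundInstances x.aics = {g | g ∈ x.ground} := by
    ext g; exact (x.mem_ground g).symm
  unfold MCSClass.Input.HasRepair HasGroundedRepair IsWeakRepair IsGrounded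
  rw [hR]
  constructor
  · rintro ⟨U, ⟨hfin, hc, hs⟩, hg⟩
    have hU : ∀ a ∈ U, a ∈ x.heads := by
      by_contra hn
      push Not at hn
      obtain ⟨a, ha, hna⟩ := hn
      -- Groundedness for the head actions in `U`: a supporting action outside this set would be a
      -- head action in `U`, hence inside it.
      obtain ⟨r, hr, -, b, hb, hbU, hbn⟩ := hg (U ∩ {a | a ∈ x.heads})
        ⟨Set.inter_subset_left, fun h => hna (h ha).2⟩
      exact hbn ⟨hbU, List.mem_flatMap.2 ⟨r, hr, hb⟩⟩
    obtain ⟨y, hy, rfl⟩ := exists_select x.heads U hU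
    refine ⟨y, by omega, fun z hz => ?_⟩
    unfold MCSClass.Input.Check
    split_ifs with h1 h2
    · exact hs
    · refine (hcons y).1 hc _ ?_
      rcases z with _ | ⟨b, z⟩
      · exact absurd rfl h1
      · simpa using hz
    -- The challenge may select all of `U`; support is demanded for proper subsets only.
    · by_cases hsub : ∀ a ∈ select x.heads y, a ∈ select (select x.heads y) z.tail
      · exact Or.inl hsub
      · right
        obtain ⟨r, hr, hnr, a, ha, haU, hna⟩ := hg {a | a ∈ select (select x.heads y) z.tail}
          ⟨fun a ha => (mem_select.1 ha).1, hsub⟩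
        refine ⟨r, hr, fun h => hnr ?_, a, ha, haU, hna⟩
        simpa [MCSClass.SatInput.Sat] using h
  · rintro ⟨y, -, hy⟩
    refine ⟨{a | a ∈ select x.heads y}, ⟨List.finite_toSet _, (hcons y).2 fun z hz => ?_, ?_⟩, ?_⟩
    · simpa [MCSClass.Input.Check] using hy (false :: z) (by simpa using hz)
    · have := hy [] (by simp)
      simp only [MCSClass.Input.Check, if_true] at this
      exact this
    · intro V hV
      obtain ⟨z, hz, rfl⟩ := exists_select (select x.heads y) V fun a ha => hV.1 ha
      have hz' : z.length ≤ (encList (x.heads.map (C.mcs x.name).actCode)).length :=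
        hz.trans (length_encList_sublist (List.filter_sublist.map _))
      have := hy (true :: z) (by simp; omega)
      simp only [MCSClass.Input.Check, List.cons_ne_nil, if_false, List.head?_cons,
        Option.some.injEq, Bool.true_eq_false, List.tail_cons] at this
      rcases this with h | ⟨g, hg, hng, a, ha, haU, hna⟩
      · exact absurd h hV.2
      · refine ⟨g, hg, fun h => hng ?_, a, ha, haU, hna⟩
        simpa [MCSClass.SatInput.Sat] using h

theorem MCSClass.Input.length_heads_le (x : C.Input) :
    (encList (x.heads.map (C.mcs x.name).actCode)).length ≤ x.encode.length := by
  have h1 : (encList (x.heads.map (C.mcs x.name).actCode)).length ≤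
      (encList (x.ground.map (C.mcs x.name).groundCode)).length := by
    unfold MCSClass.Input.heads
    generalize x.ground = l
    induction l with
    | nil => simp
    | cons g l ih =>
        have h2 := length_le_encList (w := encList (g.head.map (C.mcs x.name).actCode))
          (l := [encList (g.pos.map (C.mcs x.name).litCode),
            encList (g.neg.map (C.mcs x.name).litCode),
            encList (g.head.map (C.mcs x.name).actCode)]) (by simp)
        simp only [List.flatMap_cons, List.map_append, encList_append, List.length_append,
          List.map_cons, encList, length_encWord] at ih h2 ⊢
        simp only [CodedMCS.groundCode, encList, length_encWord, List.length_append] at h2 ⊢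
        omega
  have h2 := length_le_encList (w := encList (x.ground.map (C.mcs x.name).groundCode))
    (l := [C.code x.name, encList (x.ground.map (C.mcs x.name).groundCode)]) (by simp)
  unfold MCSClass.Input.encode
  omega

/-- The coNP condition bounds its challenges in terms of the variant, whereas the challenge bound of
the whole problem may depend only on the input. The factor comes from the doubling of lengths by
`encWord`. -/
theorem MCSClass.Input.length_variant_le (x : C.Input) (y : Word) :
    (MCSClass.Variant.encode ⟨x.name, select x.heads y⟩).length ≤ 4 * x.encode.length + 2 := by
  have h1 := length_le_encList (w := C.code x.name)
    (l := [C.code x.name, encList (x.ground.map (C.mcs x.name).groundCode)]) (by simp)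
  have h2 : (encList ((select x.heads y).map (C.mcs x.name).actCode)).length ≤
      (encList (x.heads.map (C.mcs x.name).actCode)).length :=
    length_encList_sublist (List.filter_sublist.map _)
  have h3 := x.length_heads_le
  unfold MCSClass.Variant.encode
  simp only [encList, List.length_append, length_encWord, List.length_nil]
  unfold MCSClass.Input.encode at h3 ⊢
  omega

/-- The ground AIC with code `b` is satisfied after the updates selected by `x.2.1` and the tail
of `x.2.2`. -/
def SatChallenge (m : Mode) (x : C.Input × Word × Word) (b : Word) : Prop :=
  ∃ g, (C.mcs x.1.name).groundCode g = b ∧ MCSClass.SatInput.Sat m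
    ⟨⟨x.1.name, select (select x.1.heads x.2.1) x.2.2.tail⟩, [g]⟩

theorem membership (m : Mode) (A : Set Word)
    (hsat : InP A MCSClass.SatInput.encode fun v : C.SatInput => v.Sat m)
    (hcons : InCoNP A MCSClass.Variant.encode fun v : C.Variant => v.Consistent) :
    InSigma2 A MCSClass.Input.encode fun x : C.Input => x.HasRepair m := by
  classical
  have hS := hsat.computes
  obtain ⟨p, T, q, hp⟩ := hcons
  -- Challenges that are too long for the variant are truncated, so the longer challenges allowed
  -- for the whole problem do no harm.
  let cons : C.Variant → Word → Prop := fun v z =>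
    Accepts A p [v.encode, z.take (q.eval v.encode.length)]
  have hN : Computes A (fun _ => True) [fun x : C.Variant × Word => x.1.encode, Prod.snd]
      fun x => truth (Accepts A p [x.1.encode, x.2]) :=
    Computes.accepts (E := [fun x : C.Variant × Word => x.1.encode, Prod.snd]) p T
      fun x _ => by simpa using (hp x.1).1 x.2
  -- `X + 1` leaves room for a coded set of head actions with its tag bit, and the composite with
  -- `q` for a challenge to the consistency of the selected variant.
  refine InSigma2.of_computes
    (Polynomial.X + 1 + q.comp (Polynomial.C 4 * Polynomial.X + Polynomial.C 2))
    (fun x => x.1.Check m cons x.2.1 x.2.2) ?_ ?_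
  swap
  · intro x
    refine x.hasRepair_iff m cons _ (fun y => ?_) ?_
    · refine (hp _).2.trans ?_
      simp only [Polynomial.eval_add, Polynomial.eval_comp, Polynomial.eval_mul,
        Polynomial.eval_C, Polynomial.eval_X, Polynomial.eval_one, cons]
      constructor
      · intro h z _
        exact h _ (by simp)
      · intro h z hz
        have h1 := eval_mono q (x.length_variant_le y)
        have := h z (by omega)
        rwa [List.take_of_length_le hz] at this
    · have := x.length_heads_le
      simp only [Polynomial.eval_add, Polynomial.eval_X, Polynomial.eval_one]
      omega
  set E : List (C.Input × Word × Word → Word) :=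
    [fun x => x.1.encode, fun x => x.2.1, fun x => x.2.2] with hE
  have vx : Computes A (fun _ => True) E fun x => x.1.encode := Computes.var (by simp [E])
  have vy : Computes A (fun _ => True) E fun x => x.2.1 := Computes.var (by simp [E])
  have vz : Computes A (fun _ => True) E fun x => x.2.2 := Computes.var (by simp [E])
  have vc : Computes A (fun _ => True) E fun x => C.code x.1.name :=
    vx.hdW.congr fun x _ => hdW_encWord _ _
  have vg : Computes A (fun _ => True) E fun x =>
      encList (x.1.ground.map (C.mcs x.1.name).groundCode) :=
    vx.tlW.hdW.congr fun x _ => by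
      simp only [MCSClass.Input.encode, encList]
      rw [tlW_encWord]; exact hdW_encWord _ _
  have headCode : ∀ (x : C.Input) (g : GroundAIC (C.mcs x.name).toFrame),
      hdW (tlW (tlW ((C.mcs x.name).groundCode g))) =
        encList (g.head.map (C.mcs x.name).actCode) := by
    intro x g
    simp only [CodedMCS.groundCode, encList]
    rw [tlW_encWord, tlW_encWord]
    exact hdW_encWord _ _
  have vh : Computes A (fun _ => True) E fun x =>
      encList (x.1.heads.map (C.mcs x.1.name).actCode) := by
    refine (Computes.flatMap (F := fun _ b => hdW (tlW (tlW b))) vg ?_).congr fun x _ => ?_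
    · exact (Computes.var (by simp)).tlW.tlW.hdW
    · rw [parseList_encList, MCSClass.Input.heads, List.map_flatMap, encList_flatMap,
        List.flatMap_map]
      simp only [headCode]
  have vU : Computes A (fun _ => True) E fun x =>
      encList ((select x.1.heads x.2.1).map (C.mcs x.1.name).actCode) :=
    (vh.filter_parseList vy).congr fun x _ => by rw [map_select, parseList_encList]
  have vV : Computes A (fun _ => True) E fun x =>
      encList ((select (select x.1.heads x.2.1) x.2.2.tail).map (C.mcs x.1.name).actCode) :=
    (vU.filter_parseList vz.tail).congr fun x _ => by
      rw [map_select (select x.1.heads x.2.1), parseList_encList]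
  have vUe : Computes A (fun _ => True) E fun x =>
      MCSClass.Variant.encode ⟨x.1.name, select x.1.heads x.2.1⟩ :=
    vc.encList_cons (vU.encList_cons Computes.encList_nil)
  have vVe : Computes A (fun _ => True) E fun x =>
      MCSClass.Variant.encode ⟨x.1.name, select (select x.1.heads x.2.1) x.2.2.tail⟩ :=
    vc.encList_cons (vV.encList_cons Computes.encList_nil)
  refine Computes.case vz ?_ ?_ ?_
  · have h1 := Computes.subst (E := E) (G := [fun x => MCSClass.SatInput.encode
      ⟨⟨x.1.name, select x.1.heads x.2.1⟩, x.1.ground⟩])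
      ((Trans.reindex hS fun x : C.Input × Word × Word =>
        ⟨⟨x.1.name, select x.1.heads x.2.1⟩, x.1.ground⟩))
      (by
        simp only [List.mem_singleton, forall_eq]
        exact vUe.encList_cons (vg.encList_cons Computes.encList_nil))
    refine (h1.mono (by simp)).congr fun x hx => ?_
    simp only [Function.comp, MCSClass.Input.Check, hx.2, if_true]
  · have h1 := Computes.subst (E := E)
      (G := [fun x => MCSClass.Variant.encode ⟨x.1.name, select x.1.heads x.2.1⟩,
        fun x => x.2.2.tail.take (q.eval
          (MCSClass.Variant.encode ⟨x.1.name, select x.1.heads x.2.1⟩).length)])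
      ((Trans.reindex hN fun x : C.Input × Word × Word =>
        (⟨x.1.name, select x.1.heads x.2.1⟩, x.2.2.tail.take (q.eval
          (MCSClass.Variant.encode ⟨x.1.name, select x.1.heads x.2.1⟩).length))))
      (by
        have h2 := vz.tail.take (vUe.unary_eval q)
        simp only [length_unary] at h2
        simpa using ⟨vUe, h2⟩)
    refine (h1.mono (by simp)).congr fun x hx => ?_
    have h3 : x.2.2 ≠ [] := by intro h; simp [h] at hx
    simp only [Function.comp, MCSClass.Input.Check, hx.2, if_true, if_neg h3, cons]
  · have hS' : Computes A (fun p : (C.Input × Word × Word) × Word => True ∧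
        p.2 ∈ parseList (encList (p.1.1.ground.map (C.mcs p.1.1.name).groundCode)))
        (Prod.snd :: E.map (· ∘ Prod.fst)) fun p => truth (SatChallenge m p.1 p.2) := by
      -- Every word `b` in the sequence is the code of a ground AIC `g`, so the register built from
      -- `b` is the code of a satisfaction input with the singleton `[g]`. Injectivity of
      -- `groundCode` makes the answer depend on `b` alone.
      refine Computes.subst (G := [fun p => encList [MCSClass.Variant.encode
        ⟨p.1.1.name, select (select p.1.1.heads p.1.2.1) p.1.2.2.tail⟩, encList [p.2]]])
        (Computes.transfer hS ?_) ?_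
      · rintro ⟨x, b⟩ ⟨-, hb⟩
        simp only [parseList_encList, List.mem_map] at hb
        obtain ⟨g, hg, rfl⟩ := hb
        refine ⟨⟨⟨x.1.name, select (select x.1.heads x.2.1) x.2.2.tail⟩, [g]⟩, trivial, rfl,
          congrArg truth (propext ⟨fun h => ⟨g, rfl, h⟩, ?_⟩)⟩
        rintro ⟨g', e, h⟩
        rwa [CodedMCS.groundCode_injective _ e] at h
      · simp only [List.mem_singleton, forall_eq]
        exact (vVe.lift _ (fun _ _ => trivial) _).encList_cons
          (((Computes.var (by simp)).encList_cons Computes.encList_nil).encList_cons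
            Computes.encList_nil)
    have hsub := vU.subset_parseList vV
    have hsupp := vU.supported vV vg hS'
    refine ((hsub.or hsupp).mono (by simp)).congr fun x hx => congrArg truth (propext ?_)
    have h3 : x.2.2 ≠ [] := by intro h; simp [h] at hx
    have h4 : ¬ x.2.2.head? = some false := by rw [hx.2]; simp
    have inj := (C.mcs x.1.name).actCode_injective
    simp only [MCSClass.Input.Check, if_neg h3, if_neg h4, parseList_encList]
    refine or_congr ?_ ?_
    · simp only [List.mem_map]
      constructor
      · intro h a ha
        obtain ⟨b, hb, e⟩ := h _ ⟨a, ha, rfl⟩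
        rwa [inj e] at hb
      · rintro h _ ⟨a, ha, rfl⟩
        exact ⟨a, h a ha, rfl⟩
    · constructor
      · rintro ⟨_, hb, hns, c, hc, hcU, hcV⟩
        obtain ⟨g, hg, rfl⟩ := List.mem_map.1 hb
        rw [headCode, parseList_encList] at hc
        obtain ⟨a, ha, rfl⟩ := List.mem_map.1 hc
        rw [List.mem_map_of_injective inj] at hcU hcV
        exact ⟨g, hg, fun h => hns ⟨g, rfl, h⟩, a, ha, hcU, hcV⟩
      · rintro ⟨g, hg, hns, a, ha, haU, haV⟩
        refine ⟨_, List.mem_map_of_mem hg, ?_, (C.mcs x.1.name).actCode a, ?_, ?_, ?_⟩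
        · rintro ⟨g', e, h⟩
          rw [CodedMCS.groundCode_injective _ e] at h
          exact hns h
        · rw [headCode, parseList_encList]
          exact List.mem_map_of_mem ha
        · exact List.mem_map_of_mem haU
        · rwa [List.mem_map_of_injective inj]

end Repairs

/-! ## Grounded repairs of databases and minimal models -/

/-- Positive disjunctive rules: a body and a nonempty head. -/
structure PRule (β : Type*) where
  body : List β
  first : β
  rest : List β

/-- The atoms in the head. -/
def PRule.heads {β : Type*} (r : PRule β) : List β := r.first :: r.rest

/-- `X` is a model of the rule. -/
def PRule.Holds {β : Type*} (r : PRule β) (X : Set β) : Prop :=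
  (∀ a ∈ r.body, a ∈ X) → ∃ a ∈ r.heads, a ∈ X

/-- Minimal models. -/
def IsMinModel {β : Type*} (P : List (PRule β)) (X : Set β) : Prop :=
  (∀ r ∈ P, r.Holds X) ∧ ∀ Y ⊆ X, (∀ r ∈ P, r.Holds Y) → Y = X

/-- The ground instance of a ground AIC. -/
def DBAIC.ground (d : DBAIC) : GroundAIC dbFrame where
  pos := d.pos.map fun a => ⟨(0 : Fin 1), (true, a)⟩
  neg := d.neg.map fun a => ⟨(0 : Fin 1), (true, a)⟩
  head := d.head.map fun a => ⟨(0 : Fin 1), a⟩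

theorem DBAIC.inst_toAIC (d : DBAIC) (θ : ℕ → Word) : d.toAIC.inst θ = d.ground := by
  simp only [AIC.inst, DBAIC.toAIC, List.map_map, DBAIC.ground]
  rfl

theorem groundInstances_toAIC (l : List DBAIC) :
    groundInstances (l.map DBAIC.toAIC) = {g | g ∈ l.map DBAIC.ground} := by
  ext g
  constructor
  · rintro ⟨r, hr, θ, -, rfl⟩
    obtain ⟨d, hd, rfl⟩ := List.mem_map.1 hr
    exact List.mem_map.2 ⟨d, hd, (d.inst_toAIC θ).symm⟩
  · intro h
    obtain ⟨d, hd, rfl⟩ := List.mem_map.1 h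
    exact ⟨_, List.mem_map_of_mem hd, fun _ => [], fun v _ => ⟨(0 : Fin 1), Set.mem_univ _⟩,
      (d.inst_toAIC _).symm⟩

/-- The database `X` satisfies a ground AIC. -/
def DBAIC.Sat (d : DBAIC) (X : Set Atom) : Prop :=
  ¬ ((∀ a ∈ d.pos, a ∈ X) ∧ ∀ a ∈ d.neg, a ∉ X)

/-- The atoms that are added by a set of update actions. -/
def added (U : Set (Action dbFrame)) : Set Atom := {a | (⟨(0 : Fin 1), (true, a)⟩ : Action dbFrame) ∈ U}

/-- Nothing can be removed from the empty database, so the updated knowledge base is exactly the set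
of added atoms. -/
theorem isEquilibrium_empty_iff (U : Set (Action dbFrame)) (S : BeliefState dbFrame) :
    IsEquilibrium ((dbMCS []).toMCS.update U) S ↔
      ∀ i, (S i : Set (Bool × Atom)) = {l | l.1 = true ↔ l.2 ∈ added U} := by
  have h : ∀ i : Fin 1, applicableHeads (F := dbFrame) S i = ∅ := by
    intro i
    ext a
    simp [applicableHeads]
  unfold IsEquilibrium
  refine forall_congr' fun i => ?_
  obtain rfl : i = (0 : Fin 1) := Subsingleton.elim (α := Fin 1) _ _
  change (S _ : Set (Bool × Atom)) = {l | l.1 = true ↔ l.2 ∈ _} ↔ _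
  rw [show applicableHeads (F := dbFrame) S (0 : Fin 1) = ∅ from h 0]
  simp [added, actionsAt]

/-- There is exactly one equilibrium, so weak and strong satisfaction coincide. -/
theorem satisfies_empty_iff (m : Mode) (U : Set (Action dbFrame)) (l : List DBAIC) :
    Satisfies m ((dbMCS []).toMCS.update U) {g | g ∈ l.map DBAIC.ground} ↔
      ∀ d ∈ l, d.Sat (added U) := by
  let S₀ : BeliefState dbFrame := fun _ => ⟨{l | l.1 = true ↔ l.2 ∈ added U}, Set.mem_univ _⟩
  have h₀ : IsEquilibrium ((dbMCS []).toMCS.update U) S₀ :=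
    (isEquilibrium_empty_iff U S₀).2 fun _ => rfl
  have h₁ : ∀ S, IsEquilibrium ((dbMCS []).toMCS.update U) S → S = S₀ := fun S hS =>
    funext fun i => Subtype.ext ((isEquilibrium_empty_iff U S).1 hS i)
  have h₂ : (∀ g ∈ {g | g ∈ l.map DBAIC.ground}, SatBy S₀ g) ↔ ∀ d ∈ l, d.Sat (added U) := by
    have : ∀ d : DBAIC, SatBy S₀ d.ground ↔ d.Sat (added U) := by
      intro d
      have hm : ∀ a, Holds (F := dbFrame) S₀ ⟨(0 : Fin 1), (true, a)⟩ ↔ a ∈ added U := by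
        intro a
        simp [Holds, S₀]
      simp only [SatBy, DBAIC.ground, DBAIC.Sat, List.forall_mem_map, hm]
    simp [this]
  rw [← h₂]
  cases m with
  | weak =>
      constructor
      · rintro ⟨S, hS, h⟩
        rwa [h₁ S hS] at h
      · exact fun h => ⟨S₀, h₀, h⟩
  | strong =>
      constructor
      · exact fun h => h.2 S₀ h₀
      · exact fun h => ⟨⟨S₀, h₀⟩, fun S hS => by rwa [h₁ S hS]⟩

/-- Additions only form unions, which do not depend on the order. -/
theorem isConsistent_of_additions (U : Set (Action dbFrame))
    (hU : ∀ a : Atom, (⟨(0 : Fin 1), (false, a)⟩ : Action dbFrame) ∉ U) :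
    IsConsistent (dbMCS []).toMCS U := by
  intro i l _ hl
  obtain rfl : i = (0 : Fin 1) := Subsingleton.elim (α := Fin 1) _ _
  have hf : ∀ x ∈ l, x.1 = true := by
    rintro ⟨b, a⟩ hx
    have := (hl _).1 hx
    cases b
    · exact absurd this (hU a)
    · rfl
  have key : ∀ (l : List (Bool × Atom)) (K : (dbLogic).KB), (∀ x ∈ l, x.1 = true) →
      l.foldr (fun a K => dbFrame.mng (0 : Fin 1) {a} K) K =
        ⟨K.1 ∪ {a | (true, a) ∈ l}, Set.mem_univ _⟩ := by
    intro l K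
    induction l with
    | nil => intro _; ext; simp
    | cons x l ih =>
        intro h
        obtain ⟨b, a⟩ := x
        obtain rfl : b = true := h (b, a) (by simp)
        rw [List.foldr_cons, ih fun x hx => h x (by simp [hx])]
        ext c
        simp
        tauto
  refine Eq.trans ?_ (key l _ hf).symm
  have hl' : actionsAt U (0 : Fin 1) = {a | a ∈ l} := Set.ext fun a => (hl a).symm
  have hn : {a : Atom | (false, a) ∈ actionsAt U (0 : Fin 1)} = ∅ := by
    ext a
    simpa [actionsAt] using hU a
  apply Subtype.ext
  change (_ \ {a : Atom | (false, a) ∈ actionsAt U (0 : Fin 1)}) ∪ {a : Atom | (true, a) ∈ actionsAt U (0 : Fin 1)} = _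
  rw [hn, hl', Set.sdiff_empty]
  rfl

/-! ### From positive disjunctive rules to AICs over the empty database. -/

section Reduction

variable {β : Type*} (e : β → Atom)

/-- A positive rule as an AIC. -/
def PRule.toDB (r : PRule β) : DBAIC where
  pos := r.body.map e
  neg := r.heads.map e
  head := r.heads.map fun a => (true, e a)
  head_nonempty := by simp [PRule.heads]
  add_mem := by
    intro a h
    obtain ⟨b, hb, h⟩ := List.mem_map.1 h
    cases h
    exact List.mem_map_of_mem hb
  del_mem := by simp

/-- The AIC that requires one of the atoms `w` and `u`. -/
def requireDB (w u : β) : DBAIC where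
  pos := []
  neg := [e w, e u]
  head := [(true, e u)]
  head_nonempty := by simp
  add_mem := by simp
  del_mem := by simp

/-- The AIC that forbids the atom `u`. -/
def forbidDB (u : β) : DBAIC where
  pos := [e u]
  neg := []
  head := [(false, e u)]
  head_nonempty := by simp
  add_mem := by simp
  del_mem := by simp

/-- The AICs whose grounded repairs are the minimal models of `P` that contain `w`. -/
def dbRules (P : List (PRule β)) (w u : β) : List DBAIC :=
  requireDB e w u :: forbidDB e u :: P.map (PRule.toDB e)

theorem PRule.sat_toDB (r : PRule β) (X : Set Atom) :
    (r.toDB e).Sat X ↔ r.Holds (e ⁻¹' X) := by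
  simp [DBAIC.Sat, PRule.toDB, PRule.Holds]

/-- For a translated rule, being violated at `V` while holding after `U` means that some head atom
is added by `U` and not by `V`, which is support. Thus groundedness and minimality are two readings
of the same condition. The atom `u` is never derivable, so `requireDB` and `forbidDB` only filter
the models by `w`. -/
theorem hasGroundedRepair_iff (he : Function.Injective e) (m : Mode) (P : List (PRule β))
    (w u : β) (hu : ∀ r ∈ P, u ∉ r.heads) :
    HasGroundedRepair m (dbMCS []).toMCS ((dbRules e P w u).map DBAIC.toAIC) ↔
      ∃ X, IsMinModel P X ∧ w ∈ X := by
  unfold HasGroundedRepair IsWeakRepair IsGrounded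
  rw [groundInstances_toAIC]
  have hsingle : ∀ (U : Set (Action dbFrame)) (d : DBAIC),
      Satisfies m ((dbMCS []).toMCS.update U) {d.ground} ↔ d.Sat (added U) := by
    intro U d
    have := satisfies_empty_iff m U [d]
    simpa using this
  have hall : ∀ X : Set Atom, (∀ d ∈ dbRules e P w u, d.Sat X) ↔
      (∀ r ∈ P, r.Holds (e ⁻¹' X)) ∧ w ∈ e ⁻¹' X ∧ u ∉ e ⁻¹' X := by
    intro X
    simp only [dbRules, List.forall_mem_cons, List.forall_mem_map, PRule.sat_toDB]
    simp [DBAIC.Sat, requireDB, forbidDB]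
    tauto
  constructor
  · rintro ⟨U, ⟨hfin, -, hs⟩, hg⟩
    rw [satisfies_empty_iff, hall] at hs
    obtain ⟨hP, hw, hnu⟩ := hs
    refine ⟨e ⁻¹' added U, ⟨hP, fun Y hY hYP => ?_⟩, hw⟩
    by_contra hne
    obtain ⟨b, hb, hbY⟩ : ∃ b ∈ e ⁻¹' added U, b ∉ Y := by
      by_contra hn
      push Not at hn
      exact hne (hY.antisymm hn)
    -- A smaller model `Y` becomes a proper subset of `U` by dropping the additions of atoms outside
    -- `Y`; no rule can then support going beyond it.
    set V : Set (Action dbFrame) := U \ {a | ∃ b, b ∉ Y ∧ a = ⟨(0 : Fin 1), (true, e b)⟩} with hV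
    have hVY : e ⁻¹' added V = Y := by
      ext c
      constructor
      · rintro ⟨-, hc⟩
        by_contra hcY
        exact hc ⟨c, hcY, rfl⟩
      · intro hc
        refine ⟨hY hc, ?_⟩
        rintro ⟨b, hb, h⟩
        obtain rfl : c = b := he (by simpa using h)
        exact hb hc
    obtain ⟨r, hr, hnr, a, har, haU, haV⟩ := hg V ⟨Set.sdiff_subset, fun h => (h hb).2 ⟨b, hbY, rfl⟩⟩
    obtain ⟨d, hd, rfl⟩ := List.mem_map.1 hr
    rw [hsingle] at hnr
    simp only [dbRules, List.mem_cons, List.mem_map] at hd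
    -- `requireDB` offers only the addition of `u`, which is not in `U`; `forbidDB` is satisfied
    -- since `u ∉ Y`; the remaining rules hold in `Y`.
    rcases hd with rfl | rfl | ⟨r, hrP, rfl⟩
    · simp only [DBAIC.ground, requireDB, List.map_cons, List.map_nil, List.mem_singleton] at har
      subst har
      exact hnu haU
    · refine hnr fun h => hnu (hY ?_)
      rw [← hVY]
      exact h.1 _ (by simp [forbidDB])
    · rw [PRule.sat_toDB, hVY] at hnr
      exact hnr (hYP r hrP)
  · rintro ⟨X, ⟨hP, hmin⟩, hw⟩
    -- Discarding the atoms that occur in no head leaves a model, so a minimal model has none of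
    -- them. Hence it is finite and omits `u`.
    have hheads : X ⊆ {a | ∃ r ∈ P, a ∈ r.heads} := by
      have := hmin (X ∩ {a | ∃ r ∈ P, a ∈ r.heads}) Set.inter_subset_left ?_
      · rw [← this]; exact Set.inter_subset_right
      · intro r hr hb
        obtain ⟨a, ha, haX⟩ := hP r hr fun a ha => (hb a ha).1
        exact ⟨a, ha, haX, r, hr, ha⟩
    have hnu : u ∉ X := fun h => by
      obtain ⟨r, hr, h⟩ := hheads h
      exact hu r hr h
    have hXfin : X.Finite := by
      refine (List.finite_toSet (P.flatMap PRule.heads)).subset fun a ha => ?_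
      obtain ⟨r, hr, h⟩ := hheads ha
      exact List.mem_flatMap.2 ⟨r, hr, h⟩
    set act : β → Action dbFrame := fun b => ⟨(0 : Fin 1), (true, e b)⟩ with hact
    have hpre : e ⁻¹' added (act '' X) = X := by
      ext c
      constructor
      · rintro ⟨b, hb, h⟩
        obtain rfl : b = c := he (by simpa [act] using h)
        exact hb
      · exact fun hc => ⟨c, hc, rfl⟩
    refine ⟨act '' X, ⟨hXfin.image _, isConsistent_of_additions _ ?_, ?_⟩, ?_⟩
    · rintro a ⟨b, -, h⟩
      simp [act] at h
    · rw [satisfies_empty_iff, hall, hpre]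
      exact ⟨hP, hw, hnu⟩
    · intro V hV
      have hsub : e ⁻¹' added V ⊆ X := by
        intro b hb
        rw [← hpre]
        exact hV.1 hb
      have hne : e ⁻¹' added V ≠ X := by
        intro h
        refine hV.2 ?_
        rintro _ ⟨b, hb, rfl⟩
        rw [← h] at hb
        exact hb
      obtain ⟨r, hr, hnr⟩ : ∃ r ∈ P, ¬ r.Holds (e ⁻¹' added V) := by
        by_contra hn
        push Not at hn
        exact hne (hmin _ hsub hn)
      have hnr' := hnr
      unfold PRule.Holds at hnr
      push Not at hnr
      obtain ⟨a, ha, haX⟩ := hP r hr fun a ha => hsub (hnr.1 a ha)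
      refine ⟨(r.toDB e).ground, List.mem_map_of_mem ?_, ?_, act a, ?_, ⟨a, haX, rfl⟩, hnr.2 a ha⟩
      · simp only [dbRules, List.mem_cons]
        exact Or.inr (Or.inr (List.mem_map_of_mem hr))
      · rw [hsingle, PRule.sat_toDB]
        exact hnr'
      · simp only [DBAIC.ground, PRule.toDB, List.map_map]
        exact List.mem_map.2 ⟨a, ha, rfl⟩

end Reduction

/-! ## Guessing and saturation -/

/-- The set `Z` is closed under the Horn rules in `H`. -/
def HClosed {β : Type*} (H : List (List β × β)) (Z : Set β) : Prop :=
  ∀ r ∈ H, (∀ a ∈ r.1, a ∈ Z) → r.2 ∈ Z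

/-- The rule that requires a choice among `c none`, `c false` and `c true`. -/
def choiceRule {β : Type*} (c : Option Bool → β) : PRule β :=
  ⟨[], c none, [c (some false), c (some true)]⟩

theorem choiceRule_holds {β : Type*} (c : Option Bool → β) (X : Set β) :
    (choiceRule c).Holds X ↔ ∃ o, c o ∈ X := by
  simp only [choiceRule, PRule.Holds, PRule.heads]
  constructor
  · intro h
    obtain ⟨a, ha, hX⟩ := h (by simp)
    simp only [List.mem_cons, List.not_mem_nil, or_false] at ha
    rcases ha with rfl | rfl | rfl
    · exact ⟨_, hX⟩
    · exact ⟨_, hX⟩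
    · exact ⟨_, hX⟩
  · rintro ⟨_ | _ | _, h⟩ - <;> exact ⟨_, by simp, h⟩

/-- A minimal model with `w` is saturated in the choices for `z`, so each `g` is present in it. If
some `g` did not force `w`, a closed set witnessing this would cut out a smaller model. Conversely,
the least closed set with `w` and the choices `f` is minimal, because every model inside it makes
the choices `f` and some choices `g`, hence contains `w`. -/
theorem exists_minModel_iff {β : Type*} (P : List (PRule β)) (H : List (List β × β)) (q : ℕ)
    (cy cz : ℕ → Option Bool → β) (w : β)
    (hP : ∀ X : Set β, (∀ r ∈ P, r.Holds X) ↔ HClosed H X ∧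
      (∀ i < q, ∃ o, cy i o ∈ X) ∧ ∀ i < q, ∃ o, cz i o ∈ X)
    (hcy : ∀ i j o o', cy i o = cy j o' → i = j ∧ o = o') (hw : ∀ i o, cy i o ≠ w)
    (hH : ∀ r ∈ H, ∀ i o, r.2 ≠ cy i o) (hsat : ∀ i < q, ∀ o, ([w], cz i o) ∈ H) :
    (∃ X, IsMinModel P X ∧ w ∈ X) ↔ ∃ f : ℕ → Option Bool, ∀ g : ℕ → Option Bool, ∀ Z : Set β,
      HClosed H Z → (∀ i < q, cy i (f i) ∈ Z) → (∀ i < q, cz i (g i) ∈ Z) → w ∈ Z := by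
  unfold IsMinModel
  simp only [hP]
  constructor
  · rintro ⟨X, ⟨⟨hX, hXy, -⟩, hmin⟩, hwX⟩
    choose! f hf using hXy
    refine ⟨f, fun g Z hZ hZy hZz => ?_⟩
    have hXz : ∀ i < q, ∀ o, cz i o ∈ X := fun i hi o => hX _ (hsat i hi o) (by simpa using hwX)
    -- Horn closure is stable under intersection, and saturation of `X` guarantees that the choices
    -- `g` of `Z` survive.
    have := hmin (Z ∩ X) Set.inter_subset_right ⟨fun r hr hb =>
      ⟨hZ r hr fun a ha => (hb a ha).1, hX r hr fun a ha => (hb a ha).2⟩,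
      fun i hi => ⟨f i, hZy i hi, hf i hi⟩, fun i hi => ⟨g i, hZz i hi, hXz i hi _⟩⟩
    rw [← this] at hwX
    exact hwX.1
  · rintro ⟨f, hf⟩
    set X : Set β := {a | ∀ Z : Set β, HClosed H Z → (∀ i < q, cy i (f i) ∈ Z) → w ∈ Z → a ∈ Z}
      with hXdef
    have hwX : w ∈ X := fun Z _ _ h => h
    have hXH : HClosed H X := fun r hr hb Z hZ hZy hZw =>
      hZ r hr fun a ha => hb a ha Z hZ hZy hZw
    refine ⟨X, ⟨⟨hXH, fun i hi => ⟨f i, fun Z _ hZy _ => hZy i hi⟩,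
      fun i hi => ⟨none, hXH _ (hsat i hi none) (by simpa using hwX)⟩⟩, ?_⟩, hwX⟩
    rintro Y hYX ⟨hY, hYy, hYz⟩
    have hyf : ∀ i < q, cy i (f i) ∈ Y := by
      intro i hi
      obtain ⟨o, ho⟩ := hYy i hi
      by_cases h : o = f i
      · rwa [h] at ho
      · exfalso
        -- No Horn rule has a choice for `y` as its head, so all atoms except this one form a closed
        -- set. Therefore `X` contains no choice for `y` other than those of `f`.
        refine hYX ho {a | a ≠ cy i o} (fun r hr _ => hH r hr i o) ?_ (hw i o).symm rfl
        intro j _ hj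
        obtain ⟨rfl, h'⟩ := hcy _ _ _ _ hj
        exact h h'.symm
    choose! g hg using hYz
    have hwY := hf g Y hY hyf hg
    exact hYX.antisymm fun a ha => ha Y hY hyf hwY

/-! ## Small-step execution without an oracle -/

/-- The effect of a step on one stack. -/
inductive StackAct : Type
  | keep : StackAct
  | push (b : Bool) : StackAct
  | pop : StackAct

/-- The new contents of the stack. -/
def StackAct.apply : StackAct → Word → Word
  | keep, w => w
  | push b, w => b :: w
  | pop, w => w.tail

/-- The stack that the first step of a program tests, and the programs that remain if this stack
is empty, has top `false`, or has top `true`. -/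
def Prog.control (k : List Prog) : Prog → ℕ × List Prog × List Prog × List Prog
  | seq p₁ p₂ => (0, p₁ :: p₂ :: k, p₁ :: p₂ :: k, p₁ :: p₂ :: k)
  | case r p₀ p₁ p₂ => (r, p₀ :: k, p₁ :: k, p₂ :: k)
  | loop r p => (r, k, p :: loop r p :: k, p :: loop r p :: k)
  | _ => (0, k, k, k)

/-- The effect of the first step of a program on the stacks. -/
def Prog.act : Prog → ℕ → StackAct
  | push r b, i => if i = r then .push b else .keep
  | pop r, i => if i = r then .pop else .keep
  -- The empty oracle always answers `false`.
  | query _ r, i => if i = r then .push false else .keep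
  | _, _ => .keep

/-- Selection according to the tested stack. -/
def branch (c : ℕ × List Prog × List Prog × List Prog) : Word → List Prog
  | [] => c.2.1
  | false :: _ => c.2.2.1
  | true :: _ => c.2.2.2

/-- One step, for a list of programs to be executed one after the other. -/
def smallStep : List Prog × Stacks → List Prog × Stacks
  | ([], s) => ([], s)
  | (p :: k, s) => (branch (p.control k) (s (p.control k).1), fun r => (p.act r).apply (s r))

theorem branch_same (r : ℕ) (k : List Prog) (w : Word) : branch (r, k, k, k) w = k := by
  rcases w with _ | ⟨_ | _, w⟩ <;> rfl

/-- Unfolding a `seq` is a small step that costs no time in `Exec`. The slack of one in `n + 1 ≤ 2 *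
t` pays for it in the induction. -/
theorem exists_iterate_smallStep {p : Prog} {s s' : Stacks} {t : ℕ} (h : Exec ∅ p s s' t) :
    ∀ k, ∃ n, n + 1 ≤ 2 * t ∧ smallStep^[n] (p :: k, s) = (k, s') := by
  induction h with
  | skip s => exact fun k => ⟨1, by simp, by simp [smallStep, Prog.control, branch_same, Prog.act, StackAct.apply]⟩
  | push r b s | pop r s | query q r s =>
      refine fun k => ⟨1, by simp, ?_⟩
      simp only [Function.iterate_one, smallStep, Prog.control, branch_same, Prod.mk.injEq, true_and]
      funext i
      by_cases hi : i = r
      · subst hi; simp [Prog.act, StackAct.apply, answer]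
      · simp [Prog.act, StackAct.apply, hi]
  | seq _ _ ih₁ ih₂ =>
      rename_i p₁ p₂ _ _ _ _ _ _ _
      intro k
      obtain ⟨n₁, h₁, e₁⟩ := ih₁ (p₂ :: k)
      obtain ⟨n₂, h₂, e₂⟩ := ih₂ k
      refine ⟨n₂ + (n₁ + 1), by omega, ?_⟩
      rw [Function.iterate_add_apply, Function.iterate_succ_apply]
      simp only [smallStep, Prog.control, branch_same, Prog.act, StackAct.apply]
      rw [e₁, e₂]
  | caseEmpty hr _ ih | caseFalse hr _ ih | caseTrue hr _ ih =>
      rename_i r p₀ p₁ p₂ s _ _ _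
      intro k
      obtain ⟨n, h, e⟩ := ih k
      refine ⟨n + 1, by omega, ?_⟩
      rw [Function.iterate_succ_apply]
      simp only [smallStep, Prog.control, Prog.act, StackAct.apply]
      rcases hs : s r with _ | ⟨_ | _, w⟩ <;> simp_all [branch]
  | loopDone hr =>
      intro k
      exact ⟨1, by simp, by simp [smallStep, Prog.control, branch, Prog.act, StackAct.apply, hr]⟩
  | loopStep hr _ _ ih₁ ih₂ =>
      rename_i r p s₁ _ _ _ _ _ _
      intro k
      obtain ⟨n₁, h₁, e₁⟩ := ih₁ (.loop r p :: k)
      obtain ⟨n₂, h₂, e₂⟩ := ih₂ k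
      refine ⟨n₂ + (n₁ + 1), by omega, ?_⟩
      rw [Function.iterate_add_apply, Function.iterate_succ_apply]
      simp only [smallStep, Prog.control, Prog.act, StackAct.apply]
      have : branch (r, k, p :: .loop r p :: k, p :: .loop r p :: k) (s₁ r) = p :: .loop r p :: k := by
        rcases hs : s₁ r with _ | ⟨_ | _, w⟩
        · exact absurd hs hr
        · rfl
        · rfl
      rw [this, e₁, e₂]

theorem iterate_smallStep_nil (s : Stacks) (n : ℕ) : smallStep^[n] ([], s) = ([], s) := by
  induction n with
  | zero => rfl
  | succ n ih => rw [Function.iterate_succ_apply]; exact ih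

/-- The lists of programs that can remain during the execution of `p`, before `k` remains. -/
def Prog.remainders : Prog → List Prog → List (List Prog)
  | skip, k => [skip :: k]
  | push r b, k => [push r b :: k]
  | pop r, k => [pop r :: k]
  | query q r, k => [query q r :: k]
  | seq p₁ p₂, k => (seq p₁ p₂ :: k) :: (p₁.remainders (p₂ :: k) ++ p₂.remainders k)
  | case r p₀ p₁ p₂, k =>
      (case r p₀ p₁ p₂ :: k) :: (p₀.remainders k ++ (p₁.remainders k ++ p₂.remainders k))
  | loop r p, k => (loop r p :: k) :: p.remainders (loop r p :: k)

theorem Prog.self_mem_remainders (p : Prog) (k : List Prog) : p :: k ∈ p.remainders k := by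
  cases p <;> simp [Prog.remainders]

/-- The continuations of a fixed program form a finite set closed under steps; they play the role of
the states of a Turing machine and can be numbered. -/
theorem branch_mem_remainders (p : Prog) : ∀ (k : List Prog) (q : Prog) (l : List Prog) (w : Word),
    q :: l ∈ p.remainders k → branch (q.control l) w ∈ k :: p.remainders k := by
  have hb : ∀ (r : ℕ) (k₀ k₁ k₂ : List Prog) (w : Word) (S : List (List Prog)),
      k₀ ∈ S → k₁ ∈ S → k₂ ∈ S → branch (r, k₀, k₁, k₂) w ∈ S := by
    intro r k₀ k₁ k₂ w S h₀ h₁ h₂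
    rcases w with _ | ⟨_ | _, w⟩ <;> assumption
  induction p with
  | skip | push r b | pop r | query q r =>
      intro k q l w h
      simp only [Prog.remainders, List.mem_singleton, List.cons.injEq] at h
      obtain ⟨rfl, rfl⟩ := h
      simp [Prog.control, branch_same]
  | seq p₁ p₂ ih₁ ih₂ =>
      intro k q l w h
      have h₁ := p₁.self_mem_remainders (p₂ :: k)
      have h₂ := p₂.self_mem_remainders k
      simp only [Prog.remainders, List.mem_cons, List.cons.injEq, List.mem_append] at h ⊢
      rcases h with ⟨rfl, rfl⟩ | h | h
      · simp [Prog.control, branch_same, h₁]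
      · have := ih₁ _ _ _ w h
        simp only [List.mem_cons] at this
        rcases this with h | h
        · rw [h]; simp [h₂]
        · simp [h]
      · have := ih₂ _ _ _ w h
        simp only [List.mem_cons] at this
        rcases this with h | h
        · simp [h]
        · simp [h]
  | case r p₀ p₁ p₂ ih₀ ih₁ ih₂ =>
      intro k q l w h
      have h₀ := p₀.self_mem_remainders k
      have h₁ := p₁.self_mem_remainders k
      have h₂ := p₂.self_mem_remainders k
      simp only [Prog.remainders, List.mem_cons, List.cons.injEq, List.mem_append] at h
      rcases h with ⟨rfl, rfl⟩ | h | h | h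
      · refine hb _ _ _ _ _ _ ?_ ?_ ?_ <;> simp [Prog.remainders, h₀, h₁, h₂]
      · have := ih₀ _ _ _ w h
        simp only [List.mem_cons, Prog.remainders, List.mem_append] at this ⊢
        tauto
      · have := ih₁ _ _ _ w h
        simp only [List.mem_cons, Prog.remainders, List.mem_append] at this ⊢
        tauto
      · have := ih₂ _ _ _ w h
        simp only [List.mem_cons, Prog.remainders, List.mem_append] at this ⊢
        tauto
  | loop r p ih =>
      intro k q l w h
      have h₀ := p.self_mem_remainders (.loop r p :: k)
      simp only [Prog.remainders, List.mem_cons, List.cons.injEq] at h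
      rcases h with ⟨rfl, rfl⟩ | h
      · refine hb _ _ _ _ _ _ ?_ ?_ ?_ <;> simp [Prog.remainders, h₀]
      · have := ih _ _ _ w h
        simp only [List.mem_cons, Prog.remainders] at this ⊢
        tauto

/-! ## Rules that describe a computation -/

/-- Terms: a constant plus a sum of variables. -/
abbrev Term : Type := ℕ × List (Fin 3)

/-- The value of a term. -/
def Term.eval (v : Fin 3 → ℕ) (t : Term) : ℕ := t.1 + (t.2.map v).sum

/-- A constant. -/
def Term.num (n : ℕ) : Term := (n, [])

/-- A variable. -/
def Term.var (i : Fin 3) : Term := (0, [i])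

/-- The successor of a variable. -/
def Term.suc (i : Fin 3) : Term := (1, [i])

@[simp] theorem Term.eval_num (v : Fin 3 → ℕ) (n : ℕ) : (Term.num n).eval v = n := by
  simp [Term.eval, Term.num]

@[simp] theorem Term.eval_var (v : Fin 3 → ℕ) (i : Fin 3) : (Term.var i).eval v = v i := by
  simp [Term.eval, Term.var]

@[simp] theorem Term.eval_suc (v : Fin 3 → ℕ) (i : Fin 3) : (Term.suc i).eval v = v i + 1 := by
  simp [Term.eval, Term.suc, add_comm]

/-- Rules with variables. -/
abbrev Schema : Type := List (List Term) × List Term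

/-- An instance of an atom. -/
def evalAtom (v : Fin 3 → ℕ) (a : List Term) : List ℕ := a.map (Term.eval v)

/-- An instance of a rule. -/
def Schema.eval (v : Fin 3 → ℕ) (r : Schema) : List (List ℕ) × List ℕ :=
  (r.1.map (evalAtom v), evalAtom v r.2)

open Term

/-- After `t` steps, the list of remaining programs has number `k`. -/
def aState (t : Term) (k : ℕ) : List Term := [num 0, t, num k]
/-- After `t` steps, stack `r` has height `h`. -/
def aHeight (t : Term) (r : ℕ) (h : Term) : List Term := [num 1, t, num r, h]
/-- After `t` steps, stack `r` contains `b` at position `i`, counted from the bottom. -/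
def aBit (t : Term) (r : ℕ) (i : Term) (b : Bool) : List Term := [num 2, t, num r, i, num b.toNat]

/-- The code of a choice. -/
def optCode : Option Bool → ℕ
  | none => 2
  | some b => b.toNat

theorem optCode_injective : Function.Injective optCode := by
  rintro (_ | _ | _) (_ | _ | _) h <;> simp_all [optCode]

/-- The choice with number `i` for the contents of stack `r` is `o`. -/
def aChoice (r : ℕ) (i : Term) (o : Option Bool) : List Term := [num 3, num r, i, num (optCode o)]
/-- The first `i` choices for stack `r` give a stack of height `h`. -/
def aLoad (r : ℕ) (i h : Term) : List Term := [num 4, num r, i, h]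
/-- There are `i` choices for stack `r`. -/
def aEnd (r : ℕ) (i : Term) : List Term := [num 5, num r, i]
/-- The computation accepts. -/
def aWin : List Term := [num 6]

/-- Rules for the initial contents of an input stack. -/
def loadSchemas (r : ℕ) : List Schema :=
  ([], aLoad r (num 0) (num 0)) ::
  ([aLoad r (var 0) (var 1), aChoice r (var 0) none], aLoad r (suc 0) (var 1)) ::
  ([aEnd r (var 0), aLoad r (var 0) (var 1)], aHeight (num 0) r (var 1)) ::
  [false, true].flatMap fun b =>
    [([aLoad r (var 0) (var 1), aChoice r (var 0) (some b)], aLoad r (suc 0) (suc 1)),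
     ([aLoad r (var 0) (var 1), aChoice r (var 0) (some b)], aBit (num 0) r (var 1) b)]

/-- Rules for the effect of a step on the stack `r`, if the remaining programs have number `k`. -/
def actSchemas (k r : ℕ) : StackAct → List Schema
  | .keep => ([aState (var 0) k, aHeight (var 0) r (var 1)], aHeight (suc 0) r (var 1)) ::
      [false, true].map fun b =>
        ([aState (var 0) k, aBit (var 0) r (var 1) b], aBit (suc 0) r (var 1) b)
  | .push c => ([aState (var 0) k, aHeight (var 0) r (var 1)], aHeight (suc 0) r (suc 1)) ::
      ([aState (var 0) k, aHeight (var 0) r (var 1)], aBit (suc 0) r (var 1) c) ::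
      [false, true].map fun b =>
        ([aState (var 0) k, aBit (var 0) r (var 1) b], aBit (suc 0) r (var 1) b)
  | .pop => ([aState (var 0) k, aHeight (var 0) r (num 0)], aHeight (suc 0) r (num 0)) ::
      ([aState (var 0) k, aHeight (var 0) r (suc 1)], aHeight (suc 0) r (var 1)) ::
      [false, true].map fun b =>
        -- A height of the form `2 + i + j` says that position `i` lies strictly below the top, so
        -- its bit survives the pop.
        ([aState (var 0) k, aHeight (var 0) r (2, [1, 2]), aBit (var 0) r (var 1) b],
          aBit (suc 0) r (var 1) b)

/-- Rules for the next list of remaining programs, numbered by `idx`. -/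
def controlSchemas (idx : List Prog → ℕ) (k : ℕ) (c : ℕ × List Prog × List Prog × List Prog) :
    List Schema :=
  [([aState (var 0) k, aHeight (var 0) c.1 (num 0)], aState (suc 0) (idx c.2.1)),
   ([aState (var 0) k, aHeight (var 0) c.1 (suc 1), aBit (var 0) c.1 (var 1) false],
     aState (suc 0) (idx c.2.2.1)),
   ([aState (var 0) k, aHeight (var 0) c.1 (suc 1), aBit (var 0) c.1 (var 1) true],
     aState (suc 0) (idx c.2.2.2))]

/-- Rules for one step. -/
def stepSchemas (idx : List Prog → ℕ) (K : ℕ) : List Prog → List Schema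
  | [] => []
  | p :: k => controlSchemas idx (idx (p :: k)) (p.control k) ++
      (List.range K).flatMap fun r => actSchemas (idx (p :: k)) r (p.act r)

/-- All lists of programs that can remain. -/
def Prog.states (p : Prog) : List (List Prog) := [] :: p.remainders []

/-- The rules with variables that describe the computation of `p` on the first `K` stacks. -/
def computationSchemas (idx : List Prog → ℕ) (K : ℕ) (p : Prog) : List Schema :=
  [0, 1, 2].flatMap loadSchemas ++
  (List.range' 3 (K - 3)).map (fun r => ([], aHeight (num 0) r (num 0))) ++
  [([], aState (num 0) (idx [p])),
   ([aState (var 0) (idx []), aHeight (var 0) 0 (num 1), aBit (var 0) 0 (num 0) true], aWin)] ++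
  -- Saturation: acceptance makes every choice for stack `2`, the universally quantified word, true.
  [none, some false, some true].map (fun o => ([aWin], aChoice 2 (var 0) o)) ++
  p.states.flatMap (stepSchemas idx K)

/-! ### Soundness: the true atoms of a computation obey the rules. -/

section Computation

variable (idx : List Prog → ℕ) (K : ℕ) (p : Prog) (F : ℕ → ℕ → Option Bool) (len : ℕ → ℕ)

/-- The word on the stack `r` that results from the first `n` choices. -/
def loaded (r n : ℕ) : Word := ((List.range n).filterMap (F r)).reverse

/-- The configuration after `t` steps. -/
def config (t : ℕ) : List Prog × Stacks :=
  smallStep^[t] ([p], fun r => if r < 3 then loaded F r (len r) else [])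

/-- The program reaches an accepting configuration. -/
def Reaches : Prop := ∃ t, (config p F len t).1 = [] ∧ (config p F len t).2 0 = [true]

/-- The atoms that are true for the computation of `p`. -/
def TrueAtom : List ℕ → Prop
  | [0, t, k] => k = idx (config p F len t).1
  | [1, t, r, h] => h = ((config p F len t).2 r).length
  | [2, t, r, i, b] => ((config p F len t).2 r).reverse[i]? = some (b == 1)
  | [3, r, i, o] => i < len r ∧ o = optCode (F r i)
  | [4, r, i, h] => h = (loaded F r i).length
  | [5, r, n] => n = len r
  | [6] => Reaches p F len
  | _ => False

variable {idx K p F len}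

theorem config_succ {t : ℕ} {q : Prog} {k : List Prog} (h : (config p F len t).1 = q :: k) :
    config p F len (t + 1) = (branch (q.control k) ((config p F len t).2 (q.control k).1),
      fun r => (q.act r).apply ((config p F len t).2 r)) := by
  have e : config p F len (t + 1) = smallStep (config p F len t) :=
    Function.iterate_succ_apply' _ _ _
  rw [e]
  conv_lhs => rw [← Prod.mk.eta (p := config p F len t), h]
  rfl

theorem config_mem (t : ℕ) : (config p F len t).1 ∈ p.states := by
  induction t with
  | zero => exact List.mem_cons_of_mem _ (p.self_mem_remainders [])
  | succ t ih =>
      rcases h : (config p F len t).1 with _ | ⟨q, k⟩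
      · have e : config p F len (t + 1) = smallStep (config p F len t) :=
          Function.iterate_succ_apply' _ _ _
        rw [e, ← Prod.mk.eta (p := config p F len t), h]
        exact List.mem_cons_self
      · rw [config_succ h]
        refine branch_mem_remainders p [] q k _ ?_
        rw [h] at ih
        simpa [Prog.states] using ih

theorem loaded_succ (r n : ℕ) : loaded F r (n + 1) = (F r n).toList ++ loaded F r n := by
  unfold loaded
  rw [List.range_succ, List.filterMap_append]
  rcases h : F r n with _ | b <;> simp [h]

theorem getElem?_loaded {r n i : ℕ} {b : Bool} (hi : i < n) (hb : F r i = some b) :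
    (loaded F r n).reverse[(loaded F r i).length]? = some b := by
  induction n with
  | zero => omega
  | succ n ih =>
      rw [loaded_succ, List.reverse_append]
      rcases Nat.lt_succ_iff_lt_or_eq.1 hi with h | rfl
      · have := ih h
        rw [List.getElem?_append_left (List.getElem?_eq_some_iff.1 this).1]
        exact this
      · rw [hb, ← List.length_reverse]
        simp

theorem toNat_beq (b : Bool) : (b.toNat == 1) = b := by cases b <;> rfl

theorem actSchemas_sound (hidx : Set.InjOn idx {k | k ∈ p.states}) {q : Prog} {k : List Prog}
    (hk : q :: k ∈ p.states) (r : ℕ) {s : Schema} (hs : s ∈ actSchemas (idx (q :: k)) r (q.act r))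
    (v : Fin 3 → ℕ) (hb : ∀ a ∈ s.1, TrueAtom idx p F len (evalAtom v a)) :
    TrueAtom idx p F len (evalAtom v s.2) := by
  have hcfg : aState (var 0) (idx (q :: k)) ∈ s.1 → (config p F len (v 0 + 1)).2 r =
      (q.act r).apply ((config p F len (v 0)).2 r) := by
    intro h
    have h1 := hb _ h
    simp only [evalAtom, aState, List.map_cons, List.map_nil, eval_num, eval_var, TrueAtom] at h1
    rw [config_succ (hidx (config_mem _) hk h1.symm)]
  generalize q.act r = A at hs hcfg
  cases A with
  | keep =>
      simp only [actSchemas, List.map_cons, List.map_nil, List.mem_cons, List.not_mem_nil,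
        or_false] at hs
      rcases hs with rfl | rfl | rfl <;>
      · have h1 := hcfg (by simp)
        simp only [List.forall_mem_cons] at hb
        have h2 := hb.2.1
        simp only [evalAtom, aHeight, aBit, List.map_cons, List.map_nil, eval_num, eval_var,
          eval_suc, TrueAtom] at h2 ⊢
        rw [h1]
        exact h2
  | push c =>
      simp only [actSchemas, List.map_cons, List.map_nil, List.mem_cons, List.not_mem_nil,
        or_false] at hs
      rcases hs with rfl | rfl | rfl | rfl <;>
      · have h1 := hcfg (by simp)
        simp only [List.forall_mem_cons] at hb
        have h2 := hb.2.1
        simp only [evalAtom, aHeight, aBit, List.map_cons, List.map_nil, eval_num, eval_var,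
          eval_suc, TrueAtom, toNat_beq] at h2 ⊢
        rw [h1]
        simp only [StackAct.apply, List.reverse_cons, List.length_cons]
        first
        | exact congrArg (· + 1) h2
        | (rw [h2, ← List.length_reverse, List.getElem?_concat_length])
        | (rw [List.getElem?_append_left]
           · exact h2
           · exact (List.getElem?_eq_some_iff.1 h2).1)
  | pop =>
      simp only [actSchemas, List.map_cons, List.map_nil, List.mem_cons, List.not_mem_nil,
        or_false] at hs
      rcases hs with rfl | rfl | rfl | rfl
      · have h1 := hcfg (by simp)
        simp only [List.forall_mem_cons] at hb
        have h2 := hb.2.1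
        simp only [evalAtom, aHeight, List.map_cons, List.map_nil, eval_num, eval_var,
          eval_suc, TrueAtom] at h2 ⊢
        rw [h1]
        simp [StackAct.apply, ← h2]
      · have h1 := hcfg (by simp)
        simp only [List.forall_mem_cons] at hb
        have h2 := hb.2.1
        simp only [evalAtom, aHeight, List.map_cons, List.map_nil, eval_num, eval_var,
          eval_suc, TrueAtom] at h2 ⊢
        rw [h1]
        simp [StackAct.apply, ← h2]
      all_goals
        have h1 := hcfg (by simp)
        simp only [List.forall_mem_cons] at hb
        have h2 := hb.2.1
        have h3 := hb.2.2.1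
        simp only [evalAtom, aHeight, aBit, List.map_cons, List.map_nil, eval_num, eval_var,
          eval_suc, TrueAtom] at h2 h3 ⊢
        rw [h1]
        simp only [StackAct.apply]
        rcases hw : (config p F len (v 0)).2 r with _ | ⟨c, w⟩
        · rw [hw] at h3; simp at h3
        · rw [hw] at h2 h3
          rw [List.reverse_cons, List.getElem?_append_left] at h3
          · exact h3
          · simp only [Term.eval, List.map_cons, List.map_nil, List.sum_cons, List.sum_nil,
              List.length_cons] at h2
            simp; omega

/-- If the computation does not accept, the saturation rules have a false body, and all other rules
describe correct steps. The true atoms then form a closed set without `[6]`. Injectivity of `idx`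
recovers the remaining programs from their number. -/
theorem computationSchemas_sound (hidx : Set.InjOn idx {k | k ∈ p.states})
    (hr : ¬ Reaches p F len) {s : Schema} (hs : s ∈ computationSchemas idx K p) (v : Fin 3 → ℕ)
    (hb : ∀ a ∈ s.1, TrueAtom idx p F len (evalAtom v a)) :
    TrueAtom idx p F len (evalAtom v s.2) := by
  simp only [computationSchemas, List.mem_append, or_assoc] at hs
  rcases hs with hs | hs | hs | hs | hs
  · obtain ⟨r, hr3, hs⟩ := List.mem_flatMap.1 hs
    have hr3 : r < 3 := by
      simp only [List.mem_cons, List.not_mem_nil, or_false] at hr3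
      omega
    simp only [loadSchemas, List.flatMap_cons, List.flatMap_nil, List.append_nil, List.mem_cons,
      List.mem_append, List.not_mem_nil, or_false, or_assoc] at hs
    rcases hs with rfl | rfl | rfl | rfl | rfl | rfl | rfl <;>
    · simp only [List.forall_mem_cons] at hb
      simp only [evalAtom, aHeight, aBit, aLoad, aChoice, aEnd, List.map_cons, List.map_nil,
        eval_num, eval_var, eval_suc, TrueAtom] at hb ⊢
      first
      | rfl
      | (obtain ⟨h1, h2, -⟩ := hb
         first
         | (have h3 := optCode_injective h2.2
            rw [loaded_succ, ← h3, h1]; simp)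
         | (rw [h2, h1]; simp [config, hr3])
         | (have h3 := optCode_injective h2.2
            simp only [config, Function.iterate_zero, id_eq, if_pos hr3, toNat_beq]
            rw [h1]
            exact getElem?_loaded h2.1 h3.symm))
  · obtain ⟨r, hr3, rfl⟩ := List.mem_map.1 hs
    rw [List.mem_range'_1] at hr3
    simp [evalAtom, aHeight, TrueAtom, config, Nat.not_lt.2 hr3.1]
  · simp only [List.mem_cons, List.not_mem_nil, or_false] at hs
    rcases hs with rfl | rfl
    · rfl
    · simp only [List.forall_mem_cons] at hb
      simp only [evalAtom, aState, aHeight, aBit, aWin, List.map_cons, List.map_nil,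
        eval_num, eval_var, TrueAtom] at hb ⊢
      obtain ⟨h1, h2, h3, -⟩ := hb
      refine ⟨v 0, (hidx (config_mem _) List.mem_cons_self h1.symm), ?_⟩
      obtain ⟨b, hb⟩ := List.length_eq_one_iff.1 h2.symm
      rw [hb] at h3 ⊢
      simpa using h3
  · obtain ⟨o, -, rfl⟩ := List.mem_map.1 hs
    exact absurd (hb aWin (by simp)) hr
  · obtain ⟨k, hk, hs⟩ := List.mem_flatMap.1 hs
    rcases k with _ | ⟨q, k⟩
    · simp [stepSchemas] at hs
    · simp only [stepSchemas, List.mem_append, List.mem_flatMap] at hs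
      rcases hs with hs | ⟨r, -, hs⟩
      · simp only [controlSchemas, List.mem_cons, List.not_mem_nil, or_false] at hs
        have hcfg : aState (var 0) (idx (q :: k)) ∈ s.1 → (config p F len (v 0 + 1)).1 =
            branch (q.control k) ((config p F len (v 0)).2 (q.control k).1) := by
          intro h
          have h1 := hb _ h
          simp only [evalAtom, aState, List.map_cons, List.map_nil, eval_num, eval_var,
            TrueAtom] at h1
          rw [config_succ (hidx (config_mem _) hk h1.symm)]
        rcases hs with rfl | rfl | rfl
        · have h1 := hcfg (by simp)
          simp only [List.forall_mem_cons] at hb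
          simp only [evalAtom, aState, aHeight, List.map_cons, List.map_nil, eval_num,
            eval_var, eval_suc, TrueAtom] at hb ⊢
          rw [h1, List.length_eq_zero_iff.1 hb.2.1.symm]
          rfl
        all_goals
          have h1 := hcfg (by simp)
          simp only [List.forall_mem_cons] at hb
          simp only [evalAtom, aState, aHeight, aBit, List.map_cons, List.map_nil, eval_num,
            eval_var, eval_suc, TrueAtom, toNat_beq] at hb ⊢
          obtain ⟨-, h2, h3, -⟩ := hb
          rcases hw : (config p F len (v 0)).2 (q.control k).1 with _ | ⟨c, w⟩
          · rw [hw] at h3; simp at h3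
          · rw [hw] at h1 h2 h3
            have h4 : v 1 = w.reverse.length := by simpa using h2
            rw [List.reverse_cons, List.getElem?_append_right h4.ge, h4] at h3
            simp only [Nat.sub_self, List.getElem?_cons_zero, Option.some.injEq] at h3
            subst h3
            rw [h1]
            rfl
      · exact actSchemas_sound hidx hk r hs v hb

end Computation

/-! ### Completeness: a closed set contains the atoms of the computation. -/

section Completeness

variable {idx : List Prog → ℕ} {K : ℕ} {p : Prog} {F : ℕ → ℕ → Option Bool} {len : ℕ → ℕ}

theorem mem_computationSchemas_load {r : ℕ} (hr : r < 3) {s : Schema} (hs : s ∈ loadSchemas r) :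
    s ∈ computationSchemas idx K p := by
  simp only [computationSchemas, List.mem_append]
  refine Or.inl (Or.inl (Or.inl (Or.inl (List.mem_flatMap.2 ⟨r, ?_, hs⟩))))
  interval_cases r <;> simp

theorem mem_computationSchemas_step {k : List Prog} (hk : k ∈ p.states) {s : Schema}
    (hs : s ∈ stepSchemas idx K k) : s ∈ computationSchemas idx K p := by
  simp only [computationSchemas, List.mem_append]
  exact Or.inr (List.mem_flatMap.2 ⟨k, hk, hs⟩)

theorem config_add_of_nil {t : ℕ} (h : (config p F len t).1 = []) (n : ℕ) :
    config p F len (t + n) = config p F len t := by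
  have e : config p F len (t + n) = smallStep^[n] (config p F len t) := by
    rw [add_comm]
    exact Function.iterate_add_apply _ _ _ _
  rw [e, ← Prod.mk.eta (p := config p F len t), h, iterate_smallStep_nil]

theorem length_config_le (t r : ℕ) :
    ((config p F len t).2 r).length ≤ ((config p F len 0).2 r).length + t := by
  induction t with
  | zero => simp
  | succ t ih =>
      rcases h : (config p F len t).1 with _ | ⟨q, k⟩
      · rw [config_add_of_nil h 1]; omega
      · rw [config_succ h]
        have : ∀ (A : StackAct) (w : Word), (A.apply w).length ≤ w.length + 1 := by
          rintro (_ | b | _) w <;> simp [StackAct.apply]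
          omega
        have := this (q.act r) ((config p F len t).2 r)
        dsimp only
        omega

theorem length_loaded_le (r n : ℕ) : (loaded F r n).length ≤ n := by
  unfold loaded
  rw [List.length_reverse]
  exact (List.length_filterMap_le _ _).trans (by simp)

theorem length_config_zero_le (r : ℕ) :
    ((config p F len 0).2 r).length ≤ if r < 3 then len r else 0 := by
  simp only [config, Function.iterate_zero, id_eq]
  split_ifs
  · exact length_loaded_le _ _
  · simp

/-- The atoms of `Z` describe the stack `r` with the contents `w` after `t` steps. -/
def Describes (Z : Set (List ℕ)) (t r : ℕ) (w : Word) : Prop :=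
  [1, t, r, w.length] ∈ Z ∧ ∀ i b, w.reverse[i]? = some b → [2, t, r, i, b.toNat] ∈ Z

variable {Z : Set (List ℕ)} {B N : ℕ}

/-- The load rules read the choices one at a time and carry the current height along. A choice
`none` leaves the stack as it is, which permits words shorter than the number of choices. -/
theorem describes_loaded
    (hZ : ∀ s ∈ computationSchemas idx K p, ∀ v : Fin 3 → ℕ, (∀ i, v i < B) →
      (∀ a ∈ s.1, evalAtom v a ∈ Z) → evalAtom v s.2 ∈ Z) {r : ℕ} (hr : r < 3)
    (hend : [5, r, len r] ∈ Z) (hF : ∀ i < len r, [3, r, i, optCode (F r i)] ∈ Z)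
    (hB : len r < B) : Describes Z 0 r (loaded F r (len r)) := by
  have hZ' : ∀ s ∈ loadSchemas r, ∀ x y : ℕ, x < B → y < B →
      (∀ a ∈ s.1, evalAtom ![x, y, 0] a ∈ Z) → evalAtom ![x, y, 0] s.2 ∈ Z := by
    intro s hs x y hx hy
    refine hZ s (mem_computationSchemas_load hr hs) _ fun i => ?_
    fin_cases i
    · exact hx
    · exact hy
    · exact (Nat.zero_le _).trans_lt hB
  have key : ∀ n, n ≤ len r → [4, r, n, (loaded F r n).length] ∈ Z ∧
      ∀ i b, (loaded F r n).reverse[i]? = some b → [2, 0, r, i, b.toNat] ∈ Z := by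
    intro n
    induction n with
    | zero =>
        intro _
        have := hZ' _ (List.mem_cons_self ..) 0 0 (by omega) (by omega) (by simp)
        exact ⟨by simpa [evalAtom, aLoad, loaded] using this, by simp [loaded]⟩
    | succ n ih =>
        intro hn
        obtain ⟨h1, h2⟩ := ih (by omega)
        have hl := length_loaded_le (F := F) r n
        have h3 := hF n (by omega)
        rw [loaded_succ]
        rcases hc : F r n with _ | b
        · rw [hc] at h3
          have := hZ' ([aLoad r (var 0) (var 1), aChoice r (var 0) none], aLoad r (suc 0) (var 1))
            (by simp [loadSchemas]) n (loaded F r n).length (by omega) (by omega)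
            (by simpa [evalAtom, aLoad, aChoice] using ⟨h1, h3⟩)
          exact ⟨by simpa [evalAtom, aLoad] using this, by simpa using h2⟩
        · rw [hc] at h3
          have e1 := hZ' ([aLoad r (var 0) (var 1), aChoice r (var 0) (some b)],
            aLoad r (suc 0) (suc 1)) (by cases b <;> simp [loadSchemas]) n (loaded F r n).length
            (by omega) (by omega) (by simpa [evalAtom, aLoad, aChoice] using ⟨h1, h3⟩)
          have e2 := hZ' ([aLoad r (var 0) (var 1), aChoice r (var 0) (some b)],
            aBit (num 0) r (var 1) b) (by cases b <;> simp [loadSchemas]) n (loaded F r n).length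
            (by omega) (by omega) (by simpa [evalAtom, aLoad, aChoice] using ⟨h1, h3⟩)
          refine ⟨by simpa [evalAtom, aLoad] using e1, fun i c hi => ?_⟩
          simp only [Option.toList_some, List.singleton_append, List.reverse_cons] at hi
          rcases lt_or_ge i (loaded F r n).reverse.length with h | h
          · rw [List.getElem?_append_left h] at hi
            exact h2 i c hi
          · rw [List.getElem?_append_right h] at hi
            obtain ⟨h4, h5⟩ := List.getElem?_eq_some_iff.1 hi
            have h6 : i = (loaded F r n).length := by simp at h4 h; omega
            simp only [List.getElem_singleton] at h5
            subst h5 h6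
            simpa [evalAtom, aBit] using e2
  obtain ⟨h1, h2⟩ := key _ le_rfl
  have hl := length_loaded_le (F := F) r (len r)
  have := hZ' ([aEnd r (var 0), aLoad r (var 0) (var 1)], aHeight (num 0) r (var 1))
    (by simp [loadSchemas]) (len r) (loaded F r (len r)).length hB (by omega)
    (by simpa [evalAtom, aLoad, aEnd] using ⟨hend, h1⟩)
  exact ⟨by simpa [evalAtom, aHeight] using this, h2⟩

theorem describes_apply {k t r : ℕ} {A : StackAct} {w : Word}
    (hZ : ∀ s ∈ actSchemas k r A, ∀ x y z : ℕ, x < B → y < B → z < B →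
      (∀ a ∈ s.1, evalAtom ![x, y, z] a ∈ Z) → evalAtom ![x, y, z] s.2 ∈ Z)
    (hk : [0, t, k] ∈ Z) (hw : Describes Z t r w) (ht : t < B) (hB : w.length < B) :
    Describes Z (t + 1) r (A.apply w) := by
  obtain ⟨h1, h2⟩ := hw
  cases A with
  | keep =>
      change Describes Z (t + 1) r w
      constructor
      · have := hZ ([aState (var 0) k, aHeight (var 0) r (var 1)], aHeight (suc 0) r (var 1))
          (by simp [actSchemas]) t w.length 0 ht hB (by omega)
          (by simpa [evalAtom, aState, aHeight] using ⟨hk, h1⟩)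
        simpa [evalAtom, aHeight] using this
      · intro i b hi
        have hi' : i < w.length := by simpa using (List.getElem?_eq_some_iff.1 hi).1
        have := hZ ([aState (var 0) k, aBit (var 0) r (var 1) b], aBit (suc 0) r (var 1) b)
          (by cases b <;> simp [actSchemas]) t i 0 ht (by omega) (by omega)
          (by simpa [evalAtom, aState, aBit] using ⟨hk, h2 i b hi⟩)
        simpa [evalAtom, aBit] using this
  | push c =>
      constructor
      · have := hZ ([aState (var 0) k, aHeight (var 0) r (var 1)], aHeight (suc 0) r (suc 1))
          (by simp [actSchemas]) t w.length 0 ht hB (by omega)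
          (by simpa [evalAtom, aState, aHeight] using ⟨hk, h1⟩)
        simpa [evalAtom, aHeight, StackAct.apply] using this
      · intro i b hi
        simp only [StackAct.apply, List.reverse_cons] at hi
        rcases lt_or_ge i w.reverse.length with h | h
        · rw [List.getElem?_append_left h] at hi
          have hi' : i < w.length := by simpa using h
          have := hZ ([aState (var 0) k, aBit (var 0) r (var 1) b], aBit (suc 0) r (var 1) b)
            (by cases b <;> simp [actSchemas]) t i 0 ht (by omega) (by omega)
            (by simpa [evalAtom, aState, aBit] using ⟨hk, h2 i b hi⟩)
          simpa [evalAtom, aBit] using this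
        · rw [List.getElem?_append_right h] at hi
          obtain ⟨h4, h5⟩ := List.getElem?_eq_some_iff.1 hi
          have h6 : i = w.length := by simp at h4 h; omega
          simp only [List.getElem_singleton] at h5
          subst h5 h6
          have := hZ ([aState (var 0) k, aHeight (var 0) r (var 1)], aBit (suc 0) r (var 1) c)
            (by simp [actSchemas]) t w.length 0 ht hB (by omega)
            (by simpa [evalAtom, aState, aHeight] using ⟨hk, h1⟩)
          simpa [evalAtom, aBit] using this
  | pop =>
      rcases w with _ | ⟨c, w⟩
      · refine ⟨?_, by simp [StackAct.apply]⟩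
        have := hZ ([aState (var 0) k, aHeight (var 0) r (num 0)], aHeight (suc 0) r (num 0))
          (by simp [actSchemas]) t 0 0 ht hB (by omega)
          (by simpa [evalAtom, aState, aHeight] using ⟨hk, h1⟩)
        simpa [evalAtom, aHeight, StackAct.apply] using this
      · simp only [List.length_cons] at hB h1
        constructor
        · have := hZ ([aState (var 0) k, aHeight (var 0) r (suc 1)], aHeight (suc 0) r (var 1))
            (by simp [actSchemas]) t w.length 0 ht (by omega) (by omega)
            (by simpa [evalAtom, aState, aHeight] using ⟨hk, h1⟩)
          simpa [evalAtom, aHeight, StackAct.apply] using this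
        · intro i b hi
          simp only [StackAct.apply, List.tail_cons] at hi
          have h := (List.getElem?_eq_some_iff.1 hi).1
          have h3 := h2 i b (by rw [List.reverse_cons, List.getElem?_append_left h]; exact hi)
          rw [List.length_reverse] at h
          -- The third variable takes the value that makes `2 + i + j` equal to the height before
          -- the pop.
          have e : 2 + (i + (w.length - 1 - i)) = w.length + 1 := by omega
          have := hZ ([aState (var 0) k, aHeight (var 0) r (2, [1, 2]), aBit (var 0) r (var 1) b],
            aBit (suc 0) r (var 1) b) (by cases b <;> simp [actSchemas]) t i (w.length - 1 - i) ht
            (by omega) (by omega)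
            (by simpa [evalAtom, aState, aHeight, aBit, Term.eval, Term.num, Term.var, e] using
              ⟨hk, h1, h3⟩)
          simpa [evalAtom, aBit] using this

/-- Induction on time: the atoms of each configuration up to halting are derived by the step rules.
A stack grows by at most one bit per step, so all numbers involved stay below `B`. -/
theorem win_mem
    (hZ : ∀ s ∈ computationSchemas idx K p, ∀ v : Fin 3 → ℕ, (∀ i, v i < B) →
      (∀ a ∈ s.1, evalAtom v a ∈ Z) → evalAtom v s.2 ∈ Z) (hK : 3 ≤ K)
    (hreg : ∀ q k, q :: k ∈ p.states → (q.control k).1 < K)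
    (hend : ∀ r < 3, [5, r, len r] ∈ Z)
    (hF : ∀ r < 3, ∀ i < len r, [3, r, i, optCode (F r i)] ∈ Z)
    (hB : ∀ r < 3, len r + N < B) {t : ℕ} (ht : t ≤ N)
    (h₁ : (config p F len t).1 = []) (h₂ : (config p F len t).2 0 = [true]) : [6] ∈ Z := by
  have hZ' : ∀ s ∈ computationSchemas idx K p, ∀ x y z : ℕ, x < B → y < B → z < B →
      (∀ a ∈ s.1, evalAtom ![x, y, z] a ∈ Z) → evalAtom ![x, y, z] s.2 ∈ Z := by
    intro s hs x y z hx hy hz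
    refine hZ s hs _ fun i => ?_
    fin_cases i
    · exact hx
    · exact hy
    · exact hz
  have hB0 := hB 0 (by omega)
  have hlen : ∀ r, ((config p F len 0).2 r).length + N < B := by
    intro r
    have := length_config_zero_le (p := p) (F := F) (len := len) r
    split_ifs at this with h
    · have := hB r h; omega
    · omega
  have inv : ∀ t, t ≤ N → (∀ u < t, (config p F len u).1 ≠ []) → [0, t, idx (config p F len t).1] ∈ Z ∧
      ∀ r < K, Describes Z t r ((config p F len t).2 r) := by
    intro t
    induction t with
    | zero =>
        intro _ _
        constructor
        · have := hZ' ([], aState (num 0) (idx [p])) (by simp [computationSchemas]) 0 0 0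
            (by omega) (by omega) (by omega) (by simp)
          simpa [evalAtom, aState, config] using this
        · intro r hr
          simp only [config, Function.iterate_zero, id_eq]
          split_ifs with h
          · exact describes_loaded hZ h (hend r h) (hF r h) (by have := hB r h; omega)
          · have := hZ' ([], aHeight (num 0) r (num 0)) (by
              simp only [computationSchemas, List.mem_append, List.mem_map, List.mem_range'_1]
              exact Or.inl (Or.inl (Or.inl (Or.inr ⟨r, by omega, rfl⟩)))) 0 0 0
              (by omega) (by omega) (by omega) (by simp)
            exact ⟨by simpa [evalAtom, aHeight] using this, by simp⟩
    | succ t ih =>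
        intro htN hne
        obtain ⟨h1, h2⟩ := ih (by omega) fun u hu => hne u (by omega)
        rcases h : (config p F len t).1 with _ | ⟨q, k⟩
        · exact absurd h (hne t (by omega))
        · have hmem : q :: k ∈ p.states := h ▸ config_mem t
          have hl : ∀ r, ((config p F len t).2 r).length < B := fun r => by
            have := length_config_le (p := p) (F := F) (len := len) t r
            have := hlen r
            omega
          rw [h] at h1
          rw [config_succ h]
          constructor
          · have hs : ∀ s ∈ controlSchemas idx (idx (q :: k)) (q.control k),
                s ∈ computationSchemas idx K p := fun s hs =>
              mem_computationSchemas_step hmem (by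
                simp only [stepSchemas, List.mem_append]; exact Or.inl hs)
            obtain ⟨h3, h4⟩ := h2 _ (hreg q k hmem)
            have hlr := hl (q.control k).1
            rcases hw : (config p F len t).2 (q.control k).1 with _ | ⟨b, w⟩
            · rw [hw] at h3
              have := hZ' _ (hs _ (List.mem_cons_self ..)) t 0 0 (by omega) (by omega) (by omega)
                (by simpa [evalAtom, aState, aHeight] using ⟨h1, h3⟩)
              simpa [evalAtom, aState, branch] using this
            · rw [hw] at h3 h4 hlr
              simp only [List.length_cons] at h3 hlr
              have h5 := h4 w.length b (by
                rw [List.reverse_cons, ← List.length_reverse, List.getElem?_concat_length])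
              cases b
              · have := hZ' _ (hs _ (List.mem_cons_of_mem _ (List.mem_cons_self ..))) t w.length 0
                  (by omega) (by omega) (by omega)
                  (by simpa [evalAtom, aState, aHeight, aBit] using ⟨h1, h3, h5⟩)
                simpa [evalAtom, aState, branch] using this
              · have := hZ' _ (hs _ (List.mem_cons_of_mem _ (List.mem_cons_of_mem _
                  (List.mem_cons_self ..)))) t w.length 0 (by omega) (by omega) (by omega)
                  (by simpa [evalAtom, aState, aHeight, aBit] using ⟨h1, h3, h5⟩)
                simpa [evalAtom, aState, branch] using this
          · intro r hr
            refine describes_apply (fun s hs => hZ' s (mem_computationSchemas_step hmem ?_)) h1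
              (h2 r hr) (by omega) (hl r)
            simp only [stepSchemas, List.mem_append, List.mem_flatMap, List.mem_range]
            exact Or.inr ⟨r, hr, hs⟩
  -- The empty list of programs has no step rules, so the first halting time is used; the
  -- configuration is constant from then on.
  obtain ⟨t, ht, h₁, h₂, hne⟩ : ∃ t ≤ N, (config p F len t).1 = [] ∧
      (config p F len t).2 0 = [true] ∧ ∀ u < t, (config p F len u).1 ≠ [] := by
    classical
    have hex : ∃ t, (config p F len t).1 = [] := ⟨t, h₁⟩
    have hle := Nat.find_min' hex h₁
    refine ⟨Nat.find hex, hle.trans ht, Nat.find_spec hex, ?_, fun u hu => Nat.find_min hex hu⟩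
    have := config_add_of_nil (Nat.find_spec hex) (t - Nat.find hex)
    rw [Nat.add_sub_cancel' hle] at this
    rw [← this, h₂]
  obtain ⟨h3, h4⟩ := inv t ht hne
  obtain ⟨h5, h6⟩ := h4 0 (by omega)
  rw [h₁] at h3
  rw [h₂] at h5 h6
  have := hZ' ([aState (var 0) (idx []), aHeight (var 0) 0 (num 1), aBit (var 0) 0 (num 0) true],
    aWin) (by simp [computationSchemas]) t 0 0 (by omega) (by omega) (by omega)
    (by simpa [evalAtom, aState, aHeight, aBit] using ⟨h3, h5, h6 0 true rfl⟩)
  simpa [evalAtom, aWin] using this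

end Completeness

/-! ### Words given by sequences of choices. -/

theorem range_filterMap_getElem? (l : Word) :
    (List.range l.length).filterMap (fun i => l[i]?) = l := by
  induction l using List.reverseRecOn with
  | nil => rfl
  | append_singleton l a ih =>
      rw [List.length_append, List.length_singleton, List.range_succ, List.filterMap_append]
      have : (List.range l.length).filterMap (fun i => (l ++ [a])[i]?) =
          (List.range l.length).filterMap (fun i => l[i]?) :=
        List.filterMap_congr fun i hi => List.getElem?_append_left (List.mem_range.1 hi)
      rw [this, ih]
      simp

/-- The word that is given by `q` choices. -/
def decode (q : ℕ) (f : ℕ → Option Bool) : Word := ((List.range q).filterMap f).reverse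

theorem length_decode_le (q : ℕ) (f : ℕ → Option Bool) : (decode q f).length ≤ q := by
  unfold decode
  rw [List.length_reverse]
  exact (List.length_filterMap_le _ _).trans (by simp)

/-- Choices come from the bottom of the stack upwards, which explains the reversal; beyond the end
of the word they are `none`. -/
theorem exists_decode {q : ℕ} {w : Word} (h : w.length ≤ q) : ∃ f, decode q f = w := by
  refine ⟨fun i => w.reverse[i]?, ?_⟩
  unfold decode
  obtain ⟨k, rfl⟩ := Nat.exists_eq_add_of_le h
  have h1 := range_filterMap_getElem? w.reverse
  rw [List.length_reverse] at h1
  rw [List.range_add, List.filterMap_append, h1, List.filterMap_map]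
  have : (List.range k).filterMap ((fun i => w.reverse[i]?) ∘ (w.length + ·)) = [] := by
    rw [List.filterMap_eq_nil_iff]
    intro i _
    simp
  rw [this, List.append_nil, List.reverse_reverse]

/-- The numbers below `n`. -/
def below (n : ℕ) : List ℕ := (List.range n).reverse

@[simp] theorem mem_below {n i : ℕ} : i ∈ below n ↔ i < n := by simp [below]

/-! ### The ground rules for an input word. -/

section Rules

variable (S : List Schema) (x : Word) (q B : ℕ)

/-- The facts about the numbers of choices. -/
def endFacts : List (List (List ℕ) × List ℕ) :=
  [([], [5, 0, x.length]), ([], [5, 1, q]), ([], [5, 2, q])]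

/-- The fact about the first bit of a suffix of the input. -/
def inputFact (s : Word) : List (List ℕ) × List ℕ :=
  ([], [3, 0, s.tail.length, s.headI.toNat])

/-- All instances of the schemas. -/
def instances : List (List (List ℕ) × List ℕ) :=
  (below B).flatMap fun a => (below B).flatMap fun b => (below B).flatMap fun c =>
    S.map (Schema.eval ![a, b, c])

/-- The Horn rules for the input `x`. -/
def hornRules : List (List (List ℕ) × List ℕ) :=
  endFacts x q ++ (suffixes x).map inputFact ++ instances S B

/-- A Horn rule as a positive rule. -/
def ofHorn (r : List (List ℕ) × List ℕ) : PRule (List ℕ) := ⟨r.1, r.2, []⟩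

/-- The atom for a choice. -/
def choiceAtom (r i : ℕ) (o : Option Bool) : List ℕ := [3, r, i, optCode o]

/-- All rules for the input `x`. -/
def allRules : List (PRule (List ℕ)) :=
  (hornRules S x q B).map ofHorn ++
    (below q).flatMap fun i => [choiceRule (choiceAtom 1 i), choiceRule (choiceAtom 2 i)]

variable {S x q B}

theorem mem_instances {r : List (List ℕ) × List ℕ} : r ∈ instances S B ↔
    ∃ s ∈ S, ∃ v : Fin 3 → ℕ, (∀ i, v i < B) ∧ r = s.eval v := by
  simp only [instances, List.mem_flatMap, mem_below, List.mem_map]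
  constructor
  · rintro ⟨a, ha, b, hb, c, hc, s, hs, rfl⟩
    refine ⟨s, hs, _, fun i => ?_, rfl⟩
    fin_cases i
    · exact ha
    · exact hb
    · exact hc
  · rintro ⟨s, hs, v, hv, rfl⟩
    refine ⟨v 0, hv 0, v 1, hv 1, v 2, hv 2, s, hs, ?_⟩
    congr 1
    funext i
    fin_cases i <;> rfl

theorem mem_suffixes : ∀ {w s : Word}, s ∈ suffixes w ↔ s ≠ [] ∧ s <:+ w
  | [], s => by
      simp only [suffixes, List.not_mem_nil, List.suffix_nil, false_iff]
      tauto
  | b :: w, s => by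
      rw [suffixes, List.mem_cons, mem_suffixes, List.suffix_cons_iff]
      constructor
      · rintro (rfl | h)
        · simp
        · exact ⟨h.1, Or.inr h.2⟩
      · rintro ⟨h, rfl | h'⟩
        · exact Or.inl rfl
        · exact Or.inr ⟨h, h'⟩

theorem allRules_hold (X : Set (List ℕ)) : (∀ r ∈ allRules S x q B, r.Holds X) ↔
    HClosed (hornRules S x q B) X ∧ (∀ i < q, ∃ o, choiceAtom 1 i o ∈ X) ∧
      ∀ i < q, ∃ o, choiceAtom 2 i o ∈ X := by
  have h1 : ∀ r, (ofHorn r).Holds X ↔ ((∀ a ∈ r.1, a ∈ X) → r.2 ∈ X) := by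
    intro r
    simp [ofHorn, PRule.Holds, PRule.heads]
  simp only [allRules, List.forall_mem_append, List.forall_mem_map, h1, List.mem_flatMap,
    mem_below, HClosed]
  refine and_congr_right fun _ => ?_
  constructor
  · intro h
    exact ⟨fun i hi => (choiceRule_holds _ _).1 (h _ ⟨i, hi, by simp⟩),
      fun i hi => (choiceRule_holds _ _).1 (h _ ⟨i, hi, by simp⟩)⟩
  · rintro ⟨h2, h3⟩ r ⟨i, hi, hr⟩
    simp only [List.mem_cons, List.not_mem_nil, or_false] at hr
    rcases hr with rfl | rfl
    · exact (choiceRule_holds _ _).2 (h2 i hi)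
    · exact (choiceRule_holds _ _).2 (h3 i hi)

end Rules

/-- No schema derives a choice for stack `1`, the existential word, which the saturation argument
needs; and none derives `[7]`, which serves as the forbidden atom `u`. -/
theorem computationSchemas_head {idx : List Prog → ℕ} {K : ℕ} {p : Prog} {s : Schema}
    (hs : s ∈ computationSchemas idx K p) (v : Fin 3 → ℕ) :
    (evalAtom v s.2).take 2 ≠ [3, 1] ∧ evalAtom v s.2 ≠ [7] := by
  have h₀ : ∀ t k, (evalAtom v (aState t k)).take 2 ≠ [3, 1] ∧ evalAtom v (aState t k) ≠ [7] := by
    intro t k; simp [evalAtom, aState]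
  have h₁ : ∀ t r h, (evalAtom v (aHeight t r h)).take 2 ≠ [3, 1] ∧
      evalAtom v (aHeight t r h) ≠ [7] := by
    intro t r h; simp [evalAtom, aHeight]
  have h₂ : ∀ t r i b, (evalAtom v (aBit t r i b)).take 2 ≠ [3, 1] ∧
      evalAtom v (aBit t r i b) ≠ [7] := by
    intro t r i b; simp [evalAtom, aBit]
  have h₃ : ∀ i o, (evalAtom v (aChoice 2 i o)).take 2 ≠ [3, 1] ∧
      evalAtom v (aChoice 2 i o) ≠ [7] := by
    intro i o; simp [evalAtom, aChoice]
  have h₄ : ∀ r i h, (evalAtom v (aLoad r i h)).take 2 ≠ [3, 1] ∧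
      evalAtom v (aLoad r i h) ≠ [7] := by
    intro r i h; simp [evalAtom, aLoad]
  have h₆ : (evalAtom v aWin).take 2 ≠ [3, 1] ∧ evalAtom v aWin ≠ [7] := by
    simp [evalAtom, aWin]
  simp only [computationSchemas, List.mem_append, or_assoc] at hs
  rcases hs with hs | hs | hs | hs | hs
  · obtain ⟨r, -, hs⟩ := List.mem_flatMap.1 hs
    simp only [loadSchemas, List.flatMap_cons, List.flatMap_nil, List.append_nil, List.mem_cons,
      List.mem_append, List.not_mem_nil, or_false, or_assoc] at hs
    rcases hs with rfl | rfl | rfl | rfl | rfl | rfl | rfl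
    · exact h₄ _ _ _
    · exact h₄ _ _ _
    · exact h₁ _ _ _
    · exact h₄ _ _ _
    · exact h₂ _ _ _ _
    · exact h₄ _ _ _
    · exact h₂ _ _ _ _
  · obtain ⟨r, -, rfl⟩ := List.mem_map.1 hs
    exact h₁ _ _ _
  · simp only [List.mem_cons, List.not_mem_nil, or_false] at hs
    rcases hs with rfl | rfl
    · exact h₀ _ _
    · exact h₆
  · obtain ⟨o, -, rfl⟩ := List.mem_map.1 hs
    exact h₃ _ _
  · obtain ⟨k, hk, hs⟩ := List.mem_flatMap.1 hs
    rcases k with _ | ⟨q, k⟩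
    · simp [stepSchemas] at hs
    · simp only [stepSchemas, List.mem_append, List.mem_flatMap] at hs
      rcases hs with hs | ⟨r, -, hs⟩
      · simp only [controlSchemas, List.mem_cons, List.not_mem_nil, or_false] at hs
        rcases hs with rfl | rfl | rfl <;> exact h₀ _ _
      · generalize q.act r = c at hs
        rcases c with _ | c | _ <;>
          simp only [actSchemas, List.map_cons, List.map_nil, List.mem_cons, List.not_mem_nil,
            or_false] at hs
        · rcases hs with rfl | rfl | rfl
          · exact h₁ _ _ _
          · exact h₂ _ _ _ _
          · exact h₂ _ _ _ _
        · rcases hs with rfl | rfl | rfl | rfl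
          · exact h₁ _ _ _
          · exact h₂ _ _ _ _
          · exact h₂ _ _ _ _
          · exact h₂ _ _ _ _
        · rcases hs with rfl | rfl | rfl | rfl
          · exact h₁ _ _ _
          · exact h₁ _ _ _
          · exact h₂ _ _ _ _
          · exact h₂ _ _ _ _

/-- The choices for the three input stacks. -/
def choices (x : Word) (f g : ℕ → Option Bool) : ℕ → ℕ → Option Bool
  | 0, i => x.reverse[i]?
  | 1, i => f i
  | _, i => g i

/-- The numbers of choices for the three input stacks. -/
def choiceCount (x : Word) (q : ℕ) : ℕ → ℕ
  | 0 => x.length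
  | _ => q

theorem config_zero (p : Prog) (x : Word) (q : ℕ) (f g : ℕ → Option Bool) :
    config p (choices x f g) (choiceCount x q) 0 =
      ([p], initStacks [x, decode q f, decode q g]) := by
  simp only [config, Function.iterate_zero, id_eq, Prod.mk.injEq, true_and]
  funext r
  rcases r with _ | _ | _ | r
  · have h := range_filterMap_getElem? x.reverse
    rw [List.length_reverse] at h
    change (List.filterMap (fun i => x.reverse[i]?) (List.range x.length)).reverse = x
    rw [h, List.reverse_reverse]
  · rfl
  · rfl
  · simp [initStacks]

/-- A halted configuration never changes, so an accepting one at any time equals the final one,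
which is reached within `2 * T` small steps. -/
theorem reaches_iff {p : Prog} {x : Word} {q T : ℕ} {f g : ℕ → Option Bool}
    (h : HaltsWithin ∅ p [x, decode q f, decode q g] T) :
    (Reaches p (choices x f g) (choiceCount x q) ↔ Accepts ∅ p [x, decode q f, decode q g]) ∧
    (Reaches p (choices x f g) (choiceCount x q) → ∃ t ≤ 2 * T,
      (config p (choices x f g) (choiceCount x q) t).1 = [] ∧
      (config p (choices x f g) (choiceCount x q) t).2 0 = [true]) := by
  obtain ⟨s, t, he, ht⟩ := h
  obtain ⟨n, hn, hc⟩ := exists_iterate_smallStep he []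
  have hcfg : config p (choices x f g) (choiceCount x q) n = ([], s) := by
    rw [← hc]
    have : ∀ n, config p (choices x f g) (choiceCount x q) n =
      smallStep^[n] (config p (choices x f g) (choiceCount x q) 0) := fun _ => rfl
    rw [this, config_zero]
  have hreach : Reaches p (choices x f g) (choiceCount x q) → s 0 = [true] := by
    rintro ⟨k, h1, h2⟩
    have e1 := config_add_of_nil h1 n
    have e2 := config_add_of_nil (t := n) (by rw [hcfg]) k
    rw [add_comm, e2, hcfg] at e1
    rw [← e1] at h2
    exact h2
  refine ⟨⟨fun h => ⟨s, t, he, hreach h⟩, ?_⟩, fun h => ⟨n, by omega, by rw [hcfg],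
    by rw [hcfg]; exact hreach h⟩⟩
  rintro ⟨s', t', he', h0⟩
  refine ⟨n, by rw [hcfg], ?_⟩
  rw [hcfg, (he.det he').1]
  exact h0

/-- Saturation turns minimal models into `∃ f, ∀ g`, and `decode` turns choices into words. The
bound `B` exceeds every position, height and time that can occur. -/
theorem exists_minModel_allRules_iff {idx : List Prog → ℕ} {K : ℕ} {p : Prog} {x : Word}
    {q B T : ℕ} (hidx : Set.InjOn idx {k | k ∈ p.states}) (hK : 3 ≤ K)
    (hreg : ∀ q k, q :: k ∈ p.states → (q.control k).1 < K)
    (hT : ∀ y z : Word, y.length ≤ q → z.length ≤ q → HaltsWithin ∅ p [x, y, z] T)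
    (hB : x.length + q + 2 * T < B) :
    (∃ X, IsMinModel (allRules (computationSchemas idx K p) x q B) X ∧ [6] ∈ X) ↔
      ∃ y : Word, y.length ≤ q ∧ ∀ z : Word, z.length ≤ q → Accepts ∅ p [x, y, z] := by
  set S := computationSchemas idx K p with hS
  have hchoice : ∀ r i j o o', choiceAtom r i o = choiceAtom r j o' → i = j ∧ o = o' := by
    intro r i j o o' h
    simp only [choiceAtom, List.cons.injEq, and_true, true_and] at h
    exact ⟨h.1, optCode_injective h.2⟩
  rw [exists_minModel_iff _ (hornRules S x q B) q (choiceAtom 1) (choiceAtom 2) [6]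
    allRules_hold (hchoice 1) (by simp [choiceAtom])]
  rotate_left
  · intro r hr i o h
    simp only [hornRules, List.mem_append, List.mem_map, mem_instances] at hr
    rcases hr with (hr | ⟨s, -, rfl⟩) | ⟨s, hs, v, -, rfl⟩
    · simp only [endFacts, List.mem_cons, List.not_mem_nil, or_false] at hr
      rcases hr with rfl | rfl | rfl <;> simp [choiceAtom] at h
    · simp [inputFact, choiceAtom] at h
    · refine (computationSchemas_head hs v).1 ?_
      change evalAtom v s.2 = _ at h
      rw [h]; rfl
  · intro i hi o
    simp only [hornRules, List.mem_append, mem_instances]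
    refine Or.inr ⟨([aWin], aChoice 2 (var 0) o), ?_, ![i, 0, 0], fun j => ?_, ?_⟩
    · rw [hS]
      simp only [computationSchemas, List.mem_append]
      refine Or.inl (Or.inr (List.mem_map.2 ⟨o, ?_, rfl⟩))
      rcases o with _ | _ | _ <;> simp
    · fin_cases j <;> simp <;> omega
    · simp [Schema.eval, evalAtom, aWin, aChoice, choiceAtom]
  have key : ∀ f g : ℕ → Option Bool, (∀ Z : Set (List ℕ), HClosed (hornRules S x q B) Z →
      (∀ i < q, choiceAtom 1 i (f i) ∈ Z) → (∀ i < q, choiceAtom 2 i (g i) ∈ Z) → [6] ∈ Z) ↔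
      Accepts ∅ p [x, decode q f, decode q g] := by
    intro f g
    obtain ⟨hacc, hwithin⟩ := reaches_iff (hT _ _ (length_decode_le q f) (length_decode_le q g))
    rw [← hacc]
    constructor
    · intro h
      by_contra hn
      -- Without acceptance the true atoms are a closed set that contains the choices but not `[6]`.
      refine hn (h {a | TrueAtom idx p (choices x f g) (choiceCount x q) a} ?_ ?_ ?_)
      · intro r hr hb
        simp only [hornRules, List.mem_append, List.mem_map, mem_instances] at hr
        rcases hr with (hr | ⟨s, hs, rfl⟩) | ⟨s, hs, v, -, rfl⟩
        · simp only [endFacts, List.mem_cons, List.not_mem_nil, or_false] at hr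
          rcases hr with rfl | rfl | rfl <;> rfl
        -- In a suffix `b :: s` of the input, `s.length` is the position of `b` counted from the
        -- bottom of the stack.
        · obtain ⟨hne, u, rfl⟩ := mem_suffixes.1 hs
          rcases s with _ | ⟨b, s⟩
          · exact absurd rfl hne
          · refine ⟨?_, ?_⟩
            · simp [choiceCount]; omega
            · simp only [choices, List.reverse_append, List.reverse_cons, List.tail_cons,
                List.headI_cons]
              rw [List.getElem?_append_left (by simp), ← List.length_reverse,
                List.getElem?_concat_length]
              rfl
        · refine computationSchemas_sound hidx hn hs v fun a ha => ?_
          exact hb _ (List.mem_map_of_mem ha)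
      · exact fun i hi => ⟨hi, rfl⟩
      · exact fun i hi => ⟨hi, rfl⟩
    · intro h Z hZ hf hg
      obtain ⟨t, ht, h1, h2⟩ := hwithin h
      refine win_mem (idx := idx) (K := K) (F := choices x f g) (len := choiceCount x q) (B := B)
        (N := 2 * T) ?_ hK hreg ?_ ?_ ?_ ht h1 h2
      · intro s hs v hv hb
        refine hZ (s.eval v) ?_ ?_
        · simp only [hornRules, List.mem_append, mem_instances]
          exact Or.inr ⟨s, hs, v, hv, rfl⟩
        · intro a ha
          obtain ⟨c, hc, e⟩ := List.mem_map.1 ha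
          exact e ▸ hb c hc
      · intro r hr
        refine hZ ([], [5, r, choiceCount x q r]) ?_ (by simp)
        simp only [hornRules, List.mem_append]
        refine Or.inl (Or.inl ?_)
        interval_cases r <;> simp [endFacts, choiceCount]
      · intro r hr i hi
        obtain rfl | rfl | rfl : r = 0 ∨ r = 1 ∨ r = 2 := by omega
        · simp only [choiceCount] at hi
          -- This suffix has a tail of length `i`, so its fact is the one about position `i`.
          have hd : x.drop (x.length - 1 - i) ≠ [] := by
            rw [ne_eq, List.drop_eq_nil_iff]; omega
          have hmem : x.drop (x.length - 1 - i) ∈ suffixes x :=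
            mem_suffixes.2 ⟨hd, List.drop_suffix _ _⟩
          have := hZ (inputFact (x.drop (x.length - 1 - i))) (by
            simp only [hornRules, List.mem_append]
            exact Or.inl (Or.inr (List.mem_map_of_mem hmem))) (by simp [inputFact])
          have e1 : (x.drop (x.length - 1 - i)).tail.length = i := by simp; omega
          have e2 : x.reverse[i]? = some (x.drop (x.length - 1 - i)).headI := by
            have hi' : x.length - 1 - i < x.length := by omega
            rw [List.getElem?_reverse hi, List.drop_eq_getElem_cons hi', List.headI_cons,
              List.getElem?_eq_getElem hi']
          simp only [inputFact, e1] at this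
          simp only [choices, e2, optCode]
          exact this
        · exact hf i hi
        · exact hg i hi
      · intro r hr
        interval_cases r <;> simp only [choiceCount] <;> omega
  simp only [key]
  constructor
  · rintro ⟨f, hf⟩
    refine ⟨decode q f, length_decode_le q f, fun z hz => ?_⟩
    obtain ⟨g, rfl⟩ := exists_decode hz
    exact hf g
  · rintro ⟨y, hy, h⟩
    obtain ⟨f, rfl⟩ := exists_decode hy
    exact ⟨f, fun g => h _ (length_decode_le q g)⟩

theorem bad_notMem_heads {idx : List Prog → ℕ} {K : ℕ} {p : Prog} {x : Word} {q B : ℕ} :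
    ∀ r ∈ allRules (computationSchemas idx K p) x q B, [7] ∉ r.heads := by
  intro r hr
  simp only [allRules, List.mem_append, List.mem_map, List.mem_flatMap] at hr
  rcases hr with ⟨r, hr, rfl⟩ | ⟨i, -, hr⟩
  · simp only [ofHorn, PRule.heads, List.mem_singleton]
    simp only [hornRules, List.mem_append, List.mem_map, mem_instances] at hr
    rcases hr with (hr | ⟨s, -, rfl⟩) | ⟨s, hs, v, -, rfl⟩
    · simp only [endFacts, List.mem_cons, List.not_mem_nil, or_false] at hr
      rcases hr with rfl | rfl | rfl <;> simp
    · simp [inputFact]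
    · exact fun h => (computationSchemas_head hs v).2 h.symm
  · simp only [List.mem_cons, List.not_mem_nil, or_false] at hr
    rcases hr with rfl | rfl <;> simp [choiceRule, PRule.heads, choiceAtom]

/-! ## Hardness -/

/-- Atoms with numbers as arguments. -/
def toAtom (l : List ℕ) : Atom := ([], l.map unary)

theorem toAtom_injective : Function.Injective toAtom := fun _ _ h =>
  List.map_injective_iff.2 unary_injective (Prod.ext_iff.1 h).2

/-- The word for an atom in a rule. -/
def litWord (l : List ℕ) : Word := signedCode (true, toAtom l)

/-- The word for a rule. -/
def ruleWord (r : PRule (List ℕ)) : Word := (dbMCS []).groundCode (r.toDB toAtom).ground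

theorem ruleWord_eq (r : PRule (List ℕ)) : ruleWord r = encList [encList (r.body.map litWord),
    encList (r.heads.map litWord), encList (r.heads.map litWord)] := by
  simp only [ruleWord, CodedMCS.groundCode, DBAIC.ground, PRule.toDB, List.map_map]
  rfl

/-- Instances of rules with variables. -/
def PRule.eval (R : PRule (List Term)) (v : Fin 3 → ℕ) : PRule (List ℕ) :=
  ⟨R.body.map (evalAtom v), evalAtom v R.first, R.rest.map (evalAtom v)⟩

/-! ### Writing rules in polynomial time. -/

section Generator

variable {A : Set Word} {α : Type*} {D : α → Prop} {E : List (α → Word)}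

theorem Computes.encList_append {l k : α → List Word}
    (hl : Computes A D E fun a => encList (l a)) (hk : Computes A D E fun a => encList (k a)) :
    Computes A D E fun a => encList (l a ++ k a) :=
  (hl.append hk).congr fun _ _ => (MCSRepair.encList_append _ _).symm

theorem Computes.encList_map {γ : Type*} {G : α → γ → Word} : ∀ l : List γ,
    (∀ c ∈ l, Computes A D E fun a => G a c) → Computes A D E fun a => encList (l.map (G a))
  | [], _ => Computes.encList_nil
  | c :: l, h => Computes.encList_cons (h c List.mem_cons_self)
      (Computes.encList_map l fun d hd => h d (List.mem_cons_of_mem _ hd))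

section

variable {v : α → Fin 3 → ℕ}

theorem Computes.unary_term (hv : ∀ i, Computes A D E fun a => unary (v a i)) (t : Term) :
    Computes A D E fun a => unary (t.eval (v a)) := by
  obtain ⟨n, l⟩ := t
  simp only [Term.eval, unary_add]
  refine (Computes.const _).append ?_
  induction l with
  | nil => exact Computes.const _
  | cons i l ih =>
      simp only [List.map_cons, List.sum_cons, unary_add]
      exact (hv i).append ih

theorem Computes.litWord (hv : ∀ i, Computes A D E fun a => unary (v a i))
    (l : List Term) :
    Computes A D E fun a => litWord (evalAtom (v a) l) := by
  have h : Computes A D E fun a => encList (l.map fun t => unary (t.eval (v a))) :=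
    Computes.encList_map l fun t _ => Computes.unary_term hv t
  refine ((Computes.encList_cons Computes.nil h).cons true).congr fun a _ => ?_
  simp only [MCSRepair.litWord, signedCode, atomCode, toAtom, evalAtom, List.map_map]
  rfl

theorem Computes.ruleWord (hv : ∀ i, Computes A D E fun a => unary (v a i))
    (R : PRule (List Term)) :
    Computes A D E fun a => ruleWord (R.eval (v a)) := by
  have h : ∀ l : List (List Term),
      Computes A D E fun a => encList (l.map fun t => MCSRepair.litWord (evalAtom (v a) t)) :=
    fun l => Computes.encList_map l fun t _ => Computes.litWord hv t
  refine (Computes.encList_cons (h R.body) (Computes.encList_cons (h R.heads)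
    (Computes.encList_cons (h R.heads) Computes.encList_nil))).congr fun a _ => ?_
  simp only [ruleWord_eq, PRule.eval, PRule.heads, List.map_map, List.map_cons]
  rfl

end

theorem below_succ (n : ℕ) : below (n + 1) = n :: below n := by
  simp [below, List.range_succ]

/-- The suffix of length `i + 1` stands for `i`. Suffixes come longest first, which is why `below`
lists numbers in descending order. -/
theorem suffixes_unary_flatMap {γ : Type*} (G : ℕ → List γ) : ∀ n,
    (suffixes (unary n)).flatMap (fun b => G b.tail.length) = (below n).flatMap G
  | 0 => rfl
  | n + 1 => by
      have h : suffixes (unary (n + 1)) = unary (n + 1) :: suffixes (unary n) := rfl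
      rw [h, below_succ, List.flatMap_cons, List.flatMap_cons, suffixes_unary_flatMap G n,
        unary_tail, length_unary, Nat.add_sub_cancel]

theorem Computes.flatMap_below {n : α → ℕ} {G : α → ℕ → List Word}
    (hn : Computes A D E fun a => unary (n a))
    (hG : Computes A (fun p : α × ℕ => D p.1) ((fun p => unary p.2) :: E.map (· ∘ Prod.fst))
      fun p => encList (G p.1 p.2)) :
    Computes A D E fun a => encList ((below (n a)).flatMap (G a)) := by
  have h := Computes.flatMap (F := fun a b => encList (G a b.tail.length)) hn.suffixes ?_
  · refine h.congr fun a _ => ?_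
    rw [parseList_encList, encList_flatMap, suffixes_unary_flatMap fun i => encList (G a i)]
  · have h1 : Computes A (fun p : α × Word => D p.1 ∧
        p.2 ∈ parseList (encList (MCSRepair.suffixes (unary (n p.1)))))
        ((fun p => unary p.2.tail.length) :: E.map (· ∘ Prod.fst))
        fun p => encList (G p.1 p.2.tail.length) := by
      refine ((Trans.reindex hG fun p : α × Word => (p.1, p.2.tail.length)).mono
        fun p hp => hp.1).congr (fun p _ => ?_) fun p _ => ?_
      · simp [vals]
      · rfl
    refine Computes.subst h1 fun g hg => ?_
    rcases List.mem_cons.1 hg with rfl | hg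
    · exact (Computes.var (f := Prod.snd) (by simp)).tail.unary_length
    · exact Computes.var (List.mem_cons_of_mem _ hg)

end Generator

section Rules

variable {A : Set Word} {α : Type*} {D : α → Prop} {E : List (α → Word)}

theorem Computes.endFacts {x : α → Word} {q : α → ℕ} (hx : Computes A D E x)
    (hq : Computes A D E fun a => unary (q a)) :
    Computes A D E fun a =>
      encList ((endFacts (x a) (q a)).map fun r => MCSRepair.ruleWord (ofHorn r)) := by
  have h : ∀ (r : ℕ) (n : α → ℕ), Computes A D E (fun a => unary (n a)) →
      Computes A D E fun a => MCSRepair.ruleWord (ofHorn ([], [5, r, n a])) := fun r n hn =>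
    (Computes.ruleWord (v := fun a _ => n a) (fun _ => hn)
      ⟨[], [Term.num 5, Term.num r, Term.var 0], []⟩).congr fun a _ => by
        simp [PRule.eval, evalAtom, ofHorn]
  exact Computes.encList_cons (h 0 _ hx.unary_length) (Computes.encList_cons (h 1 _ hq)
    (Computes.encList_cons (h 2 _ hq) Computes.encList_nil))

theorem Computes.inputFact {s : α → Word} (hs : Computes A D E s) :
    Computes A D E fun a => MCSRepair.ruleWord (ofHorn (inputFact (s a))) := by
  have h : ∀ b : ℕ, Computes A D E fun a =>
      MCSRepair.ruleWord (ofHorn ([], [3, 0, (s a).tail.length, b])) := fun b =>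
    (Computes.ruleWord (v := fun a _ => (s a).tail.length) (fun _ => hs.tail.unary_length)
      ⟨[], [Term.num 3, Term.num 0, Term.var 0, Term.num b], []⟩).congr fun a _ => by
        simp [PRule.eval, evalAtom, ofHorn]
  refine Computes.case hs (((h 0).mono fun a ha => ha.1).congr fun a ha => ?_)
    (((h 0).mono fun a ha => ha.1).congr fun a ha => ?_)
    (((h 1).mono fun a ha => ha.1).congr fun a ha => ?_)
  all_goals
    obtain ⟨-, ha⟩ := ha
    rcases h : s a with _ | ⟨b, w⟩ <;> simp_all [MCSRepair.inputFact]

/-- Three nested loops over the numbers below `B`; the list `S` is fixed and is unrolled in the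
program. -/
theorem Computes.instances (S : List Schema) {B : α → ℕ}
    (hB : Computes A D E fun a => unary (B a)) :
    Computes A D E fun a =>
      encList ((instances S (B a)).map fun r => MCSRepair.ruleWord (ofHorn r)) := by
  simp only [MCSRepair.instances, List.map_flatMap, List.map_map]
  have hB1 := hB.lift (fun p : α × ℕ => D p.1) (fun _ h => h) fun p => unary p.2
  have hB2 := hB1.lift (fun p : (α × ℕ) × ℕ => D p.1.1) (fun _ h => h) fun p => unary p.2
  refine hB.flatMap_below (hB1.flatMap_below (hB2.flatMap_below ?_))
  refine Computes.encList_map S fun s _ => ?_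
  have hv : ∀ i, Computes A (fun p : ((α × ℕ) × ℕ) × ℕ => D p.1.1.1)
      ((fun p => unary p.2) :: ((fun p : (α × ℕ) × ℕ => unary p.2) ::
        ((fun p : α × ℕ => unary p.2) :: E.map (· ∘ Prod.fst)).map (· ∘ Prod.fst)).map
          (· ∘ Prod.fst))
      fun p => unary ((![p.1.1.2, p.1.2, p.2] : Fin 3 → ℕ) i) := by
    intro i
    fin_cases i
    · exact Computes.var (List.mem_cons_of_mem _ (List.mem_cons_of_mem _ List.mem_cons_self))
    · exact Computes.var (List.mem_cons_of_mem _ List.mem_cons_self)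
    · exact Computes.var List.mem_cons_self
  exact Computes.ruleWord hv (⟨s.1, s.2, []⟩ : PRule (List Term))

theorem Computes.choiceRules {q : α → ℕ} (hq : Computes A D E fun a => unary (q a)) :
    Computes A D E fun a => encList (((below (q a)).flatMap fun i =>
      [choiceRule (choiceAtom 1 i), choiceRule (choiceAtom 2 i)]).map MCSRepair.ruleWord) := by
  simp only [List.map_flatMap]
  refine hq.flatMap_below ?_
  have h : ∀ r, Computes A (fun p : α × ℕ => D p.1)
      ((fun p => unary p.2) :: E.map (· ∘ Prod.fst))
      fun p => MCSRepair.ruleWord (choiceRule (choiceAtom r p.2)) := fun r =>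
    (Computes.ruleWord (v := fun p _ => p.2) (fun _ => Computes.var (by simp))
      (choiceRule (aChoice r (Term.var 0)))).congr fun p _ => by
        simp [PRule.eval, evalAtom, choiceRule, aChoice, choiceAtom]
  exact Computes.encList_cons (h 1) (Computes.encList_cons (h 2) Computes.encList_nil)

theorem Computes.allRules (S : List Schema) {x : α → Word} {q B : α → ℕ} (hx : Computes A D E x)
    (hq : Computes A D E fun a => unary (q a)) (hB : Computes A D E fun a => unary (B a)) :
    Computes A D E fun a =>
      encList ((allRules S (x a) (q a) (B a)).map MCSRepair.ruleWord) := by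
  simp only [MCSRepair.allRules, hornRules, List.map_append, List.map_map]
  refine Computes.encList_append (Computes.encList_append (Computes.encList_append
    (Computes.endFacts hx hq) ?_) (Computes.instances S hB)) (Computes.choiceRules hq)
  refine (Computes.flatMap (F := fun _ b => MCSRepair.encWord
    (MCSRepair.ruleWord (ofHorn (MCSRepair.inputFact b)))) hx.suffixes
    (Computes.inputFact (Computes.var (by simp))).encWord).congr fun a _ => ?_
  rw [parseList_encList, encList_eq_flatMap, List.flatMap_map]
  rfl

end Rules

theorem exists_input_of_database {C : MCSClass} {name : C.Name} (h : C.mcs name = dbMCS [])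
    (l : List DBAIC) : ∃ x : C.Input, x.IsDatabaseInput ∧
      x.encode = encList [C.code name, encList (l.map fun d => (dbMCS []).groundCode d.ground)] ∧
      ∀ m, x.HasRepair m ↔ HasGroundedRepair m (dbMCS []).toMCS (l.map DBAIC.toAIC) := by
  -- The types of the data depend on `C.mcs name`, which is not a variable; the equality can be
  -- eliminated once it is generalized to `M`.
  have aux : ∀ (M : CodedMCS) (h : M = dbMCS []), ∃ (aics : List (AIC M.toFrame))
      (ground : List (GroundAIC M.toFrame)), (∀ g, g ∈ ground ↔ g ∈ groundInstances aics) ∧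
      (∀ r ∈ aics, ∃ d : DBAIC,
        cast (congrArg (fun E : CodedMCS => AIC E.toFrame) h) r = d.toAIC) ∧
      ground.map M.groundCode = (l.map fun d => (dbMCS []).groundCode d.ground) ∧
      ∀ m, HasGroundedRepair m M.toMCS aics ↔
        HasGroundedRepair m (dbMCS []).toMCS (l.map DBAIC.toAIC) := by
    rintro _ rfl
    refine ⟨l.map DBAIC.toAIC, l.map DBAIC.ground, fun g => ?_, fun r hr => ?_, ?_,
      fun m => Iff.rfl⟩
    · rw [groundInstances_toAIC]; rfl
    · obtain ⟨d, -, rfl⟩ := List.mem_map.1 hr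
      exact ⟨d, rfl⟩
    · rw [List.map_map]; rfl
  obtain ⟨aics, ground, h1, h2, h3, h4⟩ := aux _ h
  refine ⟨⟨name, aics, ground, h1⟩, ⟨[], h, h2⟩, ?_, h4⟩
  simp only [MCSClass.Input.encode, h3]

/-- The numbers need not be computed: the states of a fixed program are constants of the reduction.
-/
theorem exists_numbering (l : List (List Prog)) :
    ∃ idx : List Prog → ℕ, Set.InjOn idx {k | k ∈ l} := by
  exact Set.countable_iff_exists_injOn.1 (List.finite_toSet l).countable

theorem exists_control_bound (l : List (List Prog)) :
    ∃ K, 3 ≤ K ∧ ∀ q k, q :: k ∈ l → (q.control k).1 < K := by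
  induction l with
  | nil => exact ⟨3, le_rfl, by simp⟩
  | cons k₀ l ih =>
      obtain ⟨K, h3, hK⟩ := ih
      rcases k₀ with _ | ⟨q₀, k₀⟩
      · exact ⟨K, h3, fun q k h => hK q k (by simpa using h)⟩
      · refine ⟨max K ((q₀.control k₀).1 + 1), le_max_of_le_left h3, fun q k h => ?_⟩
        rcases List.mem_cons.1 h with h | h
        · cases h; exact lt_max_of_lt_right (Nat.lt_succ_self _)
        · exact lt_max_of_lt_left (hK q k h)

theorem hardness (m : Mode) (C : MCSClass) (hC : C.ContainsDatabases) :
    Sigma2Hard (fun x : {x : C.Input // x.IsDatabaseInput} => x.1.encode)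
      (fun x : {x : C.Input // x.IsDatabaseInput} => x.1.HasRepair m) := by
  rintro L ⟨p, T, Q, hp⟩
  beta_reduce at hp
  -- Every instance produced has the empty database, whose code is a constant of the reduction.
  obtain ⟨name, -, hname⟩ := hC
  obtain ⟨idx, hidx⟩ := exists_numbering p.states
  obtain ⟨K, hK, hreg⟩ := exists_control_bound p.states
  -- `T'` bounds the running time once `y` and `z` have length at most `Q`, and `2 * T'` the number
  -- of small steps.
  let T' : Polynomial ℕ := T.comp (Polynomial.X + 2 * Q)
  let B : Polynomial ℕ := Polynomial.X + Q + 2 * T' + 1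
  let P : Word → List (PRule (List ℕ)) := fun x =>
    allRules (computationSchemas idx K p) x (Q.eval x.length) (B.eval x.length)
  choose f hdb henc hrep using fun x : Word =>
    exists_input_of_database (hname []) (dbRules toAtom (P x) [6] [7])
  have two : ∀ n : ℕ, Polynomial.eval n (2 : Polynomial ℕ) = 2 := fun n => by
    rw [← Polynomial.C_ofNat, Polynomial.eval_C]
  refine ⟨fun x => ⟨f x, hdb x⟩, ?_, fun x => ?_⟩
  · have hx : Computes ∅ (fun _ : Word => True) [fun x => x] fun x => x := Computes.var (by simp)
    have h : Computes ∅ (fun _ : Word => True) [fun x => x] fun x => (f x).encode := by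
      refine (Computes.encList_cons (Computes.const (C.code (name []))) (Computes.encList_cons
        (Computes.encList_cons (Computes.const
            ((dbMCS []).groundCode (requireDB toAtom [6] [7]).ground))
          (Computes.encList_cons (Computes.const
            ((dbMCS []).groundCode (forbidDB toAtom [7]).ground))
          (Computes.allRules (computationSchemas idx K p) hx (hx.unary_eval Q)
            (hx.unary_eval B)))) Computes.encList_nil)).congr fun x _ => ?_
      simp only [henc, dbRules, List.map_cons, List.map_map]
      rfl
    obtain ⟨r, R, hr⟩ := h
    refine ⟨r, R, fun x => ?_⟩
    obtain ⟨t, ht, he⟩ := hr x trivial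
    refine ⟨_, t, he, ?_, rfl⟩
    simpa [vals, size] using ht
  · refine (hp x).2.trans (Iff.trans ?_ (hrep x m).symm)
    rw [hasGroundedRepair_iff toAtom toAtom_injective m (P x) _ _ bad_notMem_heads]
    refine (exists_minModel_allRules_iff (T := T'.eval x.length) hidx hK hreg
      (fun y z hy hz => ?_) ?_).symm
    · obtain ⟨s, t, he, ht⟩ := (hp x).1 y z
      refine ⟨s, t, he, ht.trans ?_⟩
      simp only [T', Polynomial.eval_comp, Polynomial.eval_add, Polynomial.eval_X,
        Polynomial.eval_mul, two]
      exact eval_mono T (by omega)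
    · simp only [B, Polynomial.eval_add, Polynomial.eval_X, Polynomial.eval_mul, two,
        Polynomial.eval_one]
      omega

end MCSRepair

theorem mainTheorem5 (m : MCSRepair.Mode) (C : MCSRepair.MCSClass) :
    -- the depth of the repair tree is at most the size of the heads of the closed instances
    (∀ (x : C.Input) (k : ℕ) (node : ℕ → Set (MCSRepair.Action (C.mcs x.name).toFrame)),
      MCSRepair.IsTreePath m (C.mcs x.name).toMCS (MCSRepair.groundInstances x.aics) k node →
        k ≤ (x.ground.map fun g => g.head.length).sum) ∧
    -- membership, for every oracle `A` that decides satisfaction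
    (∀ A : Set MCSRepair.Word,
      MCSRepair.InP A MCSRepair.MCSClass.SatInput.encode
        (fun v : C.SatInput => v.Sat m) →
      MCSRepair.InCoNP A MCSRepair.MCSClass.Variant.encode
        (fun v : C.Variant => v.Consistent) →
      MCSRepair.InSigma2 A MCSRepair.MCSClass.Input.encode
        (fun x : C.Input => x.HasRepair m)) ∧
    -- hardness, already for databases
    (C.ContainsDatabases →
      MCSRepair.Sigma2Hard
        (fun x : {x : C.Input // x.IsDatabaseInput} => x.1.encode)
        (fun x : {x : C.Input // x.IsDatabaseInput} => x.1.HasRepair m)) :=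
  ⟨fun x _ _ h => MCSRepair.depth_le x.mem_ground h, fun A => MCSRepair.membership m A,
    MCSRepair.hardness m C⟩
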